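/- Let $n\ge 1$ and let $M=M^n$ be a connected, compact, closed, smooth manifold of dimension $n$ with a Riemannian metric $g$ and a fixed smooth triangulation: for $0\le l\le n$ a finite set $\Phi^l$ of smooth embeddings $\varphi:\Delta^l\to M$ of the standard simplex $\Delta^l=\{x\in\mathbb R^{l+1}: x_i\ge 0,\ \sum x_i=1\}$ (diffeomorphisms of a neighbourhood of $\Delta^l$ in its affine hull onto the image), such that $M$ is the disjoint union of the sets $\varphi(\operatorname{Int}\Delta^l)$, and $\varphi\circ\varepsilon_i\in\Phi^{l-1}$ for every $\varphi\in\Phi^l$ and every face map $\varepsilon_i$. Paint $\operatorname{Int}\delta_0=\varphi_0(\operatorname{Int}\Delta^n)$ white for an initial simplex $\varphi_0\in\Phi^n$, with centre $c_0$ (the image of the barycentre), put $P=\{\varphi_0\}$, $\psi=\varphi_0|_{\operatorname{Int}\Delta^n}$, and repeat the following step as long as possible. Choose $\varphi\in P$ and $\varphi'\in\Phi^n\setminus P$ with a common $(n-1)$-face whose inner part is not white (a black face); let $d$ be the centre of this face, $c$ the centre of $\varphi$, and $v'$ the vertex of $\varphi'$ opposite to the face. Decompose the subsimplex of $\varphi$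 spanned by $c$ and the face into intervals parallel to $cd$, and $\varphi'$ into intervals parallel to $dv'$ (in the linear structures of the simplexes). Each point of the face is then on one broken line consisting of an interval of the subsimplex, of length $s_1$, followed by an interval of $\varphi'$, of length $s_2$ (lengths in the standard simplex). Stretch the white points of the subsimplex along these broken lines, by sending the point at distance $s$ from the beginning to the point of the same broken line at distance $\frac{s_1+s_2}{s_1}s$ from the beginning, leave all other white points fixed, and replace $\psi$ by its composition with this map. Add $\varphi'$ to $P$ and paint the inner parts of the face and of $\varphi'$ white. When the process is finished, let $C=C^n$ be the set of white points, $K=K^{n-1}$ the union of the closed $(n-1)$-simplexes of the triangulation whose inner part is not white, and $\tilde M=M\setminus\{c_0\}$. Then $M=C\cup K$, $C\cap K=\emptyset$, and $\psi$ maps $\operatorname{Int}\Delta^n$ bijectively onto $C$. For $u\in\partial\Delta^n$ let $\gamma_u$ be the broken line that is the image under $\psi$ of the half-open interval from the barycentre of $\Delta^n$ to $u$ ($u$ excluded). Theorem 2. There is a continuous map $F:\tilde M\times[0,1]\to\tilde M$ such that - $F(x,0)=x$ and $F(x,1)\in K$ for every $x\in\tilde M$; - $F(z,t)=z$ for every $z\in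 K$ and $t\in[0,1]$; - if $x\in C\setminus\{c_0\}$ lies on the broken line $\gamma_u$, then $\gamma_u$ has a limit point $z\in K$ at its end, the length $s(x)$ (with respect to $g$) of the part of $\gamma_u$ from $x$ to $z$ is positive and finite, $F(x,1)=z$, and for $t<1$ the point $F(x,t)$ is the point of $\gamma_u$ from which the part of $\gamma_u$ up to $z$ has length $(1-t)s(x)$. So $K$ is a strong deformation retract of $\tilde M$. Consequently $\tilde M$ and $K$ are homotopy equivalent, and for every $k\ge 0$ their singular homology groups $H_k(\tilde M)$ and $H_k(K)$ (with coefficients in any abelian group) are isomorphic. -/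

import Mathlib

open Set Topology Filter
open scoped Bundle Manifold ContDiff unitInterval ContinuousMap

universe u

noncomputable section

/-! ### Standard simplexes -/

/-- The standard simplex of dimension `l`, in barycentric coordinates `(x₀, …, x_l)`. -/
abbrev Simplex (l : ℕ) : Type := stdSimplex ℝ (Fin (l + 1))

/-- The inner part of the standard simplex (for `l = 0` it is the whole point). -/
def simplexInterior (l : ℕ) : Set (Simplex l) := {y | ∀ j, 0 < y j}

/-- The boundary of the standard simplex. -/
def simplexBoundary (l : ℕ) : Set (Simplex l) := {y | ∃ j, y j = 0}

/-- The centre of the standard simplex. -/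
def simplexCentre (l : ℕ) : Simplex l := stdSimplex.barycenter

/-- The `i`-th face map: the linear map that sends the vertices `v₀, …, v_l` in order to
`v₀, …, v_{i-1}, v_{i+1}, …, v_{l+1}`. -/
def faceMap {l : ℕ} (i : Fin (l + 2)) : Simplex l → Simplex (l + 1) :=
  stdSimplex.map i.succAbove

/-- `c + r (u - c)` for the centre `c`: the point that divides the interval from the centre
to `u` in the ratio `r : (1 - r)`. -/
def radialPoint {l : ℕ} (u : Simplex l) (r : I) : Simplex l :=
  ⟨AffineMap.lineMap (simplexCentre l).1 u.1 (r : ℝ),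
    (convex_stdSimplex ℝ (Fin (l + 1))).lineMap_mem (simplexCentre l).2 u.2 r.2⟩

/-! ### Smooth triangulations -/

/-- `φ` is a smooth singular simplex of `M` in the sense of a diffeomorphism of an open
neighbourhood of the standard simplex (in its affine hyperplane `∑ xᵢ = 1`) onto its image in `M`:
it extends to a smooth map of an open set that is, on the hyperplane, injective with injective
differential. -/
def IsSmoothSimplex {n : ℕ} {M : Type u} [TopologicalSpace M]
    [ChartedSpace (EuclideanSpace ℝ (Fin n)) M] {l : ℕ} (φ : Simplex l → M) : Prop :=
  ∃ (U : Set (Fin (l + 1) → ℝ)) (f : (Fin (l + 1) → ℝ) → M),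
    IsOpen U ∧ stdSimplex ℝ (Fin (l + 1)) ⊆ U ∧ (∀ y : Simplex l, f y = φ y) ∧
    ContMDiffOn 𝓘(ℝ, Fin (l + 1) → ℝ) (𝓡 n) ∞ f U ∧
    InjOn f (U ∩ {x | ∑ j, x j = 1}) ∧
    ∀ x ∈ U, ∑ j, x j = 1 → ∀ v : Fin (l + 1) → ℝ, ∑ j, v j = 0 →
      mfderiv 𝓘(ℝ, Fin (l + 1) → ℝ) (𝓡 n) f x v = 0 → v = 0

/-- A smooth triangulation of an `n`-dimensional manifold: finite sets of smooth simplexes of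
dimensions `0, …, n`, closed under taking faces, such that `M` is the disjoint union of the images
of the inner parts of the standard simplexes. -/
structure SmoothTriangulation (n : ℕ) (M : Type u) [TopologicalSpace M]
    [ChartedSpace (EuclideanSpace ℝ (Fin n)) M] where
  /-- The simplexes of dimension `l`. -/
  simplexes : (l : ℕ) → Set (Simplex l → M)
  finite : ∀ l, (simplexes l).Finite
  eq_empty : ∀ l, n < l → simplexes l = ∅
  smooth : ∀ l, ∀ φ ∈ simplexes l, IsSmoothSimplex (n := n) φ
  face_mem : ∀ l, ∀ φ ∈ simplexes (l + 1), ∀ i, φ ∘ faceMap i ∈ simplexes l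
  partition : ∀ x : M, ∃! p : (l : ℕ) × (Simplex l → M),
    p.2 ∈ simplexes p.1 ∧ x ∈ p.2 '' simplexInterior p.1

/-! ### The broken lines through a common face

Fix the `i`-th face of the standard simplex of dimension `d + 1`, with centre `dᵢ`, opposite to
the vertex `vᵢ`. The interval from `dᵢ` to `vᵢ` contains the centre of the simplex. The simplex and
its subsimplex spanned by the centre and the face are decomposed into intervals parallel to
`vᵢ - dᵢ`, one through every point `q` of the face. Positions and lengths on these intervals are
measured in units of the length of `vᵢ - dᵢ`, which is the same for all faces of the standard
simplex. -/

/-- The point `q + τ (vᵢ - dᵢ)`, where `q` is a point of the `i`-th face. -/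
def chordVector {d : ℕ} (i : Fin (d + 2)) (q : Simplex d) (τ : ℝ) : Fin (d + 2) → ℝ :=
  i.insertNth τ (fun k => q k - τ / (d + 1))

theorem chordVector_eq {d : ℕ} (i : Fin (d + 2)) (q : Simplex d) (τ : ℝ) :
    chordVector i q τ =
      (faceMap i q).1 + τ • (Pi.single i 1 - (faceMap i (simplexCentre d)).1) := by
  have key : ∀ (q : Simplex d), (∀ k, (faceMap i q).1 (i.succAbove k) = q k) ∧
      (faceMap i q).1 i = 0 := by
    intro q
    constructor
    · intro k
      change FunOnFinite.linearMap ℝ ℝ i.succAbove q (i.succAbove k) = q k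
      rw [FunOnFinite.linearMap_apply_apply, Finset.sum_eq_single k]
      · intro b hb hbk
        exact absurd (Fin.succAbove_right_injective (Finset.mem_filter.1 hb).2) hbk
      · simp
    · change FunOnFinite.linearMap ℝ ℝ i.succAbove q i = 0
      rw [FunOnFinite.linearMap_apply_apply]
      refine Finset.sum_eq_zero fun b hb => ?_
      exact absurd (Finset.mem_filter.1 hb).2 (Fin.succAbove_ne i b)
  funext j
  refine Fin.succAboveCases i ?_ (fun k => ?_) j
  · simp [chordVector, (key q).2, (key (simplexCentre d)).2]
  · have hc : simplexCentre d k = ((d : ℝ) + 1)⁻¹ := by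
      change (stdSimplex.barycenter : stdSimplex ℝ (Fin (d + 1))).1 k = _
      rw [stdSimplex.barycenter_apply]; simp
    simp [chordVector, (key q).1, (key (simplexCentre d)).1, hc]
    ring

/-- The length of the interval over `q` in the subsimplex spanned by the face and the centre of the
simplex. -/
def innerLength {d : ℕ} (q : Simplex d) : ℝ := (d + 1) / (d + 2) * ⨅ k, q k

/-- The length of the interval over `q` in the whole simplex. -/
def outerLength {d : ℕ} (q : Simplex d) : ℝ := (d + 1) * ⨅ k, q k

theorem chordVector_mem {d : ℕ} (i : Fin (d + 2)) (q : Simplex d) {τ : ℝ} (h0 : 0 ≤ τ)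
    (h1 : τ ≤ outerLength q) : chordVector i q τ ∈ stdSimplex ℝ (Fin (d + 2)) := by
  refine ⟨fun j => ?_, ?_⟩
  · refine Fin.succAboveCases i ?_ (fun k => ?_) j
    · simpa [chordVector] using h0
    · have hk : (⨅ k, q k) ≤ q k := ciInf_le (Set.finite_range _).bddBelow k
      have hd : (0 : ℝ) < d + 1 := by positivity
      have : τ / (d + 1) ≤ ⨅ k, q k := by
        rw [div_le_iff₀ hd, mul_comm]; exact h1
      simp only [chordVector, Fin.insertNth_apply_succAbove]
      linarith
  · have hd : (d : ℝ) + 1 ≠ 0 := by positivity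
    have hq : ∑ k, q k = 1 := stdSimplex.sum_eq_one q
    rw [chordVector, Fin.sum_insertNth, Finset.sum_sub_distrib, hq]
    simp
    field_simp
    ring

theorem outerLength_nonneg {d : ℕ} (q : Simplex d) : 0 ≤ outerLength q :=
  mul_nonneg (by positivity) (Real.iInf_nonneg fun k => stdSimplex.zero_le q k)

/-- The point at the distance `τ` from the `i`-th face on the interval over `q`
(for `τ` outside `[0, outerLength q]` the nearer endpoint of the interval). -/
def chordPoint {d : ℕ} (i : Fin (d + 2)) (q : Simplex d) (τ : ℝ) : Simplex (d + 1) :=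
  ⟨chordVector i q (max 0 (min τ (outerLength q))),
    chordVector_mem i q (le_max_left _ _)
      (max_le (outerLength_nonneg q) (min_le_right _ _))⟩

/-- The point in which the parallel to `vᵢ - dᵢ` through `y` meets the `i`-th face. -/
def footPoint {d : ℕ} (i : Fin (d + 2)) (y : Simplex (d + 1)) : Simplex d :=
  ⟨fun k => y (i.succAbove k) + y i / (d + 1), by
    refine ⟨fun k => add_nonneg (stdSimplex.zero_le y _)
      (div_nonneg (stdSimplex.zero_le y _) (by positivity)), ?_⟩
    have hd : (d : ℝ) + 1 ≠ 0 := by positivity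
    have hy : ∑ j, y j = 1 := stdSimplex.sum_eq_one y
    rw [Fin.sum_univ_succAbove _ i] at hy
    rw [Finset.sum_add_distrib]
    simp
    field_simp
    linarith⟩

variable {d : ℕ} {M : Type u}

/-- The stretching along the broken lines for two simplexes `φ`, `φ'` of `M` with a common face,
opposite to the vertex `i` of `φ` and to the vertex `i'` of `φ'`. A point `y` of the subsimplex of
`φ` over the face lies on a broken line that consists of an interval in the subsimplex, which ends
in the face and has length `s₁`, and of an interval in `φ'`, which begins there and has length `s₂`.
If `s` is the distance from the beginning of the broken line to `y`, then the image of `y` is the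
point of the same broken line at the distance `(s₁ + s₂) / s₁ * s` from the beginning. -/
def stretchPoint (φ : Simplex (d + 1) → M) (i : Fin (d + 2)) (φ' : Simplex (d + 1) → M)
    (i' : Fin (d + 2)) (y : Simplex (d + 1)) : M :=
  let q := footPoint i y
  let s₁ := innerLength q
  let s₂ := outerLength q
  let s := s₁ - y i
  let s' := (s₁ + s₂) / s₁ * s
  if s' ≤ s₁ then φ (chordPoint i q (s₁ - s')) else φ' (chordPoint i' q (s' - s₁))

open Classical in
/-- The extension map: the stretching along broken lines on the points of the inner part of `φ`
that lie in the subsimplex spanned by the centre and the `i`-th face (in barycentric coordinates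
this is the set where the `i`-th coordinate is the least one), the identity elsewhere. -/
def extensionMap (φ : Simplex (d + 1) → M) (i : Fin (d + 2)) (φ' : Simplex (d + 1) → M)
    (i' : Fin (d + 2)) (x : M) : M :=
  if h : ∃ y ∈ simplexInterior (d + 1), (∀ j, y i ≤ y j) ∧ φ y = x then
    stretchPoint φ i φ' i' h.choose
  else x

variable [TopologicalSpace M] [ChartedSpace (EuclideanSpace ℝ (Fin (d + 1))) M]

/-! ### The extension of the coordinate neighbourhood -/

/-- `CellExtension T φ₀ P W f`: some finite number of steps of the extension process that begins
with the simplex `φ₀` leads to the canonical polyhedron with set `P` of simplexes of maximal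
dimension, to the set `W` of white points (its inner points) and to the map `f`, the composition of
the extension maps of the steps. In a step a simplex `φ ∈ P` is chosen that has a black face which
is also a face of an unpainted simplex `φ'`; the inner points of the face and of `φ'` become
white. -/
inductive CellExtension (T : SmoothTriangulation (d + 1) M) (φ₀ : Simplex (d + 1) → M) :
    Set (Simplex (d + 1) → M) → Set M → (M → M) → Prop
  | init : CellExtension T φ₀ {φ₀} (φ₀ '' simplexInterior (d + 1)) id
  | step (P : Set (Simplex (d + 1) → M)) (W : Set M) (f : M → M)
      (φ : Simplex (d + 1) → M) (i : Fin (d + 2)) (φ' : Simplex (d + 1) → M) (i' : Fin (d + 2))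
      (run : CellExtension T φ₀ P W f)
      (mem : φ ∈ P)
      (black : Disjoint ((φ ∘ faceMap i) '' simplexInterior d) W)
      (simplex : φ' ∈ T.simplexes (d + 1))
      (unpainted : φ' ∉ P)
      (common : φ ∘ faceMap i = φ' ∘ faceMap i') :
      CellExtension T φ₀ (insert φ' P)
        (W ∪ (φ ∘ faceMap i) '' simplexInterior d ∪ φ' '' simplexInterior (d + 1))
        (extensionMap φ i φ' i' ∘ f)

/-- The process is finished: no black face of the polyhedron is a face of an unpainted simplex. -/
def IsFinished (T : SmoothTriangulation (d + 1) M) (P : Set (Simplex (d + 1) → M)) (W : Set M) :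
    Prop :=
  ∀ φ ∈ P, ∀ i, Disjoint ((φ ∘ faceMap i) '' simplexInterior d) W →
    ∀ φ' ∈ T.simplexes (d + 1), ∀ i', φ ∘ faceMap i = φ' ∘ faceMap i' → φ' ∈ P

/-- The complex `K`: the union of the (closed) simplexes of codimension one of the triangulation
whose inner part has no white point. -/
def blackComplex (T : SmoothTriangulation (d + 1) M) (W : Set M) : Set M :=
  ⋃ τ ∈ {τ ∈ T.simplexes d | Disjoint (τ '' simplexInterior d) W}, range τ

/-- The broken line with the direction `u` in the cell: the image under the extension `f` of the
interval of `φ₀` from its centre (parameter `0`) towards the boundary point `u` (parameter `1`).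
Only the parameters in `[0, 1)` are meaningful. -/
def brokenLine (φ₀ : Simplex (d + 1) → M) (f : M → M) (u : Simplex (d + 1)) (r : ℝ) : M :=
  f (φ₀ (radialPoint u (projIcc 0 1 zero_le_one r)))

end

/-!
A compact manifold with a smooth triangulation is an open cell, obtained by stretching one simplex
step by step over its neighbours, together with a complex of codimension one; the complement of the
centre of the cell is deformed into the complex along the images of the rays of the cell.

The proof follows the extension process with a map of the *closed* simplex. In a step, the lengths of
the two parts of a broken line have a ratio that does not depend on the line, so that the stretching
is piecewise linear in barycentric coordinates. If the points of the common face are moved to the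
ends of their broken lines, it becomes a map `closedStretch` of the whole polyhedron, and the
compositions of these maps form a characteristic map `g` of the cell (`IsCharacteristicMap`): it is
continuous and piecewise linear on the closed simplex, it agrees with the given map on the inner
part, which it maps bijectively onto the set of white points, and it maps the boundary to black
points. The last two properties survive a step because the common face lies in no third simplex of
maximal dimension (`SmoothTriangulation.eq_or_eq_of_common_face`): by the inverse function theorem,
two simplexes on the same side of a common face overlap.

When the process is finished, all simplexes of maximal dimension are painted, for a triangulated
connected manifold is strongly connected (`SmoothTriangulation.eq_simplexes_of_closed`): the union
of the painted simplexes and the union of the others are closed and would meet only in the skeleton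
of codimension two. That skeleton cannot separate a ball of a chart, since the cone over it has
Hausdorff dimension less than that of the manifold. As the simplexes of maximal dimension cover the
manifold (`SmoothTriangulation.iUnion_range_eq_univ`), every point is white or lies in a black face,
and `g` is onto.

On the closed simplex, the length of the image of the interval `[r, 1]` of the ray towards `u` is
finite, strictly decreasing in `r`, and continuous in `u` and `r`
(`HasLinearPieces.exists_length`). Hence the point of the ray at which the fraction `1 - t` of the
remaining length is left depends continuously on the starting point and on `t`. This motion fixes
the boundary, which contains all points that `g` identifies, so it descends along the proper
surjection `g` to the required homotopy (`IsCharacteristicMap.exists_deformation`). The statements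
on homotopy type and homology follow from homotopy invariance.
-/

/-! ### Coordinates on faces and chords -/

theorem faceMap_apply_succAbove {l : ℕ} (i : Fin (l + 2)) (q : Simplex l) (k : Fin (l + 1)) :
    faceMap i q (i.succAbove k) = q k := by
  change FunOnFinite.linearMap ℝ ℝ i.succAbove q (i.succAbove k) = q k
  rw [FunOnFinite.linearMap_apply_apply, Finset.sum_eq_single k]
  · intro b hb hbk
    exact absurd (Fin.succAbove_right_injective (Finset.mem_filter.1 hb).2) hbk
  · simp

theorem faceMap_apply_self {l : ℕ} (i : Fin (l + 2)) (q : Simplex l) : faceMap i q i = 0 := by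
  change FunOnFinite.linearMap ℝ ℝ i.succAbove q i = 0
  rw [FunOnFinite.linearMap_apply_apply]
  refine Finset.sum_eq_zero fun b hb => ?_
  exact absurd (Finset.mem_filter.1 hb).2 (Fin.succAbove_ne i b)

theorem simplex_ext {l : ℕ} {y z : Simplex l} (h : ∀ j, y j = z j) : y = z :=
  stdSimplex.ext (funext h)

theorem continuous_simplex_apply {l : ℕ} (j : Fin (l + 1)) : Continuous fun y : Simplex l => y j :=
  (continuous_apply j).comp continuous_subtype_val

theorem exists_faceMap_eq {l : ℕ} {y : Simplex (l + 1)} {i : Fin (l + 2)} (hy : y i = 0) :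
    ∃ z : Simplex l, faceMap i z = y ∧ ∀ k, z k = y (i.succAbove k) := by
  have hs : ∑ j, y j = 1 := stdSimplex.sum_eq_one y
  rw [Fin.sum_univ_succAbove _ i, hy, zero_add] at hs
  refine ⟨⟨fun k => y (i.succAbove k), fun k => stdSimplex.zero_le y _, hs⟩, ?_, fun k => rfl⟩
  refine simplex_ext fun j => ?_
  refine Fin.succAboveCases i ?_ (fun k => ?_) j
  · rw [faceMap_apply_self, hy]
  · rw [faceMap_apply_succAbove]; rfl

theorem not_mem_simplexInterior_iff {l : ℕ} {y : Simplex l} :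
    y ∉ simplexInterior l ↔ y ∈ simplexBoundary l := by
  simp only [simplexInterior, simplexBoundary, mem_ofPred_eq, not_forall]
  refine exists_congr fun j => ⟨fun h => ?_, fun h => by simp [h]⟩
  exact le_antisymm (not_lt.1 h) (stdSimplex.zero_le y j)

theorem simplexInterior_zero : simplexInterior 0 = univ := by
  refine eq_univ_of_forall fun y => ?_
  have hs : ∑ j, y j = 1 := stdSimplex.sum_eq_one y
  intro j
  rw [Fin.fin_one_eq_zero j]
  rw [Fin.sum_univ_one] at hs
  exact hs ▸ one_pos

theorem simplexCentre_apply {l : ℕ} (j : Fin (l + 1)) :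
    simplexCentre l j = ((l : ℝ) + 1)⁻¹ := by
  change (stdSimplex.barycenter : stdSimplex ℝ (Fin (l + 1))).1 j = _
  rw [stdSimplex.barycenter_apply]; simp

theorem simplexCentre_mem_interior (l : ℕ) : simplexCentre l ∈ simplexInterior l := fun j => by
  rw [simplexCentre_apply]; positivity

/-! ### Open and closed simplexes of a triangulation -/

section Triangulation

variable {n : ℕ} {M : Type u} [TopologicalSpace M] [ChartedSpace (EuclideanSpace ℝ (Fin n)) M]

theorem IsSmoothSimplex.injective {l : ℕ} {φ : Simplex l → M}
    (h : IsSmoothSimplex (n := n) φ) : Function.Injective φ := by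
  obtain ⟨U, f, -, hU, hf, -, hinj, -⟩ := h
  intro y z hyz
  refine Subtype.ext (hinj ⟨hU y.2, y.2.2⟩ ⟨hU z.2, z.2.2⟩ ?_)
  exact (hf y).trans (hyz.trans (hf z).symm)

theorem IsSmoothSimplex.continuous {l : ℕ} {φ : Simplex l → M}
    (h : IsSmoothSimplex (n := n) φ) : Continuous φ := by
  obtain ⟨U, f, -, hU, hf, hsm, -⟩ := h
  have : φ = fun y : Simplex l => f y := funext fun y => (hf y).symm
  rw [this]
  exact hsm.continuousOn.comp_continuous continuous_subtype_val fun y => hU y.2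

namespace SmoothTriangulation

variable (T : SmoothTriangulation n M)

/-- Two simplexes of a triangulation whose inner parts meet have the same dimension. -/
theorem dim_eq {l l' : ℕ} {φ : Simplex l → M} {φ' : Simplex l' → M} (hφ : φ ∈ T.simplexes l)
    (hφ' : φ' ∈ T.simplexes l') {y : Simplex l} {y' : Simplex l'} (hy : y ∈ simplexInterior l)
    (hy' : y' ∈ simplexInterior l') (h : φ y = φ' y') : l = l' := by
  have := (T.partition (φ y)).unique (y₁ := ⟨l, φ⟩) (y₂ := ⟨l', φ'⟩) ⟨hφ, y, hy, rfl⟩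
    ⟨hφ', y', hy', h.symm⟩
  exact congrArg Sigma.fst this

/-- Two simplexes of a triangulation of the same dimension whose inner parts meet are equal. -/
theorem simplex_eq {l : ℕ} {φ φ' : Simplex l → M} (hφ : φ ∈ T.simplexes l)
    (hφ' : φ' ∈ T.simplexes l) {y y' : Simplex l} (hy : y ∈ simplexInterior l)
    (hy' : y' ∈ simplexInterior l) (h : φ y = φ' y') : φ = φ' := by
  have := (T.partition (φ y)).unique (y₁ := ⟨l, φ⟩) (y₂ := ⟨l, φ'⟩) ⟨hφ, y, hy, rfl⟩
    ⟨hφ', y', hy', h.symm⟩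
  exact eq_of_heq (Sigma.mk.inj this).2

theorem injective {l : ℕ} {φ : Simplex l → M} (hφ : φ ∈ T.simplexes l) : Function.Injective φ :=
  (T.smooth l φ hφ).injective

theorem continuous {l : ℕ} {φ : Simplex l → M} (hφ : φ ∈ T.simplexes l) : Continuous φ :=
  (T.smooth l φ hφ).continuous

/-- Every point of a closed simplex lies in the inner part of a simplex of the triangulation, which
has a smaller dimension if the point is not an inner point. -/
theorem exists_open_face {l : ℕ} {φ : Simplex l → M} (hφ : φ ∈ T.simplexes l) (y : Simplex l) :
    ∃ l' ≤ l, ∃ ρ ∈ T.simplexes l', ∃ z ∈ simplexInterior l', ρ z = φ y ∧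
      range ρ ⊆ range φ ∧ (l' = l → y ∈ simplexInterior l) := by
  induction l with
  | zero =>
    exact ⟨0, le_rfl, φ, hφ, y, by simp [simplexInterior_zero], rfl, Subset.rfl,
      fun _ => by simp [simplexInterior_zero]⟩
  | succ l ih =>
    by_cases hy : y ∈ simplexInterior (l + 1)
    · exact ⟨l + 1, le_rfl, φ, hφ, y, hy, rfl, Subset.rfl, fun _ => hy⟩
    · obtain ⟨i, hi⟩ := not_mem_simplexInterior_iff.1 hy
      obtain ⟨z, rfl, -⟩ := exists_faceMap_eq hi
      obtain ⟨l', hl', ρ, hρ, w, hw, hwz, hr, -⟩ := ih (T.face_mem l φ hφ i) z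
      exact ⟨l', by omega, ρ, hρ, w, hw, hwz, hr.trans (range_comp_subset_range _ _),
        fun h => by omega⟩

/-- If a point of a closed simplex of dimension `l` is an inner point of a simplex of dimension at
least `l`, then it is an inner point of the former, too. -/
theorem mem_interior_of_eq {l l' : ℕ} {φ : Simplex l → M} {ρ : Simplex l' → M}
    (hφ : φ ∈ T.simplexes l) (hρ : ρ ∈ T.simplexes l') (hl : l ≤ l') {y : Simplex l}
    {z : Simplex l'} (hz : z ∈ simplexInterior l') (h : φ y = ρ z) : y ∈ simplexInterior l := by
  obtain ⟨l₁, hl₁, ρ₁, hρ₁, w, hw, hwy, -, hint⟩ := T.exists_open_face hφ y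
  have := T.dim_eq hρ₁ hρ hw hz (hwy.trans h)
  exact hint (by omega)

/-- If an inner point of a simplex `τ` lies in a closed simplex `φ` of the next dimension, then `τ`
is a face of `φ`. -/
theorem exists_face_eq {l : ℕ} {φ : Simplex (l + 1) → M} {τ : Simplex l → M}
    (hφ : φ ∈ T.simplexes (l + 1)) (hτ : τ ∈ T.simplexes l) {y : Simplex (l + 1)} {z : Simplex l}
    (hz : z ∈ simplexInterior l) (h : φ y = τ z) :
    ∃ i, φ ∘ faceMap i = τ ∧ y = faceMap i z := by
  have hy : y ∉ simplexInterior (l + 1) := fun hy => by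
    have := T.dim_eq hφ hτ hy hz h
    omega
  obtain ⟨i, hi⟩ := not_mem_simplexInterior_iff.1 hy
  obtain ⟨w, rfl, -⟩ := exists_faceMap_eq hi
  have hf := T.face_mem l φ hφ i
  have hw : w ∈ simplexInterior l := T.mem_interior_of_eq hf hτ le_rfl hz h
  have heq := T.simplex_eq hf hτ hw hz h
  refine ⟨i, heq, ?_⟩
  have : (φ ∘ faceMap i) w = (φ ∘ faceMap i) z := by
    rw [show (φ ∘ faceMap i) w = τ z from h, heq]
  rw [T.injective hf this]

/-- The faces of a simplex of the triangulation are distinct. -/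
theorem face_index_unique {l : ℕ} {φ : Simplex (l + 1) → M} (hφ : φ ∈ T.simplexes (l + 1))
    {i j : Fin (l + 2)} (h : φ ∘ faceMap i = φ ∘ faceMap j) : i = j := by
  by_contra hij
  have h1 := T.injective hφ (congrFun h (simplexCentre l))
  obtain ⟨k, hk⟩ := Fin.exists_succAbove_eq hij
  have h2 : faceMap j (simplexCentre l) i = 0 := h1 ▸ faceMap_apply_self i _
  rw [← hk, faceMap_apply_succAbove] at h2
  exact (simplexCentre_mem_interior l k).ne' h2

end SmoothTriangulation

end Triangulation

/-! ### Local coordinates -/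

/-- The affine parametrization of the hyperplane `∑ xⱼ = 1` by all coordinates but the `i`-th. -/
def hyperplaneParam {l : ℕ} (i : Fin (l + 1)) (a : Fin l → ℝ) : Fin (l + 1) → ℝ :=
  i.insertNth (1 - ∑ k, a k) a

theorem sum_hyperplaneParam {l : ℕ} (i : Fin (l + 1)) (a : Fin l → ℝ) :
    ∑ j, hyperplaneParam i a j = 1 := by
  rw [hyperplaneParam, Fin.sum_insertNth]; ring

theorem hyperplaneParam_simplex {l : ℕ} (i : Fin (l + 1)) (y : Simplex l) :
    hyperplaneParam i (fun k => y (i.succAbove k)) = y := by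
  have hs : ∑ j, y j = 1 := stdSimplex.sum_eq_one y
  rw [Fin.sum_univ_succAbove _ i] at hs
  funext j
  refine Fin.succAboveCases i ?_ (fun k => ?_) j
  · simp only [hyperplaneParam, Fin.insertNth_apply_same]; linarith
  · simp [hyperplaneParam]

/-- The linear part of `hyperplaneParam`. -/
noncomputable def hyperplaneDir {l : ℕ} (i : Fin (l + 1)) : (Fin l → ℝ) →L[ℝ] (Fin (l + 1) → ℝ) :=
  LinearMap.toContinuousLinearMap
    { toFun := fun v => i.insertNth (-∑ k, v k) v
      map_add' := fun v w => by
        funext j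
        refine Fin.succAboveCases i ?_ (fun k => ?_) j
        · simp [Finset.sum_add_distrib]; ring
        · simp
      map_smul' := fun c v => by
        funext j
        refine Fin.succAboveCases i ?_ (fun k => ?_) j
        · simp [Finset.mul_sum]
        · simp }

theorem hyperplaneDir_apply {l : ℕ} (i : Fin (l + 1)) (v : Fin l → ℝ) :
    hyperplaneDir i v = i.insertNth (-∑ k, v k) v := rfl

theorem hyperplaneParam_eq {l : ℕ} (i : Fin (l + 1)) (a : Fin l → ℝ) :
    hyperplaneParam i a = Pi.single i 1 + hyperplaneDir i a := by
  funext j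
  rw [hyperplaneDir_apply]
  refine Fin.succAboveCases i ?_ (fun k => ?_) j
  · simp [hyperplaneParam]; ring
  · simp [hyperplaneParam]

theorem hasFDerivAt_hyperplaneParam {l : ℕ} (i : Fin (l + 1)) (a : Fin l → ℝ) :
    HasFDerivAt (hyperplaneParam i) (hyperplaneDir i) a := by
  rw [show hyperplaneParam i = fun a => Pi.single i 1 + hyperplaneDir i a from
    funext (hyperplaneParam_eq i)]
  exact (hyperplaneDir i).hasFDerivAt.const_add _

theorem contDiff_hyperplaneParam {l : ℕ} (i : Fin (l + 1)) : ContDiff ℝ ∞ (hyperplaneParam i) := by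
  rw [show hyperplaneParam i = fun a => Pi.single i 1 + hyperplaneDir i a from
    funext (hyperplaneParam_eq i)]
  exact contDiff_const.add (hyperplaneDir i).contDiff

section Manifold

variable {n : ℕ} {M : Type u} [TopologicalSpace M] [ChartedSpace (EuclideanSpace ℝ (Fin n)) M]
  [IsManifold (𝓡 n) ∞ M]

/-- A smooth simplex, read in a chart of `M` and in all barycentric coordinates but the `i`-th, is
the restriction of a smooth immersion of an open set. -/
theorem IsSmoothSimplex.exists_local_coord {l : ℕ} {φ : Simplex l → M}
    (h : IsSmoothSimplex (n := n) φ) (i : Fin (l + 1)) (x₀ : M) :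
    ∃ (O : Set (Fin l → ℝ)) (g : (Fin l → ℝ) → EuclideanSpace ℝ (Fin n)),
      IsOpen O ∧ ContDiffOn ℝ ∞ g O ∧ (∀ a ∈ O, Function.Injective (fderiv ℝ g a)) ∧
      (∀ y : Simplex l, (fun k => y (i.succAbove k)) ∈ O ↔
        φ y ∈ (extChartAt (𝓡 n) x₀).source) ∧
      ∀ y : Simplex l, g (fun k => y (i.succAbove k)) = extChartAt (𝓡 n) x₀ (φ y) := by
  obtain ⟨U, f, hUo, hU, hf, hsm, -, hinj⟩ := h
  set χ := extChartAt (𝓡 n) x₀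
  have hpc : Continuous (hyperplaneParam i) := (contDiff_hyperplaneParam i).continuous
  have hO : IsOpen (hyperplaneParam i ⁻¹' (U ∩ f ⁻¹' χ.source)) :=
    (hsm.continuousOn.isOpen_inter_preimage hUo (isOpen_extChartAt_source x₀)).preimage hpc
  have hIM : IsManifold (𝓡 n) 1 M := IsManifold.of_le (n := ∞) (by norm_cast)
  refine ⟨hyperplaneParam i ⁻¹' (U ∩ f ⁻¹' χ.source), fun a => χ (f (hyperplaneParam i a)), hO,
    ?_, ?_, ?_, ?_⟩
  · rw [← contMDiffOn_iff_contDiffOn]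
    have h1 : ContMDiffOn (𝓡 n) 𝓘(ℝ, EuclideanSpace ℝ (Fin n)) ∞ χ (chartAt _ x₀).source :=
      contMDiffOn_extChartAt
    rw [← extChartAt_source (𝓡 n)] at h1
    have h2 : ContMDiffOn 𝓘(ℝ, Fin l → ℝ) 𝓘(ℝ, Fin (l + 1) → ℝ) ∞ (hyperplaneParam i)
        (hyperplaneParam i ⁻¹' (U ∩ f ⁻¹' χ.source)) :=
      (contDiff_hyperplaneParam i).contMDiff.contMDiffOn
    exact (h1.comp (hsm.mono inter_subset_left) fun y hy => hy.2).comp h2 fun a ha => ha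
  · intro a ha
    have hfd : MDifferentiableAt 𝓘(ℝ, Fin (l + 1) → ℝ) (𝓡 n) f (hyperplaneParam i a) :=
      ((hsm _ ha.1).contMDiffAt (hUo.mem_nhds ha.1)).mdifferentiableAt (by simp)
    have hχ : MDifferentiableAt (𝓡 n) 𝓘(ℝ, EuclideanSpace ℝ (Fin n)) χ
        (f (hyperplaneParam i a)) := mdifferentiableAt_extChartAt (by
          simpa [χ] using ha.2)
    have hp : HasMFDerivAt 𝓘(ℝ, Fin l → ℝ) 𝓘(ℝ, Fin (l + 1) → ℝ) (hyperplaneParam i) a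
        (hyperplaneDir i) := (hasFDerivAt_hyperplaneParam i a).hasMFDerivAt
    have hcomp := (hχ.hasMFDerivAt.comp _ hfd.hasMFDerivAt).comp a hp
    have hfdv : fderiv ℝ ((χ ∘ f) ∘ hyperplaneParam i) a = _ :=
      mfderiv_eq_fderiv.symm.trans hcomp.mfderiv
    have hinv : Function.Injective (mfderiv (𝓡 n) 𝓘(ℝ, EuclideanSpace ℝ (Fin n)) χ
        (f (hyperplaneParam i a))) :=
      (isInvertible_mfderiv_extChartAt ha.2).injective
    change Function.Injective (fderiv ℝ ((χ ∘ f) ∘ hyperplaneParam i) a)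
    refine (injective_iff_map_eq_zero _).2 fun v hv => ?_
    have hv' := (DFunLike.congr_fun hfdv v).symm.trans hv
    have h1 := hinv (a₁ := mfderiv 𝓘(ℝ, Fin (l + 1) → ℝ) (𝓡 n) f (hyperplaneParam i a)
      (hyperplaneDir i v)) (a₂ := 0) (hv'.trans (map_zero _).symm)
    have h2 := hinj _ ha.1 (sum_hyperplaneParam i a) _
      (by rw [hyperplaneDir_apply, Fin.sum_insertNth]; ring) h1
    funext k
    have := congrFun h2 (i.succAbove k)
    simpa [hyperplaneDir_apply] using this
  · intro y
    change hyperplaneParam i _ ∈ U ∧ f (hyperplaneParam i _) ∈ χ.source ↔ _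
    rw [hyperplaneParam_simplex i y]
    exact ⟨fun h => hf y ▸ h.2, fun h => ⟨hU y.2, (hf y).symm ▸ h⟩⟩
  · intro y
    change χ (f (hyperplaneParam i _)) = _
    rw [hyperplaneParam_simplex i y]
    exact congrArg χ (hf y)

/-! ### Images of small dimension -/

/-- A continuously differentiable map is locally Lipschitz, hence it does not raise the Hausdorff
dimension. -/
theorem dimH_image_lt_of_contDiffOn {E F : Type*} [NormedAddCommGroup E] [NormedSpace ℝ E]
    [FiniteDimensional ℝ E] [NormedAddCommGroup F] [NormedSpace ℝ F] {O : Set E}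
    (hO : IsOpen O) {h : E → F} (hh : ContDiffOn ℝ 1 h O) {k : ℕ}
    (hk : Module.finrank ℝ E < k) : dimH (h '' O) < k := by
  have h1 : dimH (h '' O) ≤ dimH O := by
    refine dimH_image_le_of_locally_lipschitzOn fun x hx => ?_
    obtain ⟨K, t, ht, hL⟩ := ((hh x hx).contDiffAt (hO.mem_nhds hx)).exists_lipschitzOnWith
    exact ⟨K, t, mem_nhdsWithin_of_mem_nhds ht, hL⟩
  have h2 : dimH O ≤ Module.finrank ℝ E := by
    rw [← Real.dimH_univ_eq_finrank E]
    exact dimH_mono (subset_univ _)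
  exact (h1.trans h2).trans_lt (by exact_mod_cast hk)

theorem dimH_biUnion_finite_lt {ι X : Type*} [EMetricSpace X] {s : Set ι} (hs : s.Finite)
    {t : ι → Set X} {k : ℕ} (hk : 0 < k) (h : ∀ i ∈ s, dimH (t i) < k) :
    dimH (⋃ i ∈ s, t i) < k := by
  induction s, hs using Set.Finite.induction_on with
  | empty => simpa using hk
  | insert _ _ ih =>
    rw [biUnion_insert, dimH_union]
    exact max_lt (h _ (mem_insert _ _)) (ih fun i hi => h i (mem_insert_of_mem _ hi))

end Manifold

/-! ### At most two simplexes meet in a face of codimension one -/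

/-- Two immersions between spaces of the same dimension that agree at a point `a` of the hyperplane
`∑ xⱼ = 1`. The direction `-a` points into the half-space `∑ xⱼ < 1`; if its image under the
differential of `h'` is the image under the differential of `h` of a direction `-v` that also points
into this half-space, then the images of the half-space under the two maps overlap near the point.
The proof follows the curve `h' ((1 - t) • a)` back through the local inverse of `h`. -/
theorem exists_overlap_of_same_side {ι E : Type*} [Fintype ι] [NormedAddCommGroup E]
    [NormedSpace ℝ E] [FiniteDimensional ℝ E] (hE : Module.finrank ℝ E = Fintype.card ι)
    {O O' : Set (ι → ℝ)} {h h' : (ι → ℝ) → E} (hO : IsOpen O) (hO' : IsOpen O')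
    (hh : ContDiffOn ℝ ∞ h O) (hh' : ContDiffOn ℝ ∞ h' O') {a : ι → ℝ} (ha : a ∈ O) (ha' : a ∈ O')
    (hpos : ∀ k, 0 < a k) (hsum : ∑ k, a k = 1) (heq : h a = h' a)
    (hinj : Function.Injective (fderiv ℝ h a)) {v : ι → ℝ} (hv : fderiv ℝ h a v = fderiv ℝ h' a a)
    (hvpos : 0 < ∑ k, v k) :
    ∃ b ∈ O, ∃ b' ∈ O', (∀ k, 0 < b k) ∧ ∑ k, b k < 1 ∧ (∀ k, 0 < b' k) ∧ ∑ k, b' k < 1 ∧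
      h b = h' b' := by
  have hfr : Module.finrank ℝ (ι → ℝ) = Module.finrank ℝ E := by simp [hE]
  let D : (ι → ℝ) ≃L[ℝ] E :=
    (LinearEquiv.ofInjectiveOfFinrankEq (fderiv ℝ h a).toLinearMap hinj hfr).toContinuousLinearEquiv
  have hDcoe : (D : (ι → ℝ) →L[ℝ] E) = fderiv ℝ h a := by ext x; rfl
  have hst : HasStrictFDerivAt h (D : (ι → ℝ) →L[ℝ] E) a := by
    rw [hDcoe]
    exact (((hh a ha).contDiffAt (hO.mem_nhds ha))).hasStrictFDerivAt (by simp)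
  have hd' : HasFDerivAt h' (fderiv ℝ h' a) a :=
    (((hh' a ha').contDiffAt (hO'.mem_nhds ha')).differentiableAt (by simp)).hasFDerivAt
  set g := hst.localInverse h D a
  have hg : HasFDerivAt g (D.symm : E →L[ℝ] (ι → ℝ)) (h a) := hst.to_localInverse.hasFDerivAt
  have hga : g (h a) = a := hst.localInverse_apply_image
  -- the segment from `a` towards the origin, transported by the transition map
  have hl : HasDerivAt (fun t : ℝ => (1 - t) • a) (-a) 0 := by
    have := ((hasDerivAt_id (0 : ℝ)).const_sub 1).smul_const a
    simpa using this
  have hl0 : (1 - (0 : ℝ)) • a = a := by simp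
  have h1 : HasDerivAt (fun t : ℝ => h' ((1 - t) • a)) (fderiv ℝ h' a (-a)) 0 := by
    refine HasFDerivAt.comp_hasDerivAt (0 : ℝ) (f := fun t : ℝ => (1 - t) • a) ?_ hl
    rw [hl0]; exact hd'
  have hβ : HasDerivAt (fun t : ℝ => g (h' ((1 - t) • a))) (-v) 0 := by
    have : D.symm (fderiv ℝ h' a (-a)) = -v := by
      rw [map_neg, ← hv, map_neg]
      congr 1
      exact D.symm_apply_apply v
    rw [← this]
    refine HasFDerivAt.comp_hasDerivAt (0 : ℝ) (l' := (D.symm : E →L[ℝ] (ι → ℝ)))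
      (f := fun t : ℝ => h' ((1 - t) • a)) ?_ h1
    rw [hl0, ← heq]; exact hg
  have hS : HasDerivAt (fun t : ℝ => ∑ k, g (h' ((1 - t) • a)) k) (-∑ k, v k) 0 := by
    have := HasDerivAt.fun_sum (u := Finset.univ) fun k _ => (hasDerivAt_pi.1 hβ) k
    simpa using this
  have hβ0 : g (h' ((1 - (0 : ℝ)) • a)) = a := by rw [hl0, ← heq, hga]
  have hev1 : ∀ᶠ t : ℝ in 𝓝[>] 0, ∑ k, g (h' ((1 - t) • a)) k < 1 := by
    have := (hasDerivAt_iff_tendsto_slope.1 hS).eventually_lt_const (neg_lt_zero.2 hvpos)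
    have h2 : 𝓝[>] (0 : ℝ) ≤ 𝓝[≠] 0 := nhdsWithin_mono _ fun t ht => ne_of_gt ht
    filter_upwards [h2 this, self_mem_nhdsWithin] with t ht ht0
    rw [slope_def_field, hβ0, hsum, sub_zero, div_lt_iff₀ ht0, zero_mul] at ht
    linarith
  have hβc : Tendsto (fun t : ℝ => g (h' ((1 - t) • a))) (𝓝[>] 0) (𝓝 a) := by
    have := hβ.continuousAt.tendsto
    rw [hβ0] at this
    exact this.mono_left nhdsWithin_le_nhds
  have hlc : Tendsto (fun t : ℝ => (1 - t) • a) (𝓝[>] 0) (𝓝 a) := by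
    have := hl.continuousAt.tendsto
    rw [hl0] at this
    exact this.mono_left nhdsWithin_le_nhds
  have hhc : Tendsto (fun t : ℝ => h' ((1 - t) • a)) (𝓝[>] 0) (𝓝 (h a)) := by
    have := h1.continuousAt.tendsto
    rw [hl0, ← heq] at this
    exact this.mono_left nhdsWithin_le_nhds
  have hposO : IsOpen {b : ι → ℝ | ∀ k, 0 < b k} := by
    simp only [ofPred_forall]
    exact isOpen_iInter_of_finite fun k => isOpen_lt continuous_const (continuous_apply k)
  have hlt : ∀ᶠ t : ℝ in 𝓝[>] 0, t < 1 := nhdsWithin_le_nhds (eventually_lt_nhds one_pos)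
  obtain ⟨t, ht1, htO, htO', htp, htr, htlt, ht0⟩ := (hev1.and
    ((hβc.eventually (hO.mem_nhds ha)).and ((hlc.eventually (hO'.mem_nhds ha')).and ((hβc.eventually (hposO.mem_nhds hpos)).and
    ((hhc.eventually hst.eventually_right_inverse).and (hlt.and self_mem_nhdsWithin)))))).exists
  refine ⟨_, htO, _, htO', htp, ht1, fun k => ?_, ?_, htr⟩
  · simp only [Pi.smul_apply, smul_eq_mul]
    exact mul_pos (by linarith) (hpos k)
  · simp only [Pi.smul_apply, smul_eq_mul, ← Finset.mul_sum, hsum]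
    have : (0 : ℝ) < t := ht0
    linarith

section Manifold

variable {d : ℕ} {M : Type u} [TopologicalSpace M]
  [ChartedSpace (EuclideanSpace ℝ (Fin (d + 1))) M]

/-- At most two `n`-simplexes of an `n`-manifold have a common face of codimension one: in a chart
at the centre of the face, two different ones lie on opposite sides of the face, and this is
impossible for three of them. -/
theorem SmoothTriangulation.eq_or_eq_of_common_face [IsManifold (𝓡 (d + 1)) ∞ M]
    (T : SmoothTriangulation (d + 1) M)
    {φ₁ φ₂ φ₃ : Simplex (d + 1) → M} (h₁ : φ₁ ∈ T.simplexes (d + 1)) (h₂ : φ₂ ∈ T.simplexes (d + 1))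
    (h₃ : φ₃ ∈ T.simplexes (d + 1)) {i₁ i₂ i₃ : Fin (d + 2)}
    (h₁₂ : φ₁ ∘ faceMap i₁ = φ₂ ∘ faceMap i₂) (h₁₃ : φ₁ ∘ faceMap i₁ = φ₃ ∘ faceMap i₃)
    (hne : φ₁ ≠ φ₂) : φ₃ = φ₁ ∨ φ₃ = φ₂ := by
  by_contra hcon
  push Not at hcon
  set a : Fin (d + 1) → ℝ := fun k => simplexCentre d k with ha
  have hapos : ∀ k, 0 < a k := simplexCentre_mem_interior d
  have hasum : ∑ k, a k = 1 := stdSimplex.sum_eq_one (simplexCentre d)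
  set x₀ := φ₁ (faceMap i₁ (simplexCentre d)) with hx₀
  -- the facts about one simplex in local coordinates at the centre of the face
  have coord : ∀ (φ : Simplex (d + 1) → M) (i : Fin (d + 2)), φ ∈ T.simplexes (d + 1) →
      φ₁ ∘ faceMap i₁ = φ ∘ faceMap i →
      ∃ (O : Set (Fin (d + 1) → ℝ)) (g : (Fin (d + 1) → ℝ) → EuclideanSpace ℝ (Fin (d + 1))),
        IsOpen O ∧ ContDiffOn ℝ ∞ g O ∧ Function.Injective (fderiv ℝ g a) ∧ a ∈ O ∧
        (∀ b ∈ O, (∀ k, 0 < b k) → ∑ k, b k < 1 → ∃ y ∈ simplexInterior (d + 1),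
          φ y ∈ (extChartAt (𝓡 (d + 1)) x₀).source ∧ g b = extChartAt (𝓡 (d + 1)) x₀ (φ y)) ∧
        ∀ q : Simplex d, (fun k => q k) ∈ O →
          g (fun k => q k) = extChartAt (𝓡 (d + 1)) x₀ (φ₁ (faceMap i₁ q)) := by
    intro φ i hφ hcom
    obtain ⟨O, g, hO, hg, hinj, hiff, hgy⟩ := (T.smooth _ φ hφ).exists_local_coord i x₀
    have hface : ∀ q : Simplex d, (fun k => faceMap i q (i.succAbove k)) = fun k => q k :=
      fun q => funext fun k => faceMap_apply_succAbove i q k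
    have haO : a ∈ O := by
      rw [ha, ← hface, hiff, show φ (faceMap i (simplexCentre d)) = x₀ from
        (congrFun hcom (simplexCentre d)).symm]
      exact mem_extChartAt_source x₀
    refine ⟨O, g, hO, hg, hinj a haO, haO, fun b hb hbp hbs => ?_, fun q hq => ?_⟩
    · have hint : ∀ j, 0 < hyperplaneParam i b j := fun j => by
        refine Fin.succAboveCases i ?_ (fun k => ?_) j
        · simpa [hyperplaneParam] using hbs
        · simpa [hyperplaneParam] using hbp k
      let y : Simplex (d + 1) :=
        ⟨hyperplaneParam i b, fun j => (hint j).le, sum_hyperplaneParam i b⟩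
      have hyb : (fun k => y (i.succAbove k)) = b := by
        funext k
        change hyperplaneParam i b (i.succAbove k) = b k
        simp [hyperplaneParam]
      refine ⟨y, hint, (hiff y).1 (by rwa [hyb]), ?_⟩
      rw [← hgy y, hyb]
    · rw [← hface, hgy]
      exact congrArg _ (congrFun hcom q).symm
  obtain ⟨O₁, g₁, hO₁, hg₁, hinj₁, ha₁, hint₁, hq₁⟩ := coord φ₁ i₁ h₁ rfl
  obtain ⟨O₂, g₂, hO₂, hg₂, hinj₂, ha₂, hint₂, hq₂⟩ := coord φ₂ i₂ h₂ h₁₂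
  obtain ⟨O₃, g₃, hO₃, hg₃, hinj₃, ha₃, hint₃, hq₃⟩ := coord φ₃ i₃ h₃ h₁₃
  -- the differentials agree on the directions of the face
  have agree : ∀ (O O' : Set (Fin (d + 1) → ℝ))
      (g g' : (Fin (d + 1) → ℝ) → EuclideanSpace ℝ (Fin (d + 1))), IsOpen O → IsOpen O' →
      ContDiffOn ℝ ∞ g O → ContDiffOn ℝ ∞ g' O' → a ∈ O → a ∈ O' →
      (∀ q : Simplex d, (fun k => q k) ∈ O →
          g (fun k => q k) = extChartAt (𝓡 (d + 1)) x₀ (φ₁ (faceMap i₁ q))) →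
      (∀ q : Simplex d, (fun k => q k) ∈ O' →
          g' (fun k => q k) = extChartAt (𝓡 (d + 1)) x₀ (φ₁ (faceMap i₁ q))) →
      ∀ w : Fin (d + 1) → ℝ, ∑ k, w k = 0 → fderiv ℝ g a w = fderiv ℝ g' a w := by
    intro O O' g g' hO hO' hg hg' haO haO' hq hq' w hw
    have hd : HasFDerivAt g (fderiv ℝ g a) a :=
      (((hg a haO).contDiffAt (hO.mem_nhds haO)).differentiableAt (by simp)).hasFDerivAt
    have hd' : HasFDerivAt g' (fderiv ℝ g' a) a :=
      (((hg' a haO').contDiffAt (hO'.mem_nhds haO')).differentiableAt (by simp)).hasFDerivAt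
    have hl : HasDerivAt (fun t : ℝ => a + t • w) w 0 := by
      have := ((hasDerivAt_id (0 : ℝ)).smul_const w).const_add a
      simpa using this
    have hl0 : a + (0 : ℝ) • w = a := by simp
    have e1 : HasDerivAt (fun t : ℝ => g (a + t • w)) (fderiv ℝ g a w) 0 := by
      refine HasFDerivAt.comp_hasDerivAt (0 : ℝ) (f := fun t : ℝ => a + t • w) ?_ hl
      rw [hl0]; exact hd
    have e2 : HasDerivAt (fun t : ℝ => g' (a + t • w)) (fderiv ℝ g' a w) 0 := by
      refine HasFDerivAt.comp_hasDerivAt (0 : ℝ) (f := fun t : ℝ => a + t • w) ?_ hl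
      rw [hl0]; exact hd'
    refine e1.unique (e2.congr_of_eventuallyEq ?_)
    have hc : Tendsto (fun t : ℝ => a + t • w) (𝓝 0) (𝓝 a) := by
      have := hl.continuousAt.tendsto
      rwa [hl0] at this
    have hposO : IsOpen {b : Fin (d + 1) → ℝ | ∀ k, 0 < b k} := by
      simp only [ofPred_forall]
      exact isOpen_iInter_of_finite fun k => isOpen_lt continuous_const (continuous_apply k)
    filter_upwards [hc.eventually (hO.mem_nhds haO), hc.eventually (hO'.mem_nhds haO'),
      hc.eventually (hposO.mem_nhds hapos)] with t h1 h2 h3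
    let q : Simplex d := ⟨a + t • w, fun k => (h3 k).le, by
      simp [Finset.sum_add_distrib, ← Finset.mul_sum, hw, hasum]⟩
    exact (hq q h1).trans (hq' q h2).symm
  -- different simplexes are on different sides of the face: in the coordinates of the first one,
  -- the inward direction `-a` of the second one points outwards
  have side : ∀ (φ φ' : Simplex (d + 1) → M), φ ∈ T.simplexes (d + 1) → φ' ∈ T.simplexes (d + 1) →
      φ ≠ φ' → ∀ (O O' : Set (Fin (d + 1) → ℝ))
      (g g' : (Fin (d + 1) → ℝ) → EuclideanSpace ℝ (Fin (d + 1))), IsOpen O → IsOpen O' →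
      ContDiffOn ℝ ∞ g O → ContDiffOn ℝ ∞ g' O' → a ∈ O → a ∈ O' →
      Function.Injective (fderiv ℝ g a) → Function.Injective (fderiv ℝ g' a) →
      (∀ b ∈ O, (∀ k, 0 < b k) → ∑ k, b k < 1 → ∃ y ∈ simplexInterior (d + 1),
          φ y ∈ (extChartAt (𝓡 (d + 1)) x₀).source ∧ g b = extChartAt (𝓡 (d + 1)) x₀ (φ y)) →
      (∀ b ∈ O', (∀ k, 0 < b k) → ∑ k, b k < 1 → ∃ y ∈ simplexInterior (d + 1),
          φ' y ∈ (extChartAt (𝓡 (d + 1)) x₀).source ∧ g' b = extChartAt (𝓡 (d + 1)) x₀ (φ' y)) →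
      (∀ q : Simplex d, (fun k => q k) ∈ O →
          g (fun k => q k) = extChartAt (𝓡 (d + 1)) x₀ (φ₁ (faceMap i₁ q))) →
      (∀ q : Simplex d, (fun k => q k) ∈ O' →
          g' (fun k => q k) = extChartAt (𝓡 (d + 1)) x₀ (φ₁ (faceMap i₁ q))) →
      ∃ v, fderiv ℝ g a v = fderiv ℝ g' a a ∧ ∑ k, v k < 0 := by
    intro φ φ' hφ hφ' hne O O' g g' hO hO' hg hg' haO haO' hinj hinj' hin hin' hq hq'
    have hsurj : Function.Surjective (fderiv ℝ g a).toLinearMap :=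
      (LinearMap.injective_iff_surjective_of_finrank_eq_finrank (by simp)).1 hinj
    obtain ⟨v, hv⟩ := hsurj (fderiv ℝ g' a a)
    refine ⟨v, hv, ?_⟩
    by_contra hneg
    rcases (not_lt.1 hneg).eq_or_lt with h0 | hpos
    · have e := agree O O' g g' hO hO' hg hg' haO haO' hq hq' v h0.symm
      have : v = a := hinj' (e.symm.trans hv)
      rw [this, hasum] at h0
      norm_num at h0
    · have haeq : g a = g' a := (hq (simplexCentre d) haO).trans (hq' (simplexCentre d) haO').symm
      obtain ⟨b, hb, b', hb', hbp, hbs, hbp', hbs', he⟩ := exists_overlap_of_same_side (by simp)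
        hO hO' hg hg' haO haO' hapos hasum haeq hinj hv hpos
      obtain ⟨y, hy, hys, hye⟩ := hin b hb hbp hbs
      obtain ⟨y', hy', hys', hye'⟩ := hin' b' hb' hbp' hbs'
      refine hne (T.simplex_eq hφ hφ' hy hy' ?_)
      exact (extChartAt (𝓡 (d + 1)) x₀).injOn hys hys' (hye.symm.trans (he.trans hye'))
  obtain ⟨v, hv, hvneg⟩ := side φ₁ φ₂ h₁ h₂ hne O₁ O₂ g₁ g₂ hO₁ hO₂ hg₁ hg₂ ha₁ ha₂ hinj₁ hinj₂
    hint₁ hint₂ hq₁ hq₂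
  obtain ⟨w, hw, hwneg⟩ := side φ₂ φ₃ h₂ h₃ hcon.2.symm O₂ O₃ g₂ g₃ hO₂ hO₃ hg₂ hg₃ ha₂ ha₃ hinj₂
    hinj₃ hint₂ hint₃ hq₂ hq₃
  obtain ⟨z, hz, hzneg⟩ := side φ₁ φ₃ h₁ h₃ hcon.1.symm O₁ O₃ g₁ g₃ hO₁ hO₃ hg₁ hg₃ ha₁ ha₃ hinj₁
    hinj₃ hint₁ hint₃ hq₁ hq₃
  -- the signs multiply along `φ₁`, `φ₂`, `φ₃`
  set κ := ∑ k, w k with hκ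
  have hw0 : ∑ k, (w - κ • a) k = 0 := by
    simp [Finset.sum_sub_distrib, ← Finset.mul_sum, hasum, hκ]
  have e := agree O₁ O₂ g₁ g₂ hO₁ hO₂ hg₁ hg₂ ha₁ ha₂ hq₁ hq₂ _ hw0
  have hzv : z = (w - κ • a) + κ • v := by
    apply hinj₁
    rw [map_add, e, map_sub, map_smul, map_smul, hv, hw, hz]
    abel
  have : ∑ k, z k = κ * ∑ k, v k := by
    rw [hzv]
    simp only [Pi.add_apply, Finset.sum_add_distrib] at hw0 ⊢
    rw [hw0]
    simp [Finset.mul_sum]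
  rw [this] at hzneg
  exact absurd hzneg (not_lt.2 (mul_pos_of_neg_of_neg hwneg hvneg).le)

end Manifold

/-! ### Skeletons, purity and strong connectedness -/

section Manifold

variable {n : ℕ} {M : Type u} [TopologicalSpace M] [ChartedSpace (EuclideanSpace ℝ (Fin n)) M]

namespace SmoothTriangulation

variable (T : SmoothTriangulation n M)

/-- The union of the closed simplexes of dimension less than `m`. -/
def skeleton (m : ℕ) : Set M := ⋃ l ∈ Iio m, ⋃ ρ ∈ T.simplexes l, range ρ

theorem mem_skeleton {m : ℕ} {x : M} :
    x ∈ T.skeleton m ↔ ∃ l < m, ∃ ρ ∈ T.simplexes l, x ∈ range ρ := by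
  simp only [skeleton, mem_iUnion, mem_Iio, exists_prop]

theorem isClosed_iUnion_range [T2Space M] {l : ℕ} {P : Set (Simplex l → M)}
    (hP : P ⊆ T.simplexes l) : IsClosed (⋃ ρ ∈ P, range ρ) :=
  ((T.finite l).subset hP).isClosed_biUnion fun _ hρ =>
    (isCompact_range (T.continuous (hP hρ))).isClosed

/-- A simplex of dimension less than `n` has small Hausdorff dimension in every chart. -/
theorem dimH_chart_range_lt [IsManifold (𝓡 n) ∞ M] {l : ℕ} (hl : l < n) {ρ : Simplex l → M}
    (hρ : ρ ∈ T.simplexes l) (x₀ : M) :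
    dimH (extChartAt (𝓡 n) x₀ '' (range ρ ∩ (extChartAt (𝓡 n) x₀).source)) < n := by
  obtain ⟨O, g, hO, hg, -, hiff, hgy⟩ := (T.smooth l ρ hρ).exists_local_coord 0 x₀
  refine lt_of_le_of_lt (dimH_mono ?_) (dimH_image_lt_of_contDiffOn hO (hg.of_le (by norm_cast))
    (k := n) (by simpa using hl))
  rintro _ ⟨_, ⟨⟨y, rfl⟩, hy⟩, rfl⟩
  exact ⟨_, (hiff y).2 hy, hgy y⟩

/-- In a chart, the union of the lines through `p` and the points of a simplex of codimension at
least two has small Hausdorff dimension. -/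
theorem dimH_chart_cone_lt [IsManifold (𝓡 n) ∞ M] {l : ℕ} (hl : l + 1 < n) {ρ : Simplex l → M}
    (hρ : ρ ∈ T.simplexes l) (x₀ : M) (p : EuclideanSpace ℝ (Fin n)) :
    dimH {z | ∃ s ∈ extChartAt (𝓡 n) x₀ '' (range ρ ∩ (extChartAt (𝓡 n) x₀).source), ∃ t : ℝ,
      z = p + t • (s - p)} < n := by
  obtain ⟨O, g, hO, hg, -, hiff, hgy⟩ := (T.smooth l ρ hρ).exists_local_coord 0 x₀
  have hc : ContDiffOn ℝ 1 (fun a : (Fin l → ℝ) × ℝ => p + a.2 • (g a.1 - p)) (O ×ˢ univ) := by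
    refine contDiffOn_const.add (contDiffOn_snd.smul (ContDiffOn.sub ?_ contDiffOn_const))
    exact (hg.of_le (by norm_cast)).comp contDiffOn_fst fun a ha => ha.1
  refine lt_of_le_of_lt (dimH_mono ?_) (dimH_image_lt_of_contDiffOn (hO.prod isOpen_univ) hc
    (k := n) (by simpa using hl))
  rintro z ⟨_, ⟨_, ⟨⟨y, rfl⟩, hy⟩, rfl⟩, t, rfl⟩
  refine ⟨(_, t), ⟨(hiff y).2 hy, mem_univ _⟩, ?_⟩
  simp only [hgy y]

theorem dimH_chart_skeleton_lt [IsManifold (𝓡 n) ∞ M] (hn : 0 < n) {m : ℕ} (hm : m ≤ n) (x₀ : M) :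
    dimH (extChartAt (𝓡 n) x₀ '' (T.skeleton m ∩ (extChartAt (𝓡 n) x₀).source)) < n := by
  simp only [skeleton, iUnion_inter, image_iUnion]
  refine dimH_biUnion_finite_lt (finite_Iio m) hn fun l hl => ?_
  refine dimH_biUnion_finite_lt (T.finite l) hn fun ρ hρ => ?_
  exact T.dimH_chart_range_lt (lt_of_lt_of_le hl hm) hρ x₀

theorem dimH_chart_skeleton_cone_lt [IsManifold (𝓡 n) ∞ M] (hn : 0 < n) {m : ℕ} (hm : m < n)
    (x₀ : M) (p : EuclideanSpace ℝ (Fin n)) :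
    dimH {z | ∃ s ∈ extChartAt (𝓡 n) x₀ '' (T.skeleton m ∩ (extChartAt (𝓡 n) x₀).source), ∃ t : ℝ,
      z = p + t • (s - p)} < n := by
  have : {z | ∃ s ∈ extChartAt (𝓡 n) x₀ '' (T.skeleton m ∩ (extChartAt (𝓡 n) x₀).source), ∃ t : ℝ,
      z = p + t • (s - p)} ⊆ ⋃ l ∈ Iio m, ⋃ ρ ∈ T.simplexes l,
      {z | ∃ s ∈ extChartAt (𝓡 n) x₀ '' (range ρ ∩ (extChartAt (𝓡 n) x₀).source), ∃ t : ℝ,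
      z = p + t • (s - p)} := by
    rintro z ⟨_, ⟨x, ⟨hx, hxs⟩, rfl⟩, t, rfl⟩
    obtain ⟨l, hl, ρ, hρ, hxρ⟩ := T.mem_skeleton.1 hx
    simp only [mem_iUnion]
    exact ⟨l, hl, ρ, hρ, _, ⟨x, ⟨hxρ, hxs⟩, rfl⟩, t, rfl⟩
  refine lt_of_le_of_lt (dimH_mono this) ?_
  refine dimH_biUnion_finite_lt (finite_Iio m) hn fun l hl => ?_
  refine dimH_biUnion_finite_lt (T.finite l) hn fun ρ hρ => ?_
  exact T.dimH_chart_cone_lt (by have := mem_Iio.1 hl; omega) hρ x₀ p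

theorem interior_skeleton_eq_empty [IsManifold (𝓡 n) ∞ M] (hn : 0 < n) {m : ℕ} (hm : m ≤ n) :
    interior (T.skeleton m) = ∅ := by
  rw [eq_empty_iff_forall_notMem]
  intro x₀ hx₀
  set χ := extChartAt (𝓡 n) x₀ with hχ
  have hd : Dense (χ '' (T.skeleton m ∩ χ.source))ᶜ :=
    dense_compl_of_dimH_lt_finrank (by
      rw [finrank_euclideanSpace_fin]
      exact T.dimH_chart_skeleton_lt hn hm x₀)
  have hopen : IsOpen (χ.target ∩ χ.symm ⁻¹' interior (T.skeleton m)) :=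
    (continuousOn_extChartAt_symm x₀).isOpen_inter_preimage (isOpen_extChartAt_target x₀)
      isOpen_interior
  obtain ⟨z, hz, hzn⟩ := hd.inter_open_nonempty _ hopen
    ⟨χ x₀, mem_extChartAt_target x₀, by
      rw [mem_preimage, hχ, extChartAt_to_inv]; exact hx₀⟩
  exact hzn ⟨χ.symm z, ⟨interior_subset hz.2, χ.map_target hz.1⟩, χ.right_inv hz.1⟩

/-- The simplexes of the dimension of the manifold cover it: their union is closed, and its
complement is an open set in the union of the finitely many simplexes of smaller dimension. -/
theorem iUnion_range_eq_univ [IsManifold (𝓡 n) ∞ M] [T2Space M] (hn : 0 < n) :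
    ⋃ ρ ∈ T.simplexes n, range ρ = univ := by
  have hcl : IsClosed (⋃ ρ ∈ T.simplexes n, range ρ) := T.isClosed_iUnion_range Subset.rfl
  have hsub : (⋃ ρ ∈ T.simplexes n, range ρ)ᶜ ⊆ T.skeleton n := by
    intro x hx
    obtain ⟨⟨l, ρ⟩, ⟨hρ, y, hy, hyx⟩, -⟩ := T.partition x
    refine T.mem_skeleton.2 ⟨l, ?_, ρ, hρ, y, hyx⟩
    by_contra hl
    rcases (not_lt.1 hl).eq_or_lt with rfl | hl
    · exact hx (mem_biUnion hρ ⟨y, hyx⟩)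
    · change ρ ∈ T.simplexes l at hρ
      rw [T.eq_empty l hl] at hρ
      exact hρ
  have := interior_maximal hsub hcl.isOpen_compl
  rw [T.interior_skeleton_eq_empty hn le_rfl, subset_empty_iff, compl_empty_iff] at this
  exact this

/-- A skeleton of codimension two does not separate the manifold locally: if two closed sets cover
the manifold and meet only in the skeleton, then every point is an inner point of one of them.
Otherwise, choose points `p` and `q` near `x₀` outside of either set; in a chart, almost every point
`z` of a ball is joined to both of them by segments that avoid the skeleton, and the connected union
of these segments would have to meet both sets. -/
theorem mem_interior_or_mem_interior [IsManifold (𝓡 n) ∞ M] {m : ℕ} (hm : m < n)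
    {A B : Set M} (hA : IsClosed A) (hB : IsClosed B) (hAB : A ∪ B = univ)
    (hS : A ∩ B ⊆ T.skeleton m) (x₀ : M) : x₀ ∈ interior A ∨ x₀ ∈ interior B := by
  have hn : 0 < n := by omega
  set χ := extChartAt (𝓡 n) x₀ with hχ
  obtain ⟨r, hr, hball⟩ := Metric.isOpen_iff.1 ((isOpen_extChartAt_target x₀ : IsOpen χ.target))
    (χ x₀) (mem_extChartAt_target x₀)
  change Metric.ball (χ x₀) r ⊆ χ.target at hball
  set N := χ.source ∩ χ ⁻¹' Metric.ball (χ x₀) r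
  have hN : IsOpen N := (continuousOn_extChartAt x₀).isOpen_inter_preimage
    (isOpen_extChartAt_source x₀) Metric.isOpen_ball
  have hx₀N : x₀ ∈ N := ⟨mem_extChartAt_source x₀, Metric.mem_ball_self hr⟩
  by_contra hcon
  rw [not_or] at hcon
  set Z := χ '' (T.skeleton m ∩ χ.source)
  -- points of `N` outside of each set and of the skeleton
  have pick : ∀ D : Set M, IsClosed D → x₀ ∉ interior D → ∃ p ∈ N, p ∉ D ∧ p ∉ T.skeleton m := by
    intro D hD hx
    have hne : (N ∩ Dᶜ).Nonempty := by
      by_contra h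
      rw [not_nonempty_iff_eq_empty, ← sdiff_eq_compl_inter.trans (inter_comm _ _),
        sdiff_eq_empty] at h
      exact hx (mem_interior.2 ⟨N, h, hN, hx₀N⟩)
    by_contra h
    push Not at h
    have hsub : N ∩ Dᶜ ⊆ T.skeleton m := fun p hp => h p hp.1 hp.2
    have := interior_maximal hsub (hN.inter hD.isOpen_compl)
    rw [T.interior_skeleton_eq_empty hn hm.le] at this
    exact (hne.mono this).ne_empty rfl
  obtain ⟨p, hpN, hpA, hpS⟩ := pick A hA hcon.1
  obtain ⟨q, hqN, hqB, hqS⟩ := pick B hB hcon.2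
  have notZ : ∀ p ∈ N, p ∉ T.skeleton m → χ p ∉ Z := by
    rintro p hp hpS ⟨s, hs, hsp⟩
    rw [χ.injOn hs.2 hp.1 hsp] at hs
    exact hpS hs.1
  -- a point that is seen from both of them
  set Co := fun p : EuclideanSpace ℝ (Fin n) => {z | ∃ s ∈ Z, ∃ t : ℝ, z = p + t • (s - p)}
  have hdim : dimH (Co (χ p) ∪ Co (χ q)) < n := by
    rw [dimH_union]
    exact max_lt (T.dimH_chart_skeleton_cone_lt hn hm x₀ _)
      (T.dimH_chart_skeleton_cone_lt hn hm x₀ _)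
  have hdense : Dense (Co (χ p) ∪ Co (χ q))ᶜ :=
    dense_compl_of_dimH_lt_finrank (by rwa [finrank_euclideanSpace_fin])
  obtain ⟨z, hz, hzC⟩ := hdense.inter_open_nonempty _ Metric.isOpen_ball ⟨χ x₀, Metric.mem_ball_self hr⟩
  simp only [mem_compl_iff, mem_union, not_or] at hzC
  have seg : ∀ p ∈ N, p ∉ T.skeleton m → z ∉ Co (χ p) → ∀ w ∈ segment ℝ (χ p) z,
      w ∈ Metric.ball (χ x₀) r ∧ w ∉ Z := by
    intro p hp hpS hzp w hw
    refine ⟨(convex_ball _ _).segment_subset hp.2 hz hw, fun hwZ => ?_⟩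
    rw [segment_eq_image'] at hw
    obtain ⟨t, -, rfl⟩ := hw
    by_cases ht : t = 0
    · rw [ht] at hwZ
      exact notZ p hp hpS (by simpa using hwZ)
    · refine hzp ⟨_, hwZ, t⁻¹, ?_⟩
      simp [smul_smul, inv_mul_cancel₀ ht]
  have hY : IsPreconnected (segment ℝ (χ p) z ∪ segment ℝ (χ q) z) :=
    IsPreconnected.union z (right_mem_segment ℝ _ _) (right_mem_segment ℝ _ _)
      (convex_segment _ _).isPreconnected (convex_segment _ _).isPreconnected
  have hYp : ∀ w ∈ segment ℝ (χ p) z ∪ segment ℝ (χ q) z, w ∈ Metric.ball (χ x₀) r ∧ w ∉ Z := by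
    rintro w (hw | hw)
    · exact seg p hpN hpS hzC.1 w hw
    · exact seg q hqN hqS hzC.2 w hw
  have hYM := hY.image χ.symm ((continuousOn_extChartAt_symm x₀).mono fun w hw =>
    hball (hYp w hw).1)
  obtain ⟨_, ⟨w, hw, rfl⟩, hwA, hwB⟩ := isPreconnected_closed_iff.1 hYM A B hA hB
    (by rw [hAB]; exact subset_univ _)
    ⟨q, ⟨χ q, Or.inr (left_mem_segment ℝ _ _), χ.left_inv hqN.1⟩, by
      have : q ∈ A ∪ B := hAB ▸ mem_univ q
      exact this.resolve_right hqB⟩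
    ⟨p, ⟨χ p, Or.inl (left_mem_segment ℝ _ _), χ.left_inv hpN.1⟩, by
      have : p ∈ A ∪ B := hAB ▸ mem_univ p
      exact this.resolve_left hpA⟩
  have hwt := hball (hYp w hw).1
  exact (hYp w hw).2 ⟨χ.symm w, ⟨hS ⟨hwA, hwB⟩, χ.map_target hwt⟩, χ.right_inv hwt⟩

end SmoothTriangulation

end Manifold

/-- A triangulated connected manifold is strongly connected: a nonempty set of simplexes of maximal
dimension that is closed under passing to a neighbour through a face contains all of them. -/
theorem SmoothTriangulation.eq_simplexes_of_closed {d : ℕ} {M : Type u} [TopologicalSpace M]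
    [T2Space M] [ConnectedSpace M] [ChartedSpace (EuclideanSpace ℝ (Fin (d + 1))) M]
    [IsManifold (𝓡 (d + 1)) ∞ M] (T : SmoothTriangulation (d + 1) M)
    {P : Set (Simplex (d + 1) → M)} (hP : P ⊆ T.simplexes (d + 1)) (hne : P.Nonempty)
    (hcl : ∀ φ ∈ P, ∀ i, ∀ φ' ∈ T.simplexes (d + 1), ∀ i', φ ∘ faceMap i = φ' ∘ faceMap i' →
      φ' ∈ P) : P = T.simplexes (d + 1) := by
  refine hP.antisymm fun φ' hφ' => ?_
  by_contra hφ'P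
  obtain ⟨φ, hφ⟩ := hne
  set A := ⋃ ρ ∈ P, range ρ
  set B := ⋃ ρ ∈ T.simplexes (d + 1) \ P, range ρ
  have hA : IsClosed A := T.isClosed_iUnion_range hP
  have hB : IsClosed B := T.isClosed_iUnion_range sdiff_subset
  have hAB : A ∪ B = univ := by
    rw [← T.iUnion_range_eq_univ d.succ_pos, ← biUnion_union, union_sdiff_cancel hP]
  have hS : A ∩ B ⊆ T.skeleton d := by
    rintro x ⟨hxA, hxB⟩
    simp only [A, B, mem_iUnion] at hxA hxB
    obtain ⟨φ₁, h₁, y₁, hy₁⟩ := hxA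
    obtain ⟨φ₂, h₂, y₂, rfl⟩ := hxB
    obtain ⟨l, hl, ρ, hρ, z, hz, hzx, -, hint⟩ := T.exists_open_face h₂.1 y₂
    refine T.mem_skeleton.2 ⟨l, ?_, ρ, hρ, z, hzx⟩
    by_contra hld
    obtain rfl | rfl : l = d ∨ l = d + 1 := by omega
    · obtain ⟨i₁, hi₁, -⟩ := T.exists_face_eq (hP h₁) hρ hz (hy₁.trans hzx.symm)
      obtain ⟨i₂, hi₂, -⟩ := T.exists_face_eq h₂.1 hρ hz hzx.symm
      exact h₂.2 (hcl φ₁ h₁ i₁ φ₂ h₂.1 i₂ (hi₁.trans hi₂.symm))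
    · have hy₂ := hint rfl
      have hy₁' := T.mem_interior_of_eq (hP h₁) h₂.1 le_rfl hy₂ hy₁
      exact h₂.2 (T.simplex_eq (hP h₁) h₂.1 hy₁' hy₂ hy₁ ▸ h₁)
  have hor := T.mem_interior_or_mem_interior d.lt_succ_self hA hB hAB hS
  have key : ∀ φ₁ ∈ T.simplexes (d + 1), ∀ φ₂ ∈ T.simplexes (d + 1), φ₁ ≠ φ₂ →
      φ₁ (simplexCentre (d + 1)) ∉ range φ₂ := by
    rintro φ₁ h₁ φ₂ h₂ hne ⟨y, hy⟩
    exact hne (T.simplex_eq h₁ h₂ (simplexCentre_mem_interior _)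
      (T.mem_interior_of_eq h₂ h₁ le_rfl (simplexCentre_mem_interior _) hy) hy.symm)
  have hiA : φ (simplexCentre (d + 1)) ∈ interior A := by
    refine (hor _).resolve_right fun h => ?_
    have h := interior_subset h
    simp only [B, mem_iUnion] at h
    obtain ⟨φ₂, h₂, hx⟩ := h
    exact key φ (hP hφ) φ₂ h₂.1 (fun e => h₂.2 (e ▸ hφ)) hx
  have hiB : φ' (simplexCentre (d + 1)) ∈ interior B := by
    refine (hor _).resolve_left fun h => ?_
    have h := interior_subset h
    simp only [A, mem_iUnion] at h
    obtain ⟨φ₂, h₂, hx⟩ := h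
    exact key φ' hφ' φ₂ (hP h₂) (fun e => hφ'P (e ▸ h₂)) hx
  obtain ⟨x, -, hxA, hxB⟩ := isPreconnected_univ (interior A) (interior B) isOpen_interior
    isOpen_interior (fun x _ => hor x) ⟨_, mem_univ _, hiA⟩ ⟨_, mem_univ _, hiB⟩
  have hx : x ∈ interior (A ∩ B) := by rw [interior_inter]; exact ⟨hxA, hxB⟩
  have := interior_mono hS hx
  rw [T.interior_skeleton_eq_empty d.succ_pos d.le_succ] at this
  exact this

/-! ### The chords over a face -/

section Chords

variable {d : ℕ}

theorem footPoint_apply (i : Fin (d + 2)) (y : Simplex (d + 1)) (k : Fin (d + 1)) :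
    footPoint i y k = y (i.succAbove k) + y i / (d + 1) := rfl

theorem iInf_simplex_le (q : Simplex d) (k : Fin (d + 1)) : (⨅ k, q k) ≤ q k :=
  ciInf_le (Set.finite_range _).bddBelow k

theorem exists_eq_iInf_simplex (q : Simplex d) : ∃ k, q k = ⨅ k, q k :=
  exists_eq_ciInf_of_finite

theorem le_outerLength_iff {q : Simplex d} {τ : ℝ} :
    τ ≤ outerLength q ↔ ∀ k, τ / (d + 1) ≤ q k := by
  have hd : (0 : ℝ) < d + 1 := by positivity
  constructor
  · intro h k
    rw [div_le_iff₀ hd, mul_comm]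
    exact h.trans (mul_le_mul_of_nonneg_left (iInf_simplex_le q k) hd.le)
  · intro h
    obtain ⟨k, hk⟩ := exists_eq_iInf_simplex q
    have := h k
    rw [div_le_iff₀ hd, mul_comm, hk] at this
    exact this

theorem lt_outerLength_iff {q : Simplex d} {τ : ℝ} :
    τ < outerLength q ↔ ∀ k, τ / (d + 1) < q k := by
  have hd : (0 : ℝ) < d + 1 := by positivity
  constructor
  · intro h k
    rw [div_lt_iff₀ hd, mul_comm]
    exact h.trans_le (mul_le_mul_of_nonneg_left (iInf_simplex_le q k) hd.le)
  · intro h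
    obtain ⟨k, hk⟩ := exists_eq_iInf_simplex q
    have := h k
    rw [div_lt_iff₀ hd, mul_comm, hk] at this
    exact this

theorem outerLength_eq_mul_innerLength (q : Simplex d) :
    outerLength q = (d + 2) * innerLength q := by
  have : (d : ℝ) + 2 ≠ 0 := by positivity
  rw [outerLength, innerLength]; field_simp

theorem innerLength_nonneg (q : Simplex d) : 0 ≤ innerLength q :=
  mul_nonneg (by positivity) (Real.iInf_nonneg fun k => stdSimplex.zero_le q k)

theorem outerLength_pos_iff {q : Simplex d} : 0 < outerLength q ↔ q ∈ simplexInterior d := by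
  rw [lt_outerLength_iff]; simp [simplexInterior]

theorem chordPoint_val (i : Fin (d + 2)) (q : Simplex d) {τ : ℝ} (h0 : 0 ≤ τ)
    (h1 : τ ≤ outerLength q) : (chordPoint i q τ).1 = chordVector i q τ := by
  simp only [chordPoint, min_eq_left h1, max_eq_right h0]

theorem chordPoint_apply_self (i : Fin (d + 2)) (q : Simplex d) {τ : ℝ} (h0 : 0 ≤ τ)
    (h1 : τ ≤ outerLength q) : chordPoint i q τ i = τ := by
  change (chordPoint i q τ).1 i = τ
  rw [chordPoint_val i q h0 h1]; simp [chordVector]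

theorem chordPoint_apply_succAbove (i : Fin (d + 2)) (q : Simplex d) {τ : ℝ} (h0 : 0 ≤ τ)
    (h1 : τ ≤ outerLength q) (k : Fin (d + 1)) :
    chordPoint i q τ (i.succAbove k) = q k - τ / (d + 1) := by
  change (chordPoint i q τ).1 (i.succAbove k) = _
  rw [chordPoint_val i q h0 h1]; simp [chordVector]

theorem footPoint_chordPoint (i : Fin (d + 2)) (q : Simplex d) {τ : ℝ} (h0 : 0 ≤ τ)
    (h1 : τ ≤ outerLength q) : footPoint i (chordPoint i q τ) = q := by
  refine simplex_ext fun k => ?_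
  rw [footPoint_apply, chordPoint_apply_self i q h0 h1, chordPoint_apply_succAbove i q h0 h1]
  ring

theorem apply_le_outerLength (i : Fin (d + 2)) (y : Simplex (d + 1)) :
    y i ≤ outerLength (footPoint i y) := by
  rw [le_outerLength_iff]
  intro k
  rw [footPoint_apply]
  linarith [stdSimplex.zero_le y (i.succAbove k)]

theorem chordPoint_footPoint (i : Fin (d + 2)) (y : Simplex (d + 1)) :
    chordPoint i (footPoint i y) (y i) = y := by
  have h0 : 0 ≤ y i := stdSimplex.zero_le y i
  have h1 := apply_le_outerLength i y
  refine simplex_ext fun j => ?_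
  refine Fin.succAboveCases i ?_ (fun k => ?_) j
  · rw [chordPoint_apply_self i _ h0 h1]
  · rw [chordPoint_apply_succAbove i _ h0 h1, footPoint_apply]; ring

theorem chordPoint_zero (i : Fin (d + 2)) (q : Simplex d) : chordPoint i q 0 = faceMap i q := by
  refine simplex_ext fun j => ?_
  refine Fin.succAboveCases i ?_ (fun k => ?_) j
  · rw [chordPoint_apply_self i _ le_rfl (outerLength_nonneg q), faceMap_apply_self]
  · rw [chordPoint_apply_succAbove i _ le_rfl (outerLength_nonneg q), faceMap_apply_succAbove]
    simp

theorem footPoint_faceMap (i : Fin (d + 2)) (q : Simplex d) : footPoint i (faceMap i q) = q := by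
  rw [← chordPoint_zero, footPoint_chordPoint i q le_rfl (outerLength_nonneg q)]

theorem mem_simplexInterior_iff_chord (i : Fin (d + 2)) (y : Simplex (d + 1)) :
    y ∈ simplexInterior (d + 1) ↔ 0 < y i ∧ y i < outerLength (footPoint i y) := by
  rw [lt_outerLength_iff]
  simp only [footPoint_apply]
  constructor
  · exact fun h => ⟨h i, fun k => by linarith [h (i.succAbove k)]⟩
  · rintro ⟨h0, h⟩ j
    refine Fin.succAboveCases i h0 (fun k => ?_) j
    linarith [h k]

/-- The subsimplex spanned by the centre and the `i`-th face in the coordinates given by the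
chords. -/
theorem forall_apply_le_iff_chord (i : Fin (d + 2)) (y : Simplex (d + 1)) :
    (∀ j, y i ≤ y j) ↔ y i ≤ innerLength (footPoint i y) := by
  have hd : (0 : ℝ) < d + 1 := by positivity
  have hd2 : (0 : ℝ) < d + 2 := by positivity
  have hk : y i ≤ innerLength (footPoint i y) ↔ (d + 2) * y i ≤ outerLength (footPoint i y) := by
    rw [outerLength_eq_mul_innerLength, mul_le_mul_iff_right₀ hd2]
  rw [hk, le_outerLength_iff]
  have e : (d + 2) * y i / (d + 1) = y i + y i / ((d : ℝ) + 1) := by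
    field_simp; ring
  simp only [footPoint_apply]
  constructor
  · intro h k
    rw [e]
    linarith [h (i.succAbove k)]
  · intro h j
    refine Fin.succAboveCases i le_rfl (fun k => ?_) j
    have := h k
    rw [e] at this
    linarith

/-! ### The stretching in coordinates -/

/-- The position of the image of `y` under the stretching on the broken line through `y`: it is
measured from the common face, positive in the new simplex and negative in the old one. With
`s₂ = (d + 2) s₁` and `s = s₁ - yᵢ`, it is `(s₁ + s₂) / s₁ * s - s₁ = s₂ - (d + 3) yᵢ`. -/
noncomputable def stretchPosition (i : Fin (d + 2)) (y : Simplex (d + 1)) : ℝ :=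
  outerLength (footPoint i y) - (d + 3) * y i

theorem stretchPosition_le (i : Fin (d + 2)) (y : Simplex (d + 1)) :
    stretchPosition i y ≤ outerLength (footPoint i y) := by
  have h0 : 0 ≤ y i := stdSimplex.zero_le y i
  have : 0 ≤ ((d : ℝ) + 3) * y i := by positivity
  rw [stretchPosition]; linarith

theorem neg_stretchPosition_le {i : Fin (d + 2)} {y : Simplex (d + 1)} (hy : ∀ j, y i ≤ y j) :
    -stretchPosition i y ≤ innerLength (footPoint i y) := by
  rw [forall_apply_le_iff_chord] at hy
  rw [stretchPosition, outerLength_eq_mul_innerLength]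
  have : ((d : ℝ) + 3) * y i ≤ (d + 3) * innerLength (footPoint i y) := by gcongr
  linarith

theorem innerLength_le_outerLength (q : Simplex d) : innerLength q ≤ outerLength q := by
  rw [outerLength_eq_mul_innerLength]
  have := innerLength_nonneg q
  have hd : (0 : ℝ) ≤ d := by positivity
  nlinarith [mul_nonneg hd this]

variable {M : Type u}

/-- The ratio of the lengths is the same for all broken lines, so that the stretching is
piecewise linear in barycentric coordinates. -/
theorem stretchPoint_eq (φ φ' : Simplex (d + 1) → M) (i i' : Fin (d + 2)) {y : Simplex (d + 1)}
    (hy : ∀ j, y i ≤ y j) :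
    stretchPoint φ i φ' i' y =
      if stretchPosition i y ≤ 0 then φ (chordPoint i (footPoint i y) (-stretchPosition i y))
      else φ' (chordPoint i' (footPoint i y) (stretchPosition i y)) := by
  have hy' := (forall_apply_le_iff_chord i y).1 hy
  set q := footPoint i y with hq
  have key : (innerLength q + outerLength q) / innerLength q * (innerLength q - y i) -
      innerLength q = stretchPosition i y := by
    rw [stretchPosition, ← hq, outerLength_eq_mul_innerLength]
    rcases (innerLength_nonneg q).eq_or_lt with h | h
    · have h0 : y i = 0 := le_antisymm (h ▸ hy') (stdSimplex.zero_le y i)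
      rw [← h, h0]; simp
    · field_simp; ring
  have key' : innerLength q - (innerLength q + outerLength q) / innerLength q *
      (innerLength q - y i) = -stretchPosition i y := by linarith
  have hiff : (innerLength q + outerLength q) / innerLength q * (innerLength q - y i) ≤
      innerLength q ↔ stretchPosition i y ≤ 0 := by
    rw [← key, sub_nonpos]
  simp only [stretchPoint, ← hq, key, key', hiff]

/-- The stretching fixes the points of the walls between the subsimplexes, and the boundary of the
face. -/
theorem stretchPoint_of_le (φ φ' : Simplex (d + 1) → M) (i i' : Fin (d + 2)) {y : Simplex (d + 1)}
    (hy : ∀ j, y i ≤ y j) {k : Fin (d + 1)} (hk : y (i.succAbove k) ≤ y i) :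
    stretchPoint φ i φ' i' y = φ y := by
  have hd : (0 : ℝ) < d + 1 := by positivity
  have hy' := (forall_apply_le_iff_chord i y).1 hy
  have hin : innerLength (footPoint i y) = y i := by
    refine le_antisymm ?_ hy'
    have h1 := iInf_simplex_le (footPoint i y) k
    rw [footPoint_apply] at h1
    rw [innerLength, div_mul_eq_mul_div, div_le_iff₀ (by positivity)]
    calc ((d : ℝ) + 1) * (⨅ k, footPoint i y k) ≤ (d + 1) * (y i + y i / (d + 1)) := by
          gcongr; linarith
      _ = y i * (d + 2) := by field_simp; ring
  have hpos : stretchPosition i y = -y i := by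
    rw [stretchPosition, outerLength_eq_mul_innerLength, hin]; ring
  rw [stretchPoint_eq φ φ' i i' hy, hpos, neg_neg, if_pos
    (neg_nonpos.2 (stdSimplex.zero_le y i)), chordPoint_footPoint]

/-- The part of the stretching in one of the two simplexes, as a linear map, on the set of points
whose foot has the least coordinate `k`: the chord through `y` is mapped to the chord with the same
foot over the face opposite to `j`, the position is multiplied by the sign `c`. -/
noncomputable def stretchLinear (i j : Fin (d + 2)) (k : Fin (d + 1)) (c : ℝ) :
    (Fin (d + 2) → ℝ) →L[ℝ] (Fin (d + 2) → ℝ) :=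
  LinearMap.toContinuousLinearMap
    { toFun := fun v => j.insertNth
        (c * ((d + 1) * (v (i.succAbove k) + v i / (d + 1)) - (d + 3) * v i))
        fun m => v (i.succAbove m) + v i / (d + 1) -
          c * ((d + 1) * (v (i.succAbove k) + v i / (d + 1)) - (d + 3) * v i) / (d + 1)
      map_add' := fun v w => by
        funext l
        refine Fin.succAboveCases j ?_ (fun m => ?_) l
        · simp; ring
        · simp; ring
      map_smul' := fun a v => by
        funext l
        refine Fin.succAboveCases j ?_ (fun m => ?_) l
        · simp; ring
        · simp; ring }

theorem stretchLinear_apply_self (i j : Fin (d + 2)) (k : Fin (d + 1)) (c : ℝ)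
    (v : Fin (d + 2) → ℝ) : stretchLinear i j k c v j =
      c * ((d + 1) * (v (i.succAbove k) + v i / (d + 1)) - (d + 3) * v i) := by
  simp [stretchLinear]

theorem stretchLinear_apply_succAbove (i j : Fin (d + 2)) (k : Fin (d + 1)) (c : ℝ)
    (v : Fin (d + 2) → ℝ) (m : Fin (d + 1)) : stretchLinear i j k c v (j.succAbove m) =
      v (i.succAbove m) + v i / (d + 1) -
          c * ((d + 1) * (v (i.succAbove k) + v i / (d + 1)) - (d + 3) * v i) / (d + 1) := by
  simp [stretchLinear]

theorem sum_stretchLinear (i j : Fin (d + 2)) (k : Fin (d + 1)) (c : ℝ) (v : Fin (d + 2) → ℝ) :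
    ∑ l, stretchLinear i j k c v l = ∑ l, v l := by
  have hd : (d : ℝ) + 1 ≠ 0 := by positivity
  rw [Fin.sum_univ_succAbove _ j, Fin.sum_univ_succAbove v i, stretchLinear_apply_self]
  simp only [stretchLinear_apply_succAbove, Finset.sum_sub_distrib, Finset.sum_add_distrib,
    Finset.sum_const, Finset.card_univ, Fintype.card_fin, nsmul_eq_mul]
  push_cast
  field_simp
  ring

theorem stretchLinear_injective (i j : Fin (d + 2)) (k : Fin (d + 1)) {c : ℝ} (hc : c ≠ 0) :
    Function.Injective (stretchLinear i j k c) := by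
  refine (injective_iff_map_eq_zero _).2 fun v hv => ?_
  have hj := congrFun hv j
  rw [stretchLinear_apply_self] at hj
  have ht := (mul_eq_zero.1 hj).resolve_left hc
  have hm : ∀ m, v (i.succAbove m) + v i / (d + 1) = 0 := fun m => by
    have := congrFun hv (j.succAbove m)
    rw [stretchLinear_apply_succAbove, ht] at this
    simpa using this
  rw [hm k, mul_zero, zero_sub, neg_eq_zero] at ht
  have hi : v i = 0 := (mul_eq_zero.1 ht).resolve_left (by positivity)
  funext l
  refine Fin.succAboveCases i hi (fun m => ?_) l
  simpa [hi] using hm m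

theorem stretchPosition_eq_of_forall_le (i : Fin (d + 2)) {k : Fin (d + 1)} {y : Simplex (d + 1)}
    (hk : ∀ m, y (i.succAbove k) ≤ y (i.succAbove m)) :
    stretchPosition i y = (d + 1) * (y (i.succAbove k) + y i / (d + 1)) - (d + 3) * y i := by
  have hmin : (⨅ m, footPoint i y m) = y (i.succAbove k) + y i / (d + 1) := by
    refine le_antisymm (iInf_simplex_le (footPoint i y) k) (le_ciInf fun m => ?_)
    rw [footPoint_apply]
    linarith [hk m]
  rw [stretchPosition, outerLength, hmin]

theorem stretchLinear_eq_chordPoint (i j : Fin (d + 2)) {k : Fin (d + 1)} {c : ℝ}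
    {y : Simplex (d + 1)} (hk : ∀ m, y (i.succAbove k) ≤ y (i.succAbove m))
    (h0 : 0 ≤ c * stretchPosition i y)
    (h1 : c * stretchPosition i y ≤ outerLength (footPoint i y)) :
    stretchLinear i j k c y = (chordPoint j (footPoint i y) (c * stretchPosition i y)).1 := by
  have hpos := stretchPosition_eq_of_forall_le i hk
  rw [chordPoint_val j _ h0 h1]
  funext l
  refine Fin.succAboveCases j ?_ (fun m => ?_) l
  · rw [stretchLinear_apply_self, ← hpos]; simp [chordVector]
  · rw [stretchLinear_apply_succAbove, ← hpos]; simp [chordVector, footPoint_apply]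

end Chords

/-! ### The closed stretching map -/

section Stretch

variable {d : ℕ} {M : Type u}

open Classical in
/-- The stretching on the closed polyhedron: unlike `extensionMap`, it also moves the points of the
common face, to the opposite end of their broken lines. -/
noncomputable def closedStretch (φ : Simplex (d + 1) → M) (i : Fin (d + 2))
    (φ' : Simplex (d + 1) → M) (i' : Fin (d + 2)) (x : M) : M :=
  if h : ∃ y, (∀ j, y i ≤ y j) ∧ φ y = x then stretchPoint φ i φ' i' h.choose else x

variable {φ φ' : Simplex (d + 1) → M} {i i' : Fin (d + 2)}

theorem closedStretch_of_forall_le (hφ : Function.Injective φ) {y : Simplex (d + 1)}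
    (hy : ∀ j, y i ≤ y j) : closedStretch φ i φ' i' (φ y) = stretchPoint φ i φ' i' y := by
  have h : ∃ z, (∀ j, z i ≤ z j) ∧ φ z = φ y := ⟨y, hy, rfl⟩
  rw [closedStretch, dif_pos h, hφ h.choose_spec.2]

theorem closedStretch_of_not {x : M} (h : ¬∃ y, (∀ j, y i ≤ y j) ∧ φ y = x) :
    closedStretch φ i φ' i' x = x := by
  rw [closedStretch, dif_neg h]

theorem closedStretch_of_le (hφ : Function.Injective φ) {y : Simplex (d + 1)} {k : Fin (d + 1)}
    (hk : y (i.succAbove k) ≤ y i) : closedStretch φ i φ' i' (φ y) = φ y := by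
  by_cases hy : ∀ j, y i ≤ y j
  · rw [closedStretch_of_forall_le hφ hy, stretchPoint_of_le φ φ' i i' hy hk]
  · refine closedStretch_of_not ?_
    rintro ⟨z, hz, hzy⟩
    exact hy (hφ hzy ▸ hz)

/-- A point that is moved by the stretching and is not an inner point of `φ` is an inner point of
the common face. -/
theorem closedStretch_eq_self_or (hφ : Function.Injective φ) {x : M}
    (hx : x ∉ φ '' simplexInterior (d + 1)) :
    closedStretch φ i φ' i' x = x ∨ x ∈ (φ ∘ faceMap i) '' simplexInterior d := by
  by_cases h : ∃ y, (∀ j, y i ≤ y j) ∧ φ y = x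
  · obtain ⟨y, hy, rfl⟩ := h
    by_cases hk : ∃ k, y (i.succAbove k) ≤ y i
    · obtain ⟨k, hk⟩ := hk
      exact Or.inl (closedStretch_of_le hφ hk)
    · push Not at hk
      have hyi : y i = 0 := by
        by_contra h0
        have h0 : 0 < y i := lt_of_le_of_ne (stdSimplex.zero_le y i) (Ne.symm h0)
        exact hx ⟨y, fun j => h0.trans_le (hy j), rfl⟩
      obtain ⟨q, rfl, hq⟩ := exists_faceMap_eq hyi
      exact Or.inr ⟨q, fun k => by rw [hq]; exact hyi ▸ hk k, rfl⟩
  · exact Or.inl (closedStretch_of_not h)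

/-- The stretching of a point of the common face. -/
theorem closedStretch_face (hφ : Function.Injective φ) {q : Simplex d}
    (hq : q ∈ simplexInterior d) :
    closedStretch φ i φ' i' (φ (faceMap i q)) = φ' (chordPoint i' q (outerLength q)) := by
  have hy : ∀ j, faceMap i q i ≤ faceMap i q j := fun j => by
    rw [faceMap_apply_self]; exact stdSimplex.zero_le _ j
  have hpos : stretchPosition i (faceMap i q) = outerLength q := by
    rw [stretchPosition, footPoint_faceMap, faceMap_apply_self]; ring
  rw [closedStretch_of_forall_le hφ hy, stretchPoint_eq φ φ' i i' hy, hpos, footPoint_faceMap,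
    if_neg (not_le.2 (outerLength_pos_iff.2 hq))]

theorem chordPoint_outerLength_mem_boundary (i' : Fin (d + 2)) (q : Simplex d) :
    chordPoint i' q (outerLength q) ∈ simplexBoundary (d + 1) := by
  rw [← not_mem_simplexInterior_iff, mem_simplexInterior_iff_chord i',
    footPoint_chordPoint i' q (outerLength_nonneg q) le_rfl,
    chordPoint_apply_self i' q (outerLength_nonneg q) le_rfl]
  exact fun h => lt_irrefl _ h.2

/-- The stretching maps the inner points of the subsimplex bijectively onto the points of the
subsimplex, of the open face and of the new open simplex. -/
theorem bijOn_stretchPoint (hφ : Function.Injective φ) (hφ' : Function.Injective φ')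
    (hdisj : Disjoint (range φ) (φ' '' simplexInterior (d + 1))) :
    BijOn (stretchPoint φ i φ' i') {y | y ∈ simplexInterior (d + 1) ∧ ∀ j, y i ≤ y j}
      (φ '' {y | y ∈ simplexInterior (d + 1) ∧ ∀ j, y i ≤ y j} ∪
        (φ ∘ faceMap i) '' simplexInterior d ∪ φ' '' simplexInterior (d + 1)) := by
  have hd3 : (0 : ℝ) < d + 3 := by positivity
  -- the foot is an inner point, and the position is inside of the broken line
  have foot : ∀ y : Simplex (d + 1), y ∈ simplexInterior (d + 1) →
      footPoint i y ∈ simplexInterior d ∧ stretchPosition i y < outerLength (footPoint i y) := by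
    intro y hy
    have h := (mem_simplexInterior_iff_chord i y).1 hy
    refine ⟨outerLength_pos_iff.1 (h.1.trans h.2), ?_⟩
    have := mul_pos hd3 h.1
    rw [stretchPosition]; linarith
  have neg_le : ∀ y : Simplex (d + 1), (∀ j, y i ≤ y j) →
      -stretchPosition i y ≤ outerLength (footPoint i y) := fun y hy =>
    (neg_stretchPosition_le hy).trans (innerLength_le_outerLength _)
  have new_mem : ∀ y : Simplex (d + 1), y ∈ simplexInterior (d + 1) → 0 < stretchPosition i y →
      chordPoint i' (footPoint i y) (stretchPosition i y) ∈ simplexInterior (d + 1) := by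
    intro y hy hpos
    have h1 := (foot y hy).2
    rw [mem_simplexInterior_iff_chord i', footPoint_chordPoint i' _ hpos.le h1.le,
      chordPoint_apply_self i' _ hpos.le h1.le]
    exact ⟨hpos, h1⟩
  have determine : ∀ y z : Simplex (d + 1), footPoint i y = footPoint i z →
      stretchPosition i y = stretchPosition i z → y = z := by
    intro y z hf hp
    have : y i = z i := by
      rw [stretchPosition, stretchPosition, hf] at hp
      exact mul_left_cancel₀ hd3.ne' (by linarith)
    rw [← chordPoint_footPoint i y, ← chordPoint_footPoint i z, hf, this]
  -- the point of the subsimplex with given foot and position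
  have exists_pt : ∀ (q : Simplex d) (t : ℝ), q ∈ simplexInterior d → -innerLength q ≤ t →
      t < outerLength q → ∃ y : Simplex (d + 1), y ∈ simplexInterior (d + 1) ∧ (∀ j, y i ≤ y j) ∧
        footPoint i y = q ∧ stretchPosition i y = t := by
    intro q t hq ht1 ht2
    have hin : innerLength q < outerLength q := by
      rw [outerLength_eq_mul_innerLength]
      have h1 : 0 < innerLength q := by
        have := outerLength_pos_iff.2 hq
        rw [outerLength_eq_mul_innerLength] at this
        exact pos_of_mul_pos_right this (by positivity)
      have hd : (0 : ℝ) ≤ d := by positivity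
      nlinarith [mul_nonneg hd h1.le]
    have hτ0 : 0 < (outerLength q - t) / (d + 3) := div_pos (by linarith) hd3
    have hτ1 : (outerLength q - t) / (d + 3) ≤ innerLength q := by
      rw [div_le_iff₀ hd3, outerLength_eq_mul_innerLength]; linarith
    have hτ2 := hτ1.trans_lt hin
    have hf := footPoint_chordPoint i q hτ0.le hτ2.le
    have hc := chordPoint_apply_self i q hτ0.le hτ2.le
    refine ⟨chordPoint i q ((outerLength q - t) / (d + 3)), ?_, ?_, hf, ?_⟩
    · rw [mem_simplexInterior_iff_chord i, hf, hc]; exact ⟨hτ0, hτ2⟩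
    · rw [forall_apply_le_iff_chord, hf, hc]; exact hτ1
    · rw [stretchPosition, hf, hc]; field_simp; ring
  refine ⟨?_, ?_, ?_⟩
  · rintro y ⟨hyi, hy⟩
    rw [stretchPoint_eq φ φ' i i' hy]
    split_ifs with hpos
    · left
      rcases hpos.eq_or_lt with h0 | hneg
      · right
        exact ⟨footPoint i y, (foot y hyi).1, by rw [h0, neg_zero, chordPoint_zero]; rfl⟩
      · left
        have h0 : 0 < -stretchPosition i y := by linarith
        have h1 := neg_stretchPosition_le hy
        have h2 := neg_le y hy
        have hj : ∀ j, chordPoint i (footPoint i y) (-stretchPosition i y) i ≤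
            chordPoint i (footPoint i y) (-stretchPosition i y) j := by
          rw [forall_apply_le_iff_chord, footPoint_chordPoint i _ h0.le h2,
            chordPoint_apply_self i _ h0.le h2]
          exact h1
        refine ⟨_, ⟨fun j => lt_of_lt_of_le ?_ (hj j), hj⟩, rfl⟩
        rw [chordPoint_apply_self i _ h0.le h2]
        exact h0
    · right
      exact ⟨_, new_mem y hyi (not_le.1 hpos), rfl⟩
  · rintro y ⟨hyi, hy⟩ z ⟨hzi, hz⟩ h
    rw [stretchPoint_eq φ φ' i i' hy, stretchPoint_eq φ φ' i i' hz] at h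
    split_ifs at h with h1 h2 h2
    · have e := hφ h
      have e1 := congrArg (footPoint i) e
      rw [footPoint_chordPoint i _ (neg_nonneg.2 h1) (neg_le y hy),
        footPoint_chordPoint i _ (neg_nonneg.2 h2) (neg_le z hz)] at e1
      have e2 := congrArg (fun w : Simplex (d + 1) => w i) e
      simp only [chordPoint_apply_self i _ (neg_nonneg.2 h1) (neg_le y hy),
        chordPoint_apply_self i _ (neg_nonneg.2 h2) (neg_le z hz)] at e2
      exact determine y z e1 (neg_injective e2)
    · exact absurd (mem_image_of_mem φ' (new_mem z hzi (not_le.1 h2)))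
        (disjoint_left.1 hdisj ⟨_, h⟩)
    · exact absurd (mem_image_of_mem φ' (new_mem y hyi (not_le.1 h1)))
        (disjoint_left.1 hdisj ⟨_, h.symm⟩)
    · have e := hφ' h
      have e1 := congrArg (footPoint i') e
      rw [footPoint_chordPoint i' _ (not_le.1 h1).le (foot y hyi).2.le,
        footPoint_chordPoint i' _ (not_le.1 h2).le (foot z hzi).2.le] at e1
      have e2 := congrArg (fun w : Simplex (d + 1) => w i') e
      simp only [chordPoint_apply_self i' _ (not_le.1 h1).le (foot y hyi).2.le,
        chordPoint_apply_self i' _ (not_le.1 h2).le (foot z hzi).2.le] at e2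
      exact determine y z e1 e2
  · rintro x ((⟨w, ⟨hwi, hw⟩, rfl⟩ | ⟨q, hq, rfl⟩) | ⟨w, hwi, rfl⟩)
    · have hw0 := (mem_simplexInterior_iff_chord i w).1 hwi
      obtain ⟨y, hyi, hy, hf, hp⟩ := exists_pt (footPoint i w) (-w i)
        (outerLength_pos_iff.1 (hw0.1.trans hw0.2))
        (neg_le_neg ((forall_apply_le_iff_chord i w).1 hw)) (by linarith [hw0.1, hw0.2])
      refine ⟨y, ⟨hyi, hy⟩, ?_⟩
      rw [stretchPoint_eq φ φ' i i' hy, hp, hf, if_pos (by linarith [hw0.1]), neg_neg,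
        chordPoint_footPoint]
    · obtain ⟨y, hyi, hy, hf, hp⟩ := exists_pt q 0 hq (neg_nonpos.2 (innerLength_nonneg q))
        (outerLength_pos_iff.2 hq)
      refine ⟨y, ⟨hyi, hy⟩, ?_⟩
      rw [stretchPoint_eq φ φ' i i' hy, hp, hf, if_pos le_rfl, neg_zero, chordPoint_zero]
      rfl
    · have hw0 := (mem_simplexInterior_iff_chord i' w).1 hwi
      obtain ⟨y, hyi, hy, hf, hp⟩ := exists_pt (footPoint i' w) (w i')
        (outerLength_pos_iff.1 (hw0.1.trans hw0.2))
        (by linarith [innerLength_nonneg (footPoint i' w), hw0.1]) hw0.2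
      refine ⟨y, ⟨hyi, hy⟩, ?_⟩
      rw [stretchPoint_eq φ φ' i i' hy, hp, hf, if_neg (not_le.2 hw0.1), chordPoint_footPoint]

/-- On white points the stretching agrees with the extension map. -/
theorem extensionMap_eq_closedStretch (hφ : Function.Injective φ) {x : M}
    (hx : x ∉ (φ ∘ faceMap i) '' simplexInterior d) :
    extensionMap φ i φ' i' x = closedStretch φ i φ' i' x := by
  by_cases h : ∃ y ∈ simplexInterior (d + 1), (∀ j, y i ≤ y j) ∧ φ y = x
  · obtain ⟨y, hyi, hy, rfl⟩ := h
    have h : ∃ z ∈ simplexInterior (d + 1), (∀ j, z i ≤ z j) ∧ φ z = φ y := ⟨y, hyi, hy, rfl⟩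
    rw [closedStretch_of_forall_le hφ hy, extensionMap, dif_pos h, hφ h.choose_spec.2.2]
  · rw [extensionMap, dif_neg h]
    by_cases h' : ∃ y, (∀ j, y i ≤ y j) ∧ φ y = x
    · obtain ⟨y, hy, rfl⟩ := h'
      have : φ y ∉ φ '' simplexInterior (d + 1) := by
        rintro ⟨z, hz, hzy⟩
        exact h ⟨z, hz, hφ hzy ▸ hy, hzy⟩
      exact ((closedStretch_eq_self_or hφ this).resolve_right hx).symm
    · exact (closedStretch_of_not h').symm

end Stretch

/-! ### Piecewise linear maps into the polyhedron -/

section Pieces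

variable {d : ℕ} {M : Type u}

/-- A piece of a map `g` of the standard simplex: on a closed convex set `Q`, the map is the
composition of a linear automorphism `A`, which preserves the sum of the coordinates, with a simplex
`φ` of the set `P`. The set `Q` need not lie in the standard simplex; only the points of the simplex
in it matter. -/
structure IsLinearPiece (g : Simplex (d + 1) → M) (P : Set (Simplex (d + 1) → M))
    (Q : Set (Fin (d + 2) → ℝ)) (A : (Fin (d + 2) → ℝ) →L[ℝ] (Fin (d + 2) → ℝ))
    (φ : Simplex (d + 1) → M) : Prop where
  isClosed : IsClosed Q
  convex : Convex ℝ Q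
  mem : φ ∈ P
  sum_eq : ∀ v, ∑ j, A v j = ∑ j, v j
  injective : Function.Injective A
  eq : ∀ y : Simplex (d + 1), (y : Fin (d + 2) → ℝ) ∈ Q → ∃ z : Simplex (d + 1), z.1 = A y ∧
    g y = φ z

/-- The map `g` has finitely many linear pieces that cover the set `S`. -/
def HasLinearPieces (g : Simplex (d + 1) → M) (P : Set (Simplex (d + 1) → M))
    (S : Set (Fin (d + 2) → ℝ)) : Prop :=
  ∃ s : Set (Set (Fin (d + 2) → ℝ) × ((Fin (d + 2) → ℝ) →L[ℝ] (Fin (d + 2) → ℝ)) ×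
    (Simplex (d + 1) → M)), s.Finite ∧ (∀ p ∈ s, IsLinearPiece g P p.1 p.2.1 p.2.2) ∧
    ∀ y : Simplex (d + 1), (y : Fin (d + 2) → ℝ) ∈ S → ∃ p ∈ s, (y : Fin (d + 2) → ℝ) ∈ p.1

theorem IsLinearPiece.hasLinearPieces {g : Simplex (d + 1) → M} {P : Set (Simplex (d + 1) → M)}
    {Q : Set (Fin (d + 2) → ℝ)} {A : (Fin (d + 2) → ℝ) →L[ℝ] (Fin (d + 2) → ℝ)}
    {φ : Simplex (d + 1) → M} (h : IsLinearPiece g P Q A φ) : HasLinearPieces g P Q :=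
  ⟨{(Q, A, φ)}, finite_singleton _, by rintro p rfl; exact h, fun y hy => ⟨_, rfl, hy⟩⟩

theorem HasLinearPieces.iUnion {ι : Type*} {s : Set ι} (hs : s.Finite) {g : Simplex (d + 1) → M}
    {P : Set (Simplex (d + 1) → M)} {S : ι → Set (Fin (d + 2) → ℝ)}
    (h : ∀ a ∈ s, HasLinearPieces g P (S a)) : HasLinearPieces g P (⋃ a ∈ s, S a) := by
  choose! t ht using h
  refine ⟨⋃ a ∈ s, t a, hs.biUnion fun a ha => (ht a ha).1, fun p hp => ?_, fun y hy => ?_⟩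
  · simp only [mem_iUnion] at hp
    obtain ⟨a, ha, hp⟩ := hp
    exact (ht a ha).2.1 p hp
  · simp only [mem_iUnion] at hy
    obtain ⟨a, ha, hy⟩ := hy
    obtain ⟨p, hp, hyp⟩ := (ht a ha).2.2 y hy
    exact ⟨p, mem_biUnion ha hp, hyp⟩

theorem HasLinearPieces.mono {g : Simplex (d + 1) → M} {P : Set (Simplex (d + 1) → M)}
    {S S' : Set (Fin (d + 2) → ℝ)} (h : HasLinearPieces g P S')
    (hS : ∀ y : Simplex (d + 1), (y : Fin (d + 2) → ℝ) ∈ S → (y : Fin (d + 2) → ℝ) ∈ S') :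
    HasLinearPieces g P S := by
  obtain ⟨s, hs, hp, hc⟩ := h
  exact ⟨s, hs, hp, fun y hy => hc y (hS y hy)⟩

theorem isClosed_setOf_le_clm {V ι : Type*} [NormedAddCommGroup V] [NormedSpace ℝ V]
    (a b : ι → V →L[ℝ] ℝ) : IsClosed {v | ∀ l, a l v ≤ b l v} := by
  simp only [ofPred_forall]
  exact isClosed_iInter fun l => isClosed_le (a l).continuous (b l).continuous

theorem convex_setOf_le_clm {V ι : Type*} [NormedAddCommGroup V] [NormedSpace ℝ V]
    (a b : ι → V →L[ℝ] ℝ) : Convex ℝ {v | ∀ l, a l v ≤ b l v} := by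
  intro v hv w hw s t hs ht _ l
  simp only [map_add, map_smul, smul_eq_mul]
  exact add_le_add (mul_le_mul_of_nonneg_left (hv l) hs) (mul_le_mul_of_nonneg_left (hw l) ht)

theorem HasLinearPieces.union {g : Simplex (d + 1) → M} {P : Set (Simplex (d + 1) → M)}
    {S S' : Set (Fin (d + 2) → ℝ)} (h : HasLinearPieces g P S) (h' : HasLinearPieces g P S') :
    HasLinearPieces g P (S ∪ S') := by
  obtain ⟨s, hs, hp, hc⟩ := h
  obtain ⟨s', hs', hp', hc'⟩ := h'
  refine ⟨s ∪ s', hs.union hs', fun p hp₀ => hp₀.elim (hp p) (hp' p), fun y hy => ?_⟩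
  rcases hy with hy | hy
  · obtain ⟨p, hps, hyp⟩ := hc y hy
    exact ⟨p, Or.inl hps, hyp⟩
  · obtain ⟨p, hps, hyp⟩ := hc' y hy
    exact ⟨p, Or.inr hps, hyp⟩

/-- A linear piece is cut by the stretching into finitely many linear pieces. -/
theorem IsLinearPiece.closedStretch {g : Simplex (d + 1) → M} {P : Set (Simplex (d + 1) → M)}
    {Q : Set (Fin (d + 2) → ℝ)} {A : (Fin (d + 2) → ℝ) →L[ℝ] (Fin (d + 2) → ℝ)}
    {φ φ' φ₁ : Simplex (d + 1) → M} {i i' : Fin (d + 2)} (h : IsLinearPiece g P Q A φ₁)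
    (hφ : Function.Injective φ) (hcom : φ ∘ faceMap i = φ' ∘ faceMap i')
    (hid : φ₁ ≠ φ → ∀ z, closedStretch φ i φ' i' (φ₁ z) = φ₁ z) :
    HasLinearPieces (closedStretch φ i φ' i' ∘ g) (insert φ' P) Q := by
  by_cases hφ₁ : φ₁ = φ
  swap
  · refine IsLinearPiece.hasLinearPieces (A := A) (φ := φ₁) ⟨h.isClosed, h.convex,
      mem_insert_of_mem _ h.mem, h.sum_eq, h.injective, fun y hy => ?_⟩
    obtain ⟨z, hz, hgz⟩ := h.eq y hy
    exact ⟨z, hz, by rw [Function.comp_apply, hgz, hid hφ₁]⟩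
  subst hφ₁
  let c : Fin (d + 2) → (Fin (d + 2) → ℝ) →L[ℝ] ℝ := fun j => (ContinuousLinearMap.proj j).comp A
  let τ : Fin (d + 1) → (Fin (d + 2) → ℝ) →L[ℝ] ℝ := fun k =>
    (ContinuousLinearMap.proj i).comp ((stretchLinear i i k 1).comp A)
  have hτ : ∀ (k : Fin (d + 1)) (z : Simplex (d + 1)) (v : Fin (d + 2) → ℝ), z.1 = A v →
      (∀ m, A v (i.succAbove k) ≤ A v (i.succAbove m)) → τ k v = stretchPosition i z := by
    intro k z v hz hk
    rw [← hz] at hk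
    rw [stretchPosition_eq_of_forall_le i hk]
    change stretchLinear i i k 1 (A v) i = _
    rw [stretchLinear_apply_self, ← hz, one_mul]
    rfl
  -- outside of the subsimplex
  let N : Fin (d + 1) → Set (Fin (d + 2) → ℝ) := fun k =>
    Q ∩ {v | ∀ _ : Unit, c (i.succAbove k) v ≤ c i v}
  -- the part that stays in the old simplex
  let S : Fin (d + 1) → Set (Fin (d + 2) → ℝ) := fun k =>
    Q ∩ {v | ∀ j, c i v ≤ c j v} ∩ {v | ∀ m, c (i.succAbove k) v ≤ c (i.succAbove m) v}
  let S₁ : Fin (d + 1) → Set (Fin (d + 2) → ℝ) := fun k =>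
    S k ∩ {v | ∀ _ : Unit, τ k v ≤ (0 : (Fin (d + 2) → ℝ) →L[ℝ] ℝ) v}
  -- the part that moves to the new simplex
  let S₂ : Fin (d + 1) → Set (Fin (d + 2) → ℝ) := fun k =>
    S k ∩ {v | ∀ _ : Unit, (0 : (Fin (d + 2) → ℝ) →L[ℝ] ℝ) v ≤ τ k v}
  have hScl : ∀ k, IsClosed (S k) := fun k =>
    (h.isClosed.inter (isClosed_setOf_le_clm _ _)).inter (isClosed_setOf_le_clm _ _)
  have hScv : ∀ k, Convex ℝ (S k) := fun k =>
    (h.convex.inter (convex_setOf_le_clm _ _)).inter (convex_setOf_le_clm _ _)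
  have hN : HasLinearPieces (_root_.closedStretch φ₁ i φ' i' ∘ g) (insert φ' P)
      (⋃ k ∈ univ, N k) := by
    refine HasLinearPieces.iUnion finite_univ fun k _ => ?_
    refine IsLinearPiece.hasLinearPieces (A := A) (φ := φ₁)
      ⟨h.isClosed.inter (isClosed_setOf_le_clm _ _), h.convex.inter (convex_setOf_le_clm _ _),
      mem_insert_of_mem _ h.mem, h.sum_eq, h.injective, fun y hy => ?_⟩
    obtain ⟨z, hz, hgz⟩ := h.eq y hy.1
    refine ⟨z, hz, ?_⟩
    have hk : A y (i.succAbove k) ≤ A y i := hy.2 ()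
    rw [← hz] at hk
    rw [Function.comp_apply, hgz, closedStretch_of_le hφ hk]
  have hS₁ : HasLinearPieces (_root_.closedStretch φ₁ i φ' i' ∘ g) (insert φ' P)
      (⋃ k ∈ univ, S₁ k) := by
    refine HasLinearPieces.iUnion finite_univ fun k _ => ?_
    refine IsLinearPiece.hasLinearPieces (A := (stretchLinear i i k (-1)).comp A) (φ := φ₁)
      ⟨(hScl k).inter (isClosed_setOf_le_clm _ _), (hScv k).inter (convex_setOf_le_clm _ _),
      mem_insert_of_mem _ h.mem, fun v => (sum_stretchLinear i i k (-1) (A v)).trans (h.sum_eq v),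
      (stretchLinear_injective i i k (by norm_num)).comp h.injective, fun y hy => ?_⟩
    obtain ⟨⟨⟨hyQ, hsec⟩, hk⟩, hpos⟩ := hy
    obtain ⟨z, hz, hgz⟩ := h.eq y hyQ
    have hp : stretchPosition i z ≤ 0 := hτ k z y hz hk ▸ hpos ()
    replace hsec : ∀ j, A y i ≤ A y j := hsec
    replace hk : ∀ m, A y (i.succAbove k) ≤ A y (i.succAbove m) := hk
    rw [← hz] at hsec hk
    refine ⟨chordPoint i (footPoint i z) (-stretchPosition i z), ?_, ?_⟩
    · rw [ContinuousLinearMap.comp_apply, ← hz]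
      have := stretchLinear_eq_chordPoint (c := -1) i i hk (by linarith)
        (by linarith [neg_stretchPosition_le hsec, innerLength_le_outerLength (footPoint i z)])
      rw [neg_one_mul] at this
      exact this.symm
    · rw [Function.comp_apply, hgz, closedStretch_of_forall_le hφ hsec,
        stretchPoint_eq φ₁ φ' i i' hsec, if_pos hp]
  have hS₂ : HasLinearPieces (_root_.closedStretch φ₁ i φ' i' ∘ g) (insert φ' P)
      (⋃ k ∈ univ, S₂ k) := by
    refine HasLinearPieces.iUnion finite_univ fun k _ => ?_
    refine IsLinearPiece.hasLinearPieces (A := (stretchLinear i i' k 1).comp A) (φ := φ')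
      ⟨(hScl k).inter (isClosed_setOf_le_clm _ _), (hScv k).inter (convex_setOf_le_clm _ _),
      mem_insert _ _, fun v => (sum_stretchLinear i i' k 1 (A v)).trans (h.sum_eq v),
      (stretchLinear_injective i i' k (by norm_num)).comp h.injective, fun y hy => ?_⟩
    obtain ⟨⟨⟨hyQ, hsec⟩, hk⟩, hpos⟩ := hy
    obtain ⟨z, hz, hgz⟩ := h.eq y hyQ
    have hp : 0 ≤ stretchPosition i z := hτ k z y hz hk ▸ hpos ()
    replace hsec : ∀ j, A y i ≤ A y j := hsec
    replace hk : ∀ m, A y (i.succAbove k) ≤ A y (i.succAbove m) := hk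
    rw [← hz] at hsec hk
    refine ⟨chordPoint i' (footPoint i z) (stretchPosition i z), ?_, ?_⟩
    · rw [ContinuousLinearMap.comp_apply, ← hz]
      have := stretchLinear_eq_chordPoint (c := 1) i i' hk (by linarith)
        (by linarith [stretchPosition_le i z])
      rw [one_mul] at this
      exact this.symm
    · rw [Function.comp_apply, hgz, closedStretch_of_forall_le hφ hsec,
        stretchPoint_eq φ₁ φ' i i' hsec]
      split_ifs with h0
      · have h0 : stretchPosition i z = 0 := le_antisymm h0 hp
        rw [h0, neg_zero, chordPoint_zero, chordPoint_zero]
        exact congrFun hcom _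
      · rfl
  refine ((hN.union hS₁).union hS₂).mono fun y hy => ?_
  obtain ⟨z, hz, -⟩ := h.eq y hy
  by_cases hsec : ∀ j, A y i ≤ A y j
  · obtain ⟨k, hk⟩ := exists_eq_ciInf_of_finite (f := fun k => A y (i.succAbove k))
    have hk : ∀ m, A y (i.succAbove k) ≤ A y (i.succAbove m) := fun m =>
      hk.le.trans (ciInf_le (Set.finite_range _).bddBelow m)
    rcases le_total (τ k y) 0 with h0 | h0
    · exact Or.inl (Or.inr (mem_biUnion (mem_univ k) ⟨⟨⟨hy, hsec⟩, hk⟩, fun _ => h0⟩))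
    · exact Or.inr (mem_biUnion (mem_univ k) ⟨⟨⟨hy, hsec⟩, hk⟩, fun _ => h0⟩)
  · push Not at hsec
    obtain ⟨j, hj⟩ := hsec
    obtain ⟨k, rfl⟩ := Fin.exists_succAbove_eq (x := j) (y := i)
      (by rintro rfl; exact lt_irrefl _ hj)
    exact Or.inl (Or.inl (mem_biUnion (mem_univ k) ⟨hy, fun _ => hj.le⟩))

theorem HasLinearPieces.closedStretch {g : Simplex (d + 1) → M} {P : Set (Simplex (d + 1) → M)}
    {φ φ' : Simplex (d + 1) → M} {i i' : Fin (d + 2)} (h : HasLinearPieces g P univ)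
    (hφ : Function.Injective φ) (hcom : φ ∘ faceMap i = φ' ∘ faceMap i')
    (hid : ∀ φ₁ ∈ P, φ₁ ≠ φ → ∀ z, _root_.closedStretch φ i φ' i' (φ₁ z) = φ₁ z) :
    HasLinearPieces (_root_.closedStretch φ i φ' i' ∘ g) (insert φ' P) univ := by
  obtain ⟨s, hs, hp, hc⟩ := h
  refine (HasLinearPieces.iUnion hs (S := fun p => p.1) fun p hps =>
    (hp p hps).closedStretch hφ hcom (hid _ (hp p hps).mem)).mono fun y _ => ?_
  obtain ⟨p, hps, hyp⟩ := hc y (mem_univ _)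
  exact mem_biUnion hps hyp

theorem HasLinearPieces.exists_eq {g : Simplex (d + 1) → M} {P : Set (Simplex (d + 1) → M)}
    (h : HasLinearPieces g P univ) (y : Simplex (d + 1)) : ∃ φ ∈ P, ∃ z, g y = φ z := by
  obtain ⟨s, -, hp, hc⟩ := h
  obtain ⟨p, hps, hyp⟩ := hc y (mem_univ _)
  obtain ⟨z, -, hz⟩ := (hp p hps).eq y hyp
  exact ⟨_, (hp p hps).mem, z, hz⟩

theorem HasLinearPieces.continuous [TopologicalSpace M] {g : Simplex (d + 1) → M}
    {P : Set (Simplex (d + 1) → M)} (h : HasLinearPieces g P univ)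
    (hP : ∀ φ ∈ P, Continuous φ) : Continuous g := by
  obtain ⟨s, hs, hp, hc⟩ := h
  have : Finite s := hs
  refine (locallyFinite_of_finite fun p : s => {y : Simplex (d + 1) | y.1 ∈ p.1.1}).continuous
    (eq_univ_of_forall fun y => ?_) (fun p => ?_) (fun p => ?_)
  · obtain ⟨p, hps, hyp⟩ := hc y (mem_univ _)
    exact mem_iUnion.2 ⟨⟨p, hps⟩, hyp⟩
  · exact (hp p.1 p.2).isClosed.preimage continuous_subtype_val
  · rw [continuousOn_iff_continuous_domRestrict]
    have hz : ∀ y : {y : Simplex (d + 1) | y.1 ∈ p.1.1},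
        p.1.2.1 y.1 ∈ stdSimplex ℝ (Fin (d + 2)) := by
      intro y
      obtain ⟨z, hz, -⟩ := (hp p.1 p.2).eq y.1 y.2
      exact hz ▸ z.2
    have : {y : Simplex (d + 1) | y.1 ∈ p.1.1}.domRestrict g =
        fun y => p.1.2.2 (⟨p.1.2.1 y.1, hz y⟩ : Simplex (d + 1)) := by
      funext y
      obtain ⟨z, hz, hgz⟩ := (hp p.1 p.2).eq y.1 y.2
      rw [domRestrict_apply, hgz]
      exact congrArg _ (Subtype.ext hz)
    rw [this]
    exact (hP _ (hp p.1 p.2).mem).comp (Continuous.subtype_mk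
      (p.1.2.1.continuous.comp (continuous_subtype_val.comp continuous_subtype_val)) _)

end Pieces

/-! ### Invariants of the extension process -/

section Extension

variable {d : ℕ} {M : Type u} [TopologicalSpace M]
  [ChartedSpace (EuclideanSpace ℝ (Fin (d + 1))) M]

/-- The combinatorial properties of the set `W` of white points for the set `P` of painted simplexes
of maximal dimension. -/
structure IsWhiteSet (T : SmoothTriangulation (d + 1) M) (P : Set (Simplex (d + 1) → M))
    (W : Set M) : Prop where
  subset : P ⊆ T.simplexes (d + 1)
  nonempty : P.Nonempty
  inner_subset : ∀ φ ∈ P, φ '' simplexInterior (d + 1) ⊆ W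
  mem_of_inner : ∀ φ ∈ T.simplexes (d + 1),
    ¬Disjoint (φ '' simplexInterior (d + 1)) W → φ ∈ P
  /-- `W` consists of whole open simplexes of codimension at most one. -/
  exists_simplex : ∀ x ∈ W, ∃ l ≥ d, ∃ ρ ∈ T.simplexes l, ∃ z ∈ simplexInterior l, ρ z = x ∧
    ρ '' simplexInterior l ⊆ W
  /-- Both sides of a white face are painted. -/
  mem_of_face : ∀ τ ∈ T.simplexes d, ¬Disjoint (τ '' simplexInterior d) W →
    ∀ φ ∈ T.simplexes (d + 1), ∀ i, φ ∘ faceMap i = τ → φ ∈ P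
  /-- A point of the polyhedron is white or lies in a black face. -/
  cover : ∀ φ ∈ P, ∀ y, φ y ∈ W ∨ ∃ ψ ∈ P, ∃ j, φ y ∈ range (ψ ∘ faceMap j) ∧
    Disjoint ((ψ ∘ faceMap j) '' simplexInterior d) W

/-- A characteristic map of the cell: a continuous extension `g` of `f ∘ φ₀` to the closed simplex
that is piecewise linear in the barycentric coordinates and maps the boundary to black points. -/
structure IsCharacteristicMap (φ₀ : Simplex (d + 1) → M) (P : Set (Simplex (d + 1) → M))
    (W : Set M) (f : M → M) (g : Simplex (d + 1) → M) : Prop where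
  mem : φ₀ ∈ P
  centre : g (simplexCentre (d + 1)) = φ₀ (simplexCentre (d + 1))
  eq : ∀ y ∈ simplexInterior (d + 1), f (φ₀ y) = g y
  bijOn : BijOn g (simplexInterior (d + 1)) W
  boundary : ∀ y ∈ simplexBoundary (d + 1), g y ∉ W
  pieces : HasLinearPieces g P univ

variable {T : SmoothTriangulation (d + 1) M}

theorem isWhiteSet_init {φ₀ : Simplex (d + 1) → M} (hφ₀ : φ₀ ∈ T.simplexes (d + 1)) :
    IsWhiteSet T {φ₀} (φ₀ '' simplexInterior (d + 1)) := by
  have black : ∀ τ ∈ T.simplexes d,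
      Disjoint (τ '' simplexInterior d) (φ₀ '' simplexInterior (d + 1)) := by
    intro τ hτ
    rw [disjoint_left]
    rintro _ ⟨z, hz, rfl⟩ ⟨y, hy, hyz⟩
    exact absurd (T.dim_eq hφ₀ hτ hy hz hyz) (by omega)
  refine ⟨by rintro _ rfl; exact hφ₀, ⟨φ₀, rfl⟩, by rintro _ rfl; exact Subset.rfl, ?_, ?_, ?_, ?_⟩
  · intro φ hφ h
    obtain ⟨_, ⟨y, hy, rfl⟩, z, hz, hzy⟩ := not_disjoint_iff.1 h
    exact T.simplex_eq hφ hφ₀ hy hz hzy.symm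
  · rintro _ ⟨y, hy, rfl⟩
    exact ⟨d + 1, by omega, φ₀, hφ₀, y, hy, rfl, Subset.rfl⟩
  · intro τ hτ h
    exact absurd (black τ hτ) h
  · rintro φ₁ rfl y
    by_cases hy : y ∈ simplexInterior (d + 1)
    · exact Or.inl ⟨y, hy, rfl⟩
    · obtain ⟨j, hj⟩ := not_mem_simplexInterior_iff.1 hy
      obtain ⟨z, rfl, -⟩ := exists_faceMap_eq hj
      exact Or.inr ⟨φ₁, rfl, j, ⟨z, rfl⟩, black _ (T.face_mem d φ₁ hφ₀ j)⟩

theorem isCharacteristicMap_init {φ₀ : Simplex (d + 1) → M} (hφ₀ : φ₀ ∈ T.simplexes (d + 1)) :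
    IsCharacteristicMap φ₀ {φ₀} (φ₀ '' simplexInterior (d + 1)) id φ₀ := by
  refine ⟨rfl, rfl, fun _ _ => rfl, (T.injective hφ₀).injOn.bijOn_image, ?_, ?_⟩
  · rintro y hy ⟨z, hz, hzy⟩
    rw [T.injective hφ₀ hzy] at hz
    exact not_mem_simplexInterior_iff.2 hy hz
  · refine (IsLinearPiece.hasLinearPieces (Q := univ) (A := ContinuousLinearMap.id ℝ _) (φ := φ₀)
      ⟨isClosed_univ, convex_univ, rfl, fun v => rfl, Function.injective_id, fun y _ =>
        ⟨y, rfl, rfl⟩⟩)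

/-- The combinatorial data of one step of the extension process. -/
structure IsExtensionStep (T : SmoothTriangulation (d + 1) M) (P : Set (Simplex (d + 1) → M))
    (W : Set M) (φ : Simplex (d + 1) → M) (i : Fin (d + 2)) (φ' : Simplex (d + 1) → M)
    (i' : Fin (d + 2)) : Prop where
  mem : φ ∈ P
  black : Disjoint ((φ ∘ faceMap i) '' simplexInterior d) W
  simplex : φ' ∈ T.simplexes (d + 1)
  unpainted : φ' ∉ P
  common : φ ∘ faceMap i = φ' ∘ faceMap i'

variable {P : Set (Simplex (d + 1) → M)} {W : Set M} {φ φ' : Simplex (d + 1) → M}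
  {i i' : Fin (d + 2)}

theorem IsExtensionStep.ne (hs : IsExtensionStep T P W φ i φ' i') : φ ≠ φ' := by
  rintro rfl
  exact hs.unpainted hs.mem

theorem IsExtensionStep.eq_of_common [IsManifold (𝓡 (d + 1)) ∞ M]
    (hs : IsExtensionStep T P W φ i φ' i') (hW : IsWhiteSet T P W) {φ₁ : Simplex (d + 1) → M}
    (h₁ : φ₁ ∈ T.simplexes (d + 1)) {i₁ : Fin (d + 2)} (h : φ₁ ∘ faceMap i₁ = φ ∘ faceMap i) :
    φ₁ = φ ∨ φ₁ = φ' :=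
  T.eq_or_eq_of_common_face (hW.subset hs.mem) hs.simplex h₁ hs.common h.symm hs.ne

/-- One step of the extension process keeps the properties of the set of white points. Here it
matters that no third simplex contains the common face, which becomes white. -/
theorem IsWhiteSet.step [IsManifold (𝓡 (d + 1)) ∞ M] (hW : IsWhiteSet T P W)
    (hs : IsExtensionStep T P W φ i φ' i') :
    IsWhiteSet T (insert φ' P)
      (W ∪ (φ ∘ faceMap i) '' simplexInterior d ∪ φ' '' simplexInterior (d + 1)) := by
  have hφ := hW.subset hs.mem
  have hτ := T.face_mem d φ hφ i
  refine ⟨insert_subset hs.simplex hW.subset, ⟨φ', mem_insert _ _⟩, ?_, ?_, ?_, ?_, ?_⟩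
  · rintro φ₁ (rfl | h₁)
    · exact subset_union_right
    · exact ((hW.inner_subset φ₁ h₁).trans subset_union_left).trans subset_union_left
  · intro φ₁ h₁ h
    obtain ⟨_, ⟨y, hy, rfl⟩, (hx | ⟨q, hq, hqy⟩) | ⟨z, hz, hzy⟩⟩ := not_disjoint_iff.1 h
    · exact mem_insert_of_mem _ (hW.mem_of_inner φ₁ h₁ (not_disjoint_iff.2 ⟨_, ⟨y, hy, rfl⟩, hx⟩))
    · exact absurd (T.dim_eq hτ h₁ hq hy hqy) (by omega)
    · exact Or.inl (T.simplex_eq h₁ hs.simplex hy hz hzy.symm)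
  · rintro x ((hx | ⟨q, hq, rfl⟩) | ⟨z, hz, rfl⟩)
    · obtain ⟨l, hl, ρ, hρ, z, hz, hzx, hsub⟩ := hW.exists_simplex x hx
      exact ⟨l, hl, ρ, hρ, z, hz, hzx, (hsub.trans subset_union_left).trans subset_union_left⟩
    · exact ⟨d, le_rfl, _, hτ, q, hq, rfl, subset_union_right.trans subset_union_left⟩
    · exact ⟨d + 1, by omega, _, hs.simplex, z, hz, rfl, subset_union_right⟩
  · intro τ₁ hτ₁ h φ₁ h₁ j hj
    obtain ⟨_, ⟨y, hy, rfl⟩, (hx | ⟨q, hq, hqy⟩) | ⟨z, hz, hzy⟩⟩ := not_disjoint_iff.1 h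
    · exact mem_insert_of_mem _
        (hW.mem_of_face τ₁ hτ₁ (not_disjoint_iff.2 ⟨_, ⟨y, hy, rfl⟩, hx⟩) φ₁ h₁ j hj)
    · have := T.simplex_eq hτ hτ₁ hq hy hqy
      rcases hs.eq_of_common hW h₁ (hj.trans this.symm) with rfl | rfl
      · exact mem_insert_of_mem _ hs.mem
      · exact mem_insert _ _
    · exact absurd (T.dim_eq hs.simplex hτ₁ hz hy hzy) (by omega)
  · -- a face stays black unless it is the common face
    have black : ∀ τ₁ ∈ T.simplexes d, Disjoint (τ₁ '' simplexInterior d) W →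
        τ₁ ≠ φ ∘ faceMap i → Disjoint (τ₁ '' simplexInterior d)
          (W ∪ (φ ∘ faceMap i) '' simplexInterior d ∪ φ' '' simplexInterior (d + 1)) := by
      intro τ₁ hτ₁ hd hne
      rw [disjoint_left]
      rintro _ ⟨y, hy, rfl⟩ ((hx | ⟨q, hq, hqy⟩) | ⟨z, hz, hzy⟩)
      · exact disjoint_left.1 hd ⟨y, hy, rfl⟩ hx
      · exact hne (T.simplex_eq hτ₁ hτ hy hq hqy.symm)
      · exact absurd (T.dim_eq hs.simplex hτ₁ hz hy hzy) (by omega)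
    have new : ∀ y, φ' y ∈ W ∪ (φ ∘ faceMap i) '' simplexInterior d ∪
        φ' '' simplexInterior (d + 1) ∨ ∃ ψ ∈ insert φ' P, ∃ j, φ' y ∈ range (ψ ∘ faceMap j) ∧
        Disjoint ((ψ ∘ faceMap j) '' simplexInterior d) (W ∪ (φ ∘ faceMap i) '' simplexInterior d ∪
        φ' '' simplexInterior (d + 1)) := by
      intro y
      by_cases hy : y ∈ simplexInterior (d + 1)
      · exact Or.inl (Or.inr ⟨y, hy, rfl⟩)
      by_cases hj : ∃ j, j ≠ i' ∧ y j = 0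
      · obtain ⟨j, hji, hj⟩ := hj
        obtain ⟨z, rfl, -⟩ := exists_faceMap_eq hj
        refine Or.inr ⟨φ', mem_insert _ _, j, ⟨z, rfl⟩, ?_⟩
        have hf := T.face_mem d φ' hs.simplex j
        refine black _ hf ?_ fun h => hji (T.face_index_unique hs.simplex (h.trans hs.common))
        by_contra h
        exact hs.unpainted (hW.mem_of_face _ hf h φ' hs.simplex j rfl)
      · push Not at hj
        obtain ⟨j, hj0⟩ := not_mem_simplexInterior_iff.1 hy
        obtain rfl : j = i' := by
          by_contra h
          exact hj j h hj0
        obtain ⟨q, rfl, hq⟩ := exists_faceMap_eq hj0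
        refine Or.inl (Or.inl (Or.inr ⟨q, fun k => ?_, congrFun hs.common q⟩))
        rw [hq]
        exact lt_of_le_of_ne (stdSimplex.zero_le _ _) (hj _ (Fin.succAbove_ne _ _)).symm
    rintro φ₁ (rfl | h₁) y
    · exact new y
    · rcases hW.cover φ₁ h₁ y with hy | ⟨ψ, hψ, j, ⟨z, hz⟩, hd⟩
      · exact Or.inl (Or.inl (Or.inl hy))
      · by_cases hne : ψ ∘ faceMap j = φ ∘ faceMap i
        · rw [hne, hs.common] at hz
          rw [← hz]
          exact new (faceMap i' z)
        · exact Or.inr ⟨ψ, mem_insert_of_mem _ hψ, j, ⟨z, hz⟩,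
            black _ (T.face_mem d ψ (hW.subset hψ) j) hd hne⟩

/-- The stretching fixes all points of the other painted simplexes. In particular, the common face
is not a face of any of them. -/
theorem IsExtensionStep.closedStretch_eq_self [IsManifold (𝓡 (d + 1)) ∞ M]
    (hs : IsExtensionStep T P W φ i φ' i') (hW : IsWhiteSet T P W) {φ₁ : Simplex (d + 1) → M}
    (h₁ : φ₁ ∈ P) (hne : φ₁ ≠ φ) (z : Simplex (d + 1)) :
    closedStretch φ i φ' i' (φ₁ z) = φ₁ z := by
  have hφ := hW.subset hs.mem
  refine (closedStretch_eq_self_or (T.injective hφ) ?_).resolve_right ?_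
  · rintro ⟨y, hy, hyz⟩
    exact hne (T.simplex_eq (hW.subset h₁) hφ
      (T.mem_interior_of_eq (hW.subset h₁) hφ le_rfl hy hyz.symm) hy hyz.symm)
  · rintro ⟨q, hq, hqz⟩
    obtain ⟨j, hj, -⟩ := T.exists_face_eq (hW.subset h₁) (T.face_mem d φ hφ i) hq hqz.symm
    rcases hs.eq_of_common hW (hW.subset h₁) hj with h | h
    · exact hne h
    · exact hs.unpainted (h ▸ h₁)

theorem IsExtensionStep.disjoint (hs : IsExtensionStep T P W φ i φ' i') (hW : IsWhiteSet T P W)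
    {φ₁ : Simplex (d + 1) → M} (h₁ : φ₁ ∈ P) :
    Disjoint (range φ₁) (φ' '' simplexInterior (d + 1)) := by
  rw [disjoint_left]
  rintro _ ⟨y, rfl⟩ ⟨z, hz, hzy⟩
  have hy := T.mem_interior_of_eq (hW.subset h₁) hs.simplex le_rfl hz hzy.symm
  exact hs.unpainted (T.simplex_eq (hW.subset h₁) hs.simplex hy hz hzy.symm ▸ h₁)

/-- The stretching maps the old set of white points bijectively onto the new one. -/
theorem IsExtensionStep.bijOn_closedStretch (hs : IsExtensionStep T P W φ i φ' i')
    (hW : IsWhiteSet T P W) : BijOn (closedStretch φ i φ' i') W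
      (W ∪ (φ ∘ faceMap i) '' simplexInterior d ∪ φ' '' simplexInterior (d + 1)) := by
  have hφ := hW.subset hs.mem
  have hinj := T.injective hφ
  set S := φ '' {y | y ∈ simplexInterior (d + 1) ∧ ∀ j, y i ≤ y j} with hS
  have hSW : S ⊆ W := (image_mono fun y hy => hy.1).trans (hW.inner_subset φ hs.mem)
  have h1 : BijOn (closedStretch φ i φ' i') (W \ S) (W \ S) := by
    refine (bijOn_id _).congr fun x hx => ?_
    by_cases hx' : x ∈ φ '' simplexInterior (d + 1)
    · obtain ⟨y, hy, rfl⟩ := hx'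
      refine (closedStretch_of_not ?_).symm
      rintro ⟨z, hz, hzy⟩
      exact hx.2 ⟨z, ⟨hinj hzy ▸ hy, hz⟩, hzy⟩
    · exact ((closedStretch_eq_self_or hinj hx').resolve_right fun h =>
        disjoint_left.1 hs.black h hx.1).symm
  have h2 : BijOn (closedStretch φ i φ' i') S
      (S ∪ (φ ∘ faceMap i) '' simplexInterior d ∪ φ' '' simplexInterior (d + 1)) := by
    have hb := bijOn_stretchPoint (i := i) (i' := i') hinj (T.injective hs.simplex)
      (hs.disjoint hW hs.mem)
    have he : ∀ y, (∀ j, y i ≤ y j) → closedStretch φ i φ' i' (φ y) = stretchPoint φ i φ' i' y :=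
      fun y hy => closedStretch_of_forall_le hinj hy
    refine ⟨?_, ?_, ?_⟩
    · rintro _ ⟨y, hy, rfl⟩
      rw [he y hy.2]
      exact hb.mapsTo hy
    · rintro _ ⟨y, hy, rfl⟩ _ ⟨z, hz, rfl⟩ h
      rw [he y hy.2, he z hz.2] at h
      rw [hb.injOn hy hz h]
    · intro x hx
      obtain ⟨y, hy, rfl⟩ := hb.surjOn hx
      exact ⟨φ y, ⟨y, hy, rfl⟩, he y hy.2⟩
  have hdisj : Disjoint (W \ S)
      (S ∪ (φ ∘ faceMap i) '' simplexInterior d ∪ φ' '' simplexInterior (d + 1)) := by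
    rw [disjoint_left]
    rintro x ⟨hx, hxS⟩ ((h | h) | h)
    · exact hxS h
    · exact disjoint_left.1 hs.black h hx
    · exact hs.unpainted (hW.mem_of_inner φ' hs.simplex (not_disjoint_iff.2 ⟨x, h, hx⟩))
  have h := h1.union h2 ((injOn_union disjoint_sdiff_left).2 ⟨h1.injOn, h2.injOn, ?_⟩)
  · rw [sdiff_union_of_subset hSW, ← union_assoc, ← union_assoc, sdiff_union_of_subset hSW] at h
    exact h
  · intro x hx y hy h
    exact disjoint_left.1 hdisj (h1.mapsTo hx) (h ▸ h2.mapsTo hy)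

/-- The stretching maps black points of the polyhedron to black points. -/
theorem IsExtensionStep.closedStretch_notMem [IsManifold (𝓡 (d + 1)) ∞ M]
    (hs : IsExtensionStep T P W φ i φ' i') (hW : IsWhiteSet T P W) {φ₁ : Simplex (d + 1) → M}
    (h₁ : φ₁ ∈ P) {z : Simplex (d + 1)} (hz : φ₁ z ∉ W) :
    closedStretch φ i φ' i' (φ₁ z) ∉
      W ∪ (φ ∘ faceMap i) '' simplexInterior d ∪ φ' '' simplexInterior (d + 1) := by
  have hφ := hW.subset hs.mem
  by_cases hface : φ₁ z ∈ (φ ∘ faceMap i) '' simplexInterior d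
  · obtain ⟨q, hq, hqz⟩ := hface
    rw [← hqz, Function.comp_apply, closedStretch_face (T.injective hφ) hq]
    have hq0 := outerLength_pos_iff.2 hq
    have hbd := chordPoint_outerLength_mem_boundary i' q
    rintro ((h | ⟨q', hq', he⟩) | ⟨w, hw, he⟩)
    · obtain ⟨l, hl, ρ, hρ, w, hw, he, hsub⟩ := hW.exists_simplex _ h
      rcases hl.eq_or_lt with rfl | hl
      · obtain ⟨j, hj, -⟩ := T.exists_face_eq hs.simplex hρ hw he.symm
        exact hs.unpainted (hW.mem_of_face ρ hρ (not_disjoint_iff.2 ⟨_, ⟨w, hw, rfl⟩,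
          hsub ⟨w, hw, rfl⟩⟩) φ' hs.simplex j hj)
      · exact not_mem_simplexInterior_iff.2 hbd
          (T.mem_interior_of_eq hs.simplex hρ hl hw he.symm)
    · rw [hs.common] at he
      have := T.injective hs.simplex he
      have h0 : chordPoint i' q (outerLength q) i' = 0 := this ▸ faceMap_apply_self i' q'
      rw [chordPoint_apply_self i' q (outerLength_nonneg q) le_rfl] at h0
      exact hq0.ne' h0
    · rw [T.injective hs.simplex he] at hw
      exact not_mem_simplexInterior_iff.2 hbd hw
  · have hx : φ₁ z ∉ φ '' simplexInterior (d + 1) := fun h => hz (hW.inner_subset φ hs.mem h)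
    rw [(closedStretch_eq_self_or (T.injective hφ) hx).resolve_right hface]
    rintro ((h | h) | h)
    · exact hz h
    · exact hface h
    · exact disjoint_left.1 (hs.disjoint hW h₁) ⟨z, rfl⟩ h

theorem IsCharacteristicMap.step [IsManifold (𝓡 (d + 1)) ∞ M] {φ₀ : Simplex (d + 1) → M}
    {f : M → M} {g : Simplex (d + 1) → M} (hg : IsCharacteristicMap φ₀ P W f g)
    (hW : IsWhiteSet T P W) (hs : IsExtensionStep T P W φ i φ' i') :
    IsCharacteristicMap φ₀ (insert φ' P)
      (W ∪ (φ ∘ faceMap i) '' simplexInterior d ∪ φ' '' simplexInterior (d + 1))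
      (extensionMap φ i φ' i' ∘ f) (closedStretch φ i φ' i' ∘ g) := by
  have hinj := T.injective (hW.subset hs.mem)
  refine ⟨mem_insert_of_mem _ hg.mem, ?_, fun y hy => ?_,
    (hs.bijOn_closedStretch hW).comp hg.bijOn, fun y hy => ?_,
    hg.pieces.closedStretch hinj hs.common fun φ₁ h₁ hne z => hs.closedStretch_eq_self hW h₁ hne z⟩
  · -- the centre lies on the walls of the subsimplex, where the stretching is the identity
    rw [Function.comp_apply, hg.centre]
    by_cases hφ : φ₀ = φ
    · rw [hφ]
      exact closedStretch_of_le (k := 0) hinj (by rw [simplexCentre_apply, simplexCentre_apply])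
    · exact hs.closedStretch_eq_self hW hg.mem hφ _
  · rw [Function.comp_apply, hg.eq y hy, Function.comp_apply]
    exact extensionMap_eq_closedStretch hinj fun h =>
      disjoint_left.1 hs.black h (hg.bijOn.mapsTo hy)
  · obtain ⟨φ₁, h₁, z, hz⟩ := hg.pieces.exists_eq y
    have := hg.boundary y hy
    rw [Function.comp_apply, hz]
    rw [hz] at this
    exact hs.closedStretch_notMem hW h₁ this

/-- The result of the extension process after any number of steps. -/
theorem CellExtension.invariants [IsManifold (𝓡 (d + 1)) ∞ M] {φ₀ : Simplex (d + 1) → M}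
    (hφ₀ : φ₀ ∈ T.simplexes (d + 1)) {f : M → M} (h : CellExtension T φ₀ P W f) :
    IsWhiteSet T P W ∧ ∃ g, IsCharacteristicMap φ₀ P W f g := by
  induction h with
  | init => exact ⟨isWhiteSet_init hφ₀, φ₀, isCharacteristicMap_init hφ₀⟩
  | step P W f φ i φ' i' _ mem black simplex unpainted common ih =>
    obtain ⟨hW, g, hg⟩ := ih
    have hs : IsExtensionStep T P W φ i φ' i' := ⟨mem, black, simplex, unpainted, common⟩
    exact ⟨hW.step hs, _, hg.step hW hs⟩

/-- If the process is finished, all simplexes of maximal dimension are painted: a neighbour of a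
painted simplex is painted, through a black face by assumption and through a white face in any
case. -/
theorem IsWhiteSet.eq_simplexes [IsManifold (𝓡 (d + 1)) ∞ M] [T2Space M] [ConnectedSpace M]
    (hW : IsWhiteSet T P W) (hfin : IsFinished T P W) : P = T.simplexes (d + 1) := by
  refine T.eq_simplexes_of_closed hW.subset hW.nonempty fun φ hφ i φ' hφ' i' hcom => ?_
  by_cases hb : Disjoint ((φ ∘ faceMap i) '' simplexInterior d) W
  · exact hfin φ hφ i hb φ' hφ' i' hcom
  · exact hW.mem_of_face _ (T.face_mem d φ (hW.subset hφ) i) hb φ' hφ' i' hcom.symm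

theorem IsWhiteSet.union_blackComplex [IsManifold (𝓡 (d + 1)) ∞ M] [T2Space M] [ConnectedSpace M]
    (hW : IsWhiteSet T P W) (hfin : IsFinished T P W) : W ∪ blackComplex T W = univ := by
  refine eq_univ_of_forall fun x => ?_
  have hx : x ∈ ⋃ ρ ∈ T.simplexes (d + 1), range ρ :=
    T.iUnion_range_eq_univ d.succ_pos ▸ mem_univ x
  rw [← hW.eq_simplexes hfin] at hx
  simp only [mem_iUnion] at hx
  obtain ⟨φ, hφ, y, rfl⟩ := hx
  refine (hW.cover φ hφ y).imp_right ?_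
  rintro ⟨ψ, hψ, j, hy, hd⟩
  exact mem_biUnion (x := ψ ∘ faceMap j) ⟨T.face_mem d ψ (hW.subset hψ) j, hd⟩ hy

theorem IsWhiteSet.disjoint_blackComplex (hW : IsWhiteSet T P W) :
    Disjoint W (blackComplex T W) := by
  rw [disjoint_left]
  intro x hx hxK
  simp only [blackComplex, mem_iUnion] at hxK
  obtain ⟨τ, ⟨hτ, hd⟩, y, rfl⟩ := hxK
  obtain ⟨l, hl, ρ, hρ, z, hz, hzy, hsub⟩ := hW.exists_simplex _ hx
  have hy := T.mem_interior_of_eq hτ hρ hl hz hzy.symm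
  exact disjoint_left.1 hd ⟨y, hy, rfl⟩ hx

end Extension

/-! ### The speed of curves in a simplex -/

section Speed

variable {n : ℕ} {M : Type u} [TopologicalSpace M] [ChartedSpace (EuclideanSpace ℝ (Fin n)) M]
  [IsManifold (𝓡 n) ∞ M]
  [Bundle.RiemannianBundle (fun x : M => TangentSpace (𝓡 n) x)]

/-- In a smooth simplex, the speed of a curve with respect to the Riemannian metric is a continuous
function of the position and the velocity in barycentric coordinates. -/
theorem IsSmoothSimplex.exists_speed
    [IsContMDiffRiemannianBundle (𝓡 n) ∞ (EuclideanSpace ℝ (Fin n))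
      (fun x : M => TangentSpace (𝓡 n) x)]
    {l : ℕ} {φ : Simplex l → M}
    (h : IsSmoothSimplex (n := n) φ) :
    ∃ s : (Fin (l + 1) → ℝ) → (Fin (l + 1) → ℝ) → ℝ,
      ContinuousOn (fun q : (Fin (l + 1) → ℝ) × (Fin (l + 1) → ℝ) => s q.1 q.2)
        (stdSimplex ℝ (Fin (l + 1)) ×ˢ univ) ∧
      (∀ p ∈ stdSimplex ℝ (Fin (l + 1)), ∀ v, ∑ j, v j = 0 → v ≠ 0 → 0 < s p v) ∧
      ∀ (γ : ℝ → M) (c : ℝ → Fin (l + 1) → ℝ) (v : Fin (l + 1) → ℝ) (t : ℝ), HasDerivAt c v t →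
        (∀ᶠ r in 𝓝 t, ∃ z : Simplex l, z.1 = c r ∧ γ r = φ z) →
        ‖mfderiv 𝓘(ℝ, ℝ) (𝓡 n) γ t (1 : ℝ)‖ = s (c t) v := by
  obtain ⟨U, f, hUo, hU, hf, hsm, -, hinj⟩ := h
  have hIM : IsManifold (𝓡 n) 1 M := IsManifold.of_le (n := ∞) (by norm_cast)
  have hcR : IsContinuousRiemannianBundle (EuclideanSpace ℝ (Fin n))
      (fun x : M => TangentSpace (𝓡 n) x) := by
    obtain ⟨g, hg, h⟩ := IsContMDiffRiemannianBundle.exists_contMDiff (IB := 𝓡 n) (n := ∞)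
      (F := EuclideanSpace ℝ (Fin n)) (E := fun x : M => TangentSpace (𝓡 n) x)
    exact ⟨g, hg.continuous, h⟩
  refine ⟨fun p v => ‖mfderiv 𝓘(ℝ, Fin (l + 1) → ℝ) (𝓡 n) f p v‖, ?_, ?_, ?_⟩
  · have h1 : ContinuousOn (tangentMapWithin 𝓘(ℝ, Fin (l + 1) → ℝ) (𝓡 n) f U)
        (Bundle.TotalSpace.proj ⁻¹' U) :=
      hsm.continuousOn_tangentMapWithin (by simp) hUo.uniqueMDiffOn
    have h2 : Continuous (fun q : (Fin (l + 1) → ℝ) × (Fin (l + 1) → ℝ) =>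
        (tangentBundleModelSpaceHomeomorph 𝓘(ℝ, Fin (l + 1) → ℝ)).symm q) :=
      (tangentBundleModelSpaceHomeomorph 𝓘(ℝ, Fin (l + 1) → ℝ)).symm.continuous
    have h3 : ContinuousOn (fun q : (Fin (l + 1) → ℝ) × (Fin (l + 1) → ℝ) =>
        (⟨f q.1, mfderiv 𝓘(ℝ, Fin (l + 1) → ℝ) (𝓡 n) f q.1 q.2⟩ : TangentBundle (𝓡 n) M))
        (U ×ˢ univ) := by
      refine (h1.comp h2.continuousOn fun q hq => hq.1).congr fun q hq => ?_
      change _ = (⟨f q.1, mfderivWithin 𝓘(ℝ, Fin (l + 1) → ℝ) (𝓡 n) f U q.1 q.2⟩ :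
        TangentBundle (𝓡 n) M)
      rw [mfderivWithin_of_isOpen hUo hq.1]
    have h4 := (h3.inner_bundle h3).sqrt
    refine (h4.mono (prod_mono hU Subset.rfl)).congr fun q _ => ?_
    exact norm_eq_sqrt_real_inner _
  · intro p hp v hv hv0
    exact norm_pos_iff.2 fun h0 => hv0 (hinj p (hU hp) hp.2 v hv h0)
  · intro γ c v t hc hγ
    obtain ⟨z, hz, -⟩ := hγ.self_of_nhds
    have hγf : γ =ᶠ[𝓝 t] f ∘ c := by
      filter_upwards [hγ] with r hr
      obtain ⟨z, hz, hγz⟩ := hr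
      rw [hγz, Function.comp_apply, ← hz]
      exact (hf z).symm
    have hct : c t ∈ U := hz ▸ hU z.2
    have hfd : MDifferentiableAt 𝓘(ℝ, Fin (l + 1) → ℝ) (𝓡 n) f (c t) :=
      ((hsm _ hct).contMDiffAt (hUo.mem_nhds hct)).mdifferentiableAt (by simp)
    have hcd : HasMFDerivAt 𝓘(ℝ, ℝ) 𝓘(ℝ, Fin (l + 1) → ℝ) c t
        (ContinuousLinearMap.toSpanSingleton ℝ v) := hc.hasFDerivAt.hasMFDerivAt
    have hcomp := (hfd.hasMFDerivAt.comp t hcd).congr_of_eventuallyEq hγf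
    have e : mfderiv 𝓘(ℝ, ℝ) (𝓡 n) γ t (1 : ℝ) =
        mfderiv 𝓘(ℝ, Fin (l + 1) → ℝ) (𝓡 n) f (c t) ((1 : ℝ) • v) :=
      DFunLike.congr_fun hcomp.mfderiv (1 : ℝ)
    rw [one_smul] at e
    have hpt : γ t = f (c t) := hγf.self_of_nhds
    -- the norms of the two tangent spaces at the same point
    have aux : ∀ x y : M, x = y → ∀ (w : TangentSpace (𝓡 n) x) (w' : TangentSpace (𝓡 n) y),
        (w : EuclideanSpace ℝ (Fin n)) = w' → ‖w‖ = ‖w'‖ := by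
      rintro x _ rfl w w' rfl
      rfl
    exact aux _ _ hpt _ _ e

end Speed

/-! ### Integrals of piecewise continuous functions -/

/-- A function that is chosen, at every point, among finitely many functions that are continuous on
closed sets, is continuous at all points where the possible values agree. -/
theorem continuousAt_select {X Y ι : Type*} [TopologicalSpace X] [TopologicalSpace Y] [Finite ι]
    {S : ι → Set X} (hS : ∀ j, IsClosed (S j)) {s : ι → X → Y} (hs : ∀ j, ContinuousOn (s j) (S j))
    {sel : X → ι} (hsel : ∀ x, x ∈ S (sel x)) {x₀ : X} {y : Y}
    (hy : ∀ j, x₀ ∈ S j → s j x₀ = y) : ContinuousAt (fun x => s (sel x) x) x₀ := by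
  intro N hN
  replace hN : N ∈ 𝓝 (s (sel x₀) x₀) := hN
  rw [hy _ (hsel x₀)] at hN
  have h : ∀ j, ∀ᶠ x in 𝓝 x₀, x ∈ S j → s j x ∈ N := by
    intro j
    by_cases hj : x₀ ∈ S j
    · have := hs j x₀ hj
      rw [ContinuousWithinAt, hy j hj] at this
      exact eventually_nhdsWithin_iff.1 (this hN)
    · filter_upwards [(hS j).isOpen_compl.mem_nhds hj] with x hx hxj
      exact absurd hxj hx
  change ∀ᶠ x in 𝓝 x₀, s (sel x) x ∈ N
  filter_upwards [eventually_all.2 h] with x hx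
  exact hx _ (hsel x)

open MeasureTheory in
/-- The integral over `[r, 1]` depends continuously on `r` and on a parameter if the integrand is
bounded and continuous in the parameter at almost every point. -/
theorem continuous_integral_to_one {X : Type*} [TopologicalSpace X] [FirstCountableTopology X]
    {H : X → ℝ → ℝ} {B : ℝ} (hB : ∀ x t, |H x t| ≤ B)
    (hm : ∀ x, AEStronglyMeasurable (H x) (volume.restrict (Ioo 0 1)))
    (hc : ∀ x, ∀ᵐ t ∂(volume.restrict (Ioo 0 1)), ContinuousAt (fun x => H x t) x) :
    Continuous fun p : X × I => ∫ t in (p.2 : ℝ)..1, H p.1 t := by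
  have e : (fun p : X × I => ∫ t in (p.2 : ℝ)..1, H p.1 t) =
      fun p : X × I => ∫ t in Ioo (0 : ℝ) 1, (Ioi (p.2 : ℝ)).indicator (H p.1) t := by
    funext p
    rw [intervalIntegral.integral_of_le p.2.2.2, integral_Ioc_eq_integral_Ioo,
      setIntegral_indicator measurableSet_Ioi]
    congr 2
    ext t
    simp only [mem_Ioo, mem_inter_iff, mem_Ioi]
    have := p.2.2.1
    constructor
    · rintro ⟨h1, h2⟩
      exact ⟨⟨by linarith, h2⟩, h1⟩
    · rintro ⟨⟨_, h2⟩, h1⟩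
      exact ⟨h1, h2⟩
  rw [e, continuous_iff_continuousAt]
  rintro ⟨x₀, r₀⟩
  refine continuousAt_of_dominated (bound := fun _ => B) (Eventually.of_forall fun p =>
    (hm p.1).indicator measurableSet_Ioi) (Eventually.of_forall fun p => ae_of_all _ fun t => ?_)
    (integrable_const B) ?_
  · refine (norm_indicator_le_norm_self _ _).trans ?_
    exact hB p.1 t
  · have hne : ∀ᵐ t : ℝ ∂(volume.restrict (Ioo 0 1)), t ≠ r₀ := by
      refine ae_restrict_of_ae ?_
      exact Measure.ae_ne volume _
    filter_upwards [hc x₀, hne] with t ht htr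
    have hH : ContinuousAt (fun p : X × I => H p.1 t) (x₀, r₀) :=
      ContinuousAt.comp (f := Prod.fst) (x := (x₀, r₀)) ht continuousAt_fst
    have hr : ContinuousAt (fun p : X × I => (p.2 : ℝ)) (x₀, r₀) :=
      (continuous_subtype_val.comp continuous_snd).continuousAt
    rcases htr.lt_or_gt with h | h
    · refine (continuousAt_const (y := (0 : ℝ))).congr ?_
      filter_upwards [hr.eventually (lt_mem_nhds h)] with p hp
      rw [indicator_of_notMem]
      exact not_lt.2 (le_of_lt hp)
    · refine hH.congr ?_
      filter_upwards [hr.eventually (gt_mem_nhds h)] with p hp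
      rw [indicator_of_mem]
      exact hp

/-! ### The lengths of the broken lines -/

section Length

theorem radialPoint_val {l : ℕ} (u : Simplex l) (r : I) :
    (radialPoint u r).1 = (simplexCentre l).1 + (r : ℝ) • (u.1 - (simplexCentre l).1) := by
  change AffineMap.lineMap (simplexCentre l).1 u.1 (r : ℝ) = _
  rw [AffineMap.lineMap_apply, vsub_eq_sub, vadd_eq_add]
  exact add_comm _ _

theorem radialPoint_apply {l : ℕ} (u : Simplex l) (r : I) (j : Fin (l + 1)) :
    radialPoint u r j = ((l : ℝ) + 1)⁻¹ + r * (u j - ((l : ℝ) + 1)⁻¹) := by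
  have := congrFun (radialPoint_val u r) j
  rw [← simplexCentre_apply j]
  exact this

theorem continuous_radialPoint {l : ℕ} :
    Continuous fun p : Simplex l × I => radialPoint p.1 p.2 := by
  refine Continuous.subtype_mk (f := fun p : Simplex l × I =>
    AffineMap.lineMap (simplexCentre l).1 p.1.1 (p.2 : ℝ)) ?_ _
  have : (fun p : Simplex l × I => AffineMap.lineMap (simplexCentre l).1 p.1.1 (p.2 : ℝ)) =
      fun p : Simplex l × I =>
        (simplexCentre l).1 + (p.2 : ℝ) • (p.1.1 - (simplexCentre l).1) :=
    funext fun p => radialPoint_val p.1 p.2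
  rw [this]
  fun_prop

variable {d : ℕ} {M : Type u} [TopologicalSpace M]
  [ChartedSpace (EuclideanSpace ℝ (Fin (d + 1))) M] [IsManifold (𝓡 (d + 1)) ∞ M]
  [Bundle.RiemannianBundle (fun x : M => TangentSpace (𝓡 (d + 1)) x)]

/-- The image of the interval from the centre to `u`, parametrized by the real line. -/
noncomputable def radialCurve {l : ℕ} {M : Type u} (g : Simplex l → M) (u : Simplex l) (t : ℝ) :
    M :=
  g (radialPoint u (projIcc 0 1 zero_le_one t))

open MeasureTheory in
/-- The lengths of the images of the intervals `[r, 1]` on the rays from the centre, under a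
piecewise linear map of the standard simplex, are finite and positive and depend continuously on the
ray and on `r`. A ray meets the boundary of a convex piece in a null set of parameters; at all other
parameters the speed of the image does not depend on the choice of a piece and is continuous in the
ray, so that the integral is continuous by dominated convergence. -/
theorem HasLinearPieces.exists_length
    [IsContMDiffRiemannianBundle (𝓡 (d + 1)) ∞ (EuclideanSpace ℝ (Fin (d + 1)))
      (fun x : M => TangentSpace (𝓡 (d + 1)) x)]
    {g : Simplex (d + 1) → M} {P : Set (Simplex (d + 1) → M)} (h : HasLinearPieces g P univ)
    (hP : ∀ φ ∈ P, IsSmoothSimplex (n := d + 1) φ) :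
    ∃ L : Simplex (d + 1) × I → ℝ, Continuous L ∧ (∀ u, L (u, 1) = 0) ∧
      (∀ u, u ≠ simplexCentre (d + 1) → StrictAnti fun r => L (u, r)) ∧
      ∀ u, u ≠ simplexCentre (d + 1) → ∀ r : I,
        Manifold.pathELength (𝓡 (d + 1)) (radialCurve g u) r 1 = ENNReal.ofReal (L (u, r)) := by
  obtain ⟨s, hs, hp, hcov⟩ := h
  have hfin : Finite s := hs
  choose sp hspc hsppos hsp using fun j : s => (hP _ (hp j.1 j.2).mem).exists_speed
  -- directions
  have hdir : ∀ u : Simplex (d + 1), ∑ j, (u.1 - (simplexCentre (d + 1)).1) j = 0 := fun u => by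
    simp only [Pi.sub_apply, Finset.sum_sub_distrib]
    rw [u.2.2, (simplexCentre (d + 1)).2.2, sub_self]
  -- the speed of the ray in the direction `u` in a piece
  let S : s → Set (Simplex (d + 1) × Simplex (d + 1)) := fun j => {q | q.1.1 ∈ j.1.1}
  let v : s → Simplex (d + 1) × Simplex (d + 1) → ℝ := fun j q =>
    sp j (j.1.2.1 q.1.1) (j.1.2.1 (q.2.1 - (simplexCentre (d + 1)).1))
  have hAmem : ∀ (j : s) (y : Simplex (d + 1)), y.1 ∈ j.1.1 →
      j.1.2.1 y.1 ∈ stdSimplex ℝ (Fin (d + 2)) := fun j y hy => by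
    obtain ⟨z, hz, -⟩ := (hp j.1 j.2).eq y hy
    exact hz ▸ z.2
  have hScl : ∀ j, IsClosed (S j) := fun j =>
    (hp j.1 j.2).isClosed.preimage (continuous_subtype_val.comp continuous_fst)
  have hvc : ∀ j, ContinuousOn (v j) (S j) := fun j => by
    refine (hspc j).comp (f := fun q : Simplex (d + 1) × Simplex (d + 1) =>
      (j.1.2.1 q.1.1, j.1.2.1 (q.2.1 - (simplexCentre (d + 1)).1))) ?_
      fun q hq => ⟨hAmem j q.1 hq, mem_univ _⟩
    fun_prop
  choose sel hsel hselm using fun y : Simplex (d + 1) => hcov y (mem_univ _)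
  let H : Simplex (d + 1) × Simplex (d + 1) → ℝ := fun q => v ⟨sel q.1, hsel q.1⟩ q
  have hHpos : ∀ q : Simplex (d + 1) × Simplex (d + 1), q.2 ≠ simplexCentre (d + 1) →
      0 < H q := by
    intro q hq
    refine hsppos _ _ (hAmem ⟨sel q.1, hsel q.1⟩ q.1 (hselm q.1)) _ ?_ ?_
    · rw [(hp _ (hsel q.1)).sum_eq]; exact hdir q.2
    · intro h0
      refine hq (Subtype.ext (sub_eq_zero.1 ((hp _ (hsel q.1)).injective ?_)))
      rw [map_zero]; exact h0
  obtain ⟨B, hB⟩ : ∃ B, ∀ q, |H q| ≤ B := by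
    have : ∀ j, ∃ B, ∀ q ∈ S j, ‖v j q‖ ≤ B := fun j =>
      (hScl j).isCompact.exists_bound_of_continuousOn (hvc j)
    choose b hb using this
    have := Fintype.ofFinite s
    obtain ⟨B, hB⟩ := Finite.exists_le b
    exact ⟨B, fun q => (hb ⟨sel q.1, hsel q.1⟩ q (hselm q.1)).trans (hB _)⟩
  -- the parameters at which a ray enters or leaves a piece
  let slice : Simplex (d + 1) → s → Set ℝ := fun u j =>
    {t | AffineMap.lineMap (simplexCentre (d + 1)).1 u.1 t ∈ j.1.1}
  let bad : Simplex (d + 1) → Set ℝ := fun u => ⋃ j, frontier (slice u j)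
  have hbad : ∀ u, volume (bad u) = 0 := fun u => by
    refine measure_iUnion_null fun j => ?_
    exact Convex.addHaar_frontier volume ((hp j.1 j.2).convex.affine_preimage _)
  have hbadc : ∀ u, IsClosed (bad u) := fun u => isClosed_iUnion_of_finite fun j =>
    isClosed_frontier
  let ray : Simplex (d + 1) → ℝ → Simplex (d + 1) := fun u t =>
    radialPoint u (projIcc 0 1 zero_le_one t)
  have hray : ∀ u, ∀ t ∈ Icc (0 : ℝ) 1,
      (ray u t).1 = AffineMap.lineMap (simplexCentre (d + 1)).1 u.1 t := fun u t ht => by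
    simp only [ray, projIcc_of_mem zero_le_one ht]
    rfl
  have hrayc : Continuous fun q : Simplex (d + 1) × ℝ => (ray q.1 q.2, q.1) :=
    (continuous_radialPoint.comp (continuous_fst.prodMk
      ((continuous_projIcc (h := zero_le_one' ℝ)).comp continuous_snd))).prodMk continuous_fst
  -- at all other parameters, the speed of the curve is the one of every piece
  have hval : ∀ u, ∀ t ∈ Ioo (0 : ℝ) 1, t ∉ bad u → ∀ j, (ray u t, u) ∈ S j →
      v j (ray u t, u) = ‖mfderiv 𝓘(ℝ, ℝ) (𝓡 (d + 1)) (radialCurve g u) t (1 : ℝ)‖ := by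
    intro u t ht htb j hj
    have htI : t ∈ Icc (0 : ℝ) 1 := ⟨ht.1.le, ht.2.le⟩
    have hjs : t ∈ slice u j := by
      change (ray u t).1 ∈ j.1.1 at hj
      rwa [hray u t htI] at hj
    have hint : t ∈ interior (slice u j) := by
      by_contra hni
      exact htb (mem_iUnion.2 ⟨j, subset_closure hjs, hni⟩)
    have hder : HasDerivAt (fun r : ℝ =>
        j.1.2.1 (AffineMap.lineMap (simplexCentre (d + 1)).1 u.1 r))
        (j.1.2.1 (u.1 - (simplexCentre (d + 1)).1)) t :=
      j.1.2.1.hasFDerivAt.comp_hasDerivAt t AffineMap.hasDerivAt_lineMap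
    have := hsp j (radialCurve g u) _ _ t hder ?_
    · rw [this]
      simp only [v, hray u t htI]
    · filter_upwards [isOpen_interior.mem_nhds hint, Ioo_mem_nhds ht.1 ht.2] with r hr hr'
      have hrI : r ∈ Icc (0 : ℝ) 1 := ⟨hr'.1.le, hr'.2.le⟩
      have hrs : (ray u r).1 ∈ j.1.1 := by
        rw [hray u r hrI]
        exact (interior_subset hr : r ∈ slice u j)
      obtain ⟨z, hz, hgz⟩ := (hp j.1 j.2).eq (ray u r) hrs
      exact ⟨z, by rw [hz, ← hray u r hrI]; rfl, hgz⟩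
  have hHc : ∀ u, ∀ t ∈ Ioo (0 : ℝ) 1, t ∉ bad u →
      ContinuousAt (fun q : Simplex (d + 1) × ℝ => H (ray q.1 q.2, q.1)) (u, t) := by
    intro u t ht htb
    have h1 : ContinuousAt H (ray u t, u) :=
      continuousAt_select (sel := fun q : Simplex (d + 1) × Simplex (d + 1) =>
        (⟨sel q.1, hsel q.1⟩ : s)) hScl hvc (fun q => hselm q.1) (hval u t ht htb)
    exact ContinuousAt.comp (f := fun q : Simplex (d + 1) × ℝ => (ray q.1 q.2, q.1)) (x := (u, t))
      h1 hrayc.continuousAt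
  have hae : ∀ u, ∀ᵐ t ∂(volume.restrict (Ioo (0 : ℝ) 1)), t ∈ Ioo (0 : ℝ) 1 ∧ t ∉ bad u :=
    fun u => (ae_restrict_mem measurableSet_Ioo).and
      (ae_restrict_of_ae (measure_eq_zero_iff_ae_notMem.1 (hbad u)))
  have hm : ∀ u, AEStronglyMeasurable (fun t => H (ray u t, u)) (volume.restrict (Ioo 0 1)) := by
    intro u
    have hopen : IsOpen (Ioo (0 : ℝ) 1 \ bad u) := isOpen_Ioo.sdiff (hbadc u)
    have hcon : ContinuousOn (fun t => H (ray u t, u)) (Ioo (0 : ℝ) 1 \ bad u) := by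
      intro t ht
      refine ContinuousAt.continuousWithinAt ?_
      exact ContinuousAt.comp (f := fun t : ℝ => (u, t)) (x := t) (hHc u t ht.1 ht.2)
        (by fun_prop)
    have := hcon.aestronglyMeasurable (μ := volume) hopen.measurableSet
    rwa [Measure.restrict_congr_set (sdiff_null_ae_eq_self (hbad u))] at this
  have hint : ∀ (u : Simplex (d + 1)) (a b : ℝ), 0 ≤ a → a ≤ b → b ≤ 1 →
      IntervalIntegrable (fun t => H (ray u t, u)) volume a b := by
    intro u a b ha hab hb
    rw [intervalIntegrable_iff_integrableOn_Ioo_of_le hab]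
    refine Integrable.of_bound ?_ B (ae_of_all _ fun t => hB _)
    exact (hm u).mono_measure (Measure.restrict_mono (Ioo_subset_Ioo ha hb) le_rfl)
  refine ⟨fun p => ∫ t in (p.2 : ℝ)..1, H (ray p.1 t, p.1), ?_, ?_, ?_, ?_⟩
  · refine continuous_integral_to_one (B := B) (fun u t => hB _) hm fun u => ?_
    filter_upwards [hae u] with t ht
    exact ContinuousAt.comp (f := fun u : Simplex (d + 1) => (u, t)) (x := u) (hHc u t ht.1 ht.2)
      (by fun_prop)
  · intro u
    simp
  · intro u hu r r' hrr'
    have hrr : (r : ℝ) < r' := hrr'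
    have hadd := intervalIntegral.integral_add_adjacent_intervals
      (hint u r r' r.2.1 hrr.le r'.2.2) (hint u r' 1 r'.2.1 r'.2.2 le_rfl)
    have hpos := intervalIntegral.intervalIntegral_pos_of_pos
      (hint u r r' r.2.1 hrr.le r'.2.2) (fun t => hHpos (ray u t, u) hu) hrr
    simp only
    linarith
  · intro u hu r
    rw [Manifold.pathELength_eq_lintegral_mfderiv_Ioo]
    simp only
    rw [intervalIntegral.integral_of_le r.2.2, integral_Ioc_eq_integral_Ioo,
      ofReal_integral_eq_lintegral_ofReal]
    · refine lintegral_congr_ae ?_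
      filter_upwards [ae_mono (Measure.restrict_mono (Ioo_subset_Ioo_left r.2.1) le_rfl) (hae u)]
        with t ht
      have e : H (ray u t, u) = _ := hval u t ht.1 ht.2 ⟨sel (ray u t), hsel _⟩ (hselm _)
      rw [e]
      exact (ofReal_norm _).symm
    · exact (intervalIntegrable_iff_integrableOn_Ioo_of_le r.2.2).1 (hint u r 1 r.2.1 r.2.2 le_rfl)
    · exact ae_of_all _ fun t => (hHpos (ray u t, u) hu).le

end Length

/-! ### Polar coordinates in the simplex -/

section Polar

variable {l : ℕ}

/-- The radial coordinate: `0` at the centre and `1` on the boundary. -/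
noncomputable def simplexRadius (y : Simplex l) : ℝ := 1 - (l + 1) * ⨅ j, y j

theorem continuous_simplexRadius : Continuous (simplexRadius : Simplex l → ℝ) := by
  have h : Continuous fun y : Simplex l => ⨅ j, y j := by
    have e : (fun y : Simplex l => ⨅ j, y j) =
        fun y : Simplex l => Finset.univ.inf' Finset.univ_nonempty fun j => y j := by
      funext y
      rw [Finset.inf'_univ_eq_ciInf]
    rw [e]
    exact Continuous.finset_inf'_apply _ fun j _ => continuous_simplex_apply j
  exact continuous_const.sub (continuous_const.mul h)

theorem simplexRadius_le_one (y : Simplex l) : simplexRadius y ≤ 1 := by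
  have h : 0 ≤ ⨅ j, y j := Real.iInf_nonneg fun k => stdSimplex.zero_le y k
  have : 0 ≤ ((l : ℝ) + 1) * ⨅ j, y j := by positivity
  rw [simplexRadius]; linarith

theorem simplexRadius_pos {y : Simplex l} (hy : y ≠ simplexCentre l) : 0 < simplexRadius y := by
  by_contra h
  have hl : (0 : ℝ) < l + 1 := by positivity
  have hm : ((l : ℝ) + 1)⁻¹ ≤ ⨅ j, y j := by
    rw [inv_le_iff_one_le_mul₀' hl]
    rw [simplexRadius] at h
    linarith
  have hle : ∀ j, 0 ≤ y j - ((l : ℝ) + 1)⁻¹ := fun j =>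
    sub_nonneg.2 (hm.trans (iInf_simplex_le y j))
  have hs : ∑ j, (y j - ((l : ℝ) + 1)⁻¹) = 0 := by
    have : ∑ j, y j = 1 := stdSimplex.sum_eq_one y
    rw [Finset.sum_sub_distrib, this]
    simp [hl.ne']
  refine hy (simplex_ext fun j => ?_)
  have := (Finset.sum_eq_zero_iff_of_nonneg fun j _ => hle j).1 hs j (Finset.mem_univ j)
  rw [simplexCentre_apply]
  linarith

/-- Every point but the centre lies on the ray towards a point of the boundary. The coordinates of
that point are given since they show that it depends continuously on `y`. -/
theorem exists_radialPoint_eq (y : Simplex l) (hy : y ≠ simplexCentre l) :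
    ∃ u ∈ simplexBoundary l, (∀ j, u j = ((l : ℝ) + 1)⁻¹ + (y j - ((l : ℝ) + 1)⁻¹) /
      simplexRadius y) ∧ ∀ r : I, (r : ℝ) = simplexRadius y → radialPoint u r = y := by
  have hl : (0 : ℝ) < l + 1 := by positivity
  have hr := simplexRadius_pos hy
  have hm : ((⨅ j, y j) - ((l : ℝ) + 1)⁻¹) / simplexRadius y = -((l : ℝ) + 1)⁻¹ := by
    rw [div_eq_iff hr.ne', simplexRadius]
    field_simp
    ring
  have hsum : ∑ j, (((l : ℝ) + 1)⁻¹ + (y j - ((l : ℝ) + 1)⁻¹) / simplexRadius y) = 1 := by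
    have : ∑ j, y j = 1 := stdSimplex.sum_eq_one y
    rw [Finset.sum_add_distrib, ← Finset.sum_div, Finset.sum_sub_distrib, this]
    simp [hl.ne']
  refine ⟨⟨fun j => ((l : ℝ) + 1)⁻¹ + (y j - ((l : ℝ) + 1)⁻¹) / simplexRadius y, fun j => ?_,
    hsum⟩, ?_, fun j => rfl, fun r hre => ?_⟩
  · have : ((⨅ j, y j) - ((l : ℝ) + 1)⁻¹) / simplexRadius y ≤
        (y j - ((l : ℝ) + 1)⁻¹) / simplexRadius y := by
      gcongr
      exact iInf_simplex_le y j
    simp only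
    linarith
  · obtain ⟨j, hj⟩ := exists_eq_iInf_simplex y
    refine ⟨j, ?_⟩
    change ((l : ℝ) + 1)⁻¹ + (y j - ((l : ℝ) + 1)⁻¹) / simplexRadius y = 0
    rw [hj, hm]; ring
  · refine simplex_ext fun j => ?_
    rw [radialPoint_apply, hre]
    change ((l : ℝ) + 1)⁻¹ + simplexRadius y *
      ((((l : ℝ) + 1)⁻¹ + (y j - ((l : ℝ) + 1)⁻¹) / simplexRadius y) - ((l : ℝ) + 1)⁻¹) = y j
    field_simp
    ring

theorem radialPoint_one (u : Simplex l) : radialPoint u 1 = u :=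
  simplex_ext fun j => by rw [radialPoint_apply, Icc.coe_one]; ring

theorem radialPoint_mem_interior (u : Simplex l) {r : I} (hr : r < 1) :
    radialPoint u r ∈ simplexInterior l := fun j => by
  have h1 : (r : ℝ) < 1 := hr
  have h0 : (0 : ℝ) ≤ r := r.2.1
  have hu : 0 ≤ u j := stdSimplex.zero_le u j
  have hl : (0 : ℝ) < ((l : ℝ) + 1)⁻¹ := by positivity
  rw [radialPoint_apply]
  nlinarith [mul_nonneg h0 hu, mul_pos (sub_pos.2 h1) hl]

theorem radialPoint_ne_centre {u : Simplex l} (hu : u ≠ simplexCentre l) {r : I} (hr : 0 < r) :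
    radialPoint u r ≠ simplexCentre l := by
  intro h
  refine hu (simplex_ext fun j => ?_)
  have h0 : (0 : ℝ) < r := hr
  have := congrArg (fun z : Simplex l => z j) h
  simp only [radialPoint_apply, simplexCentre_apply] at this
  rw [simplexCentre_apply]
  have := (mul_eq_zero.1 (by linarith : (r : ℝ) * (u j - ((l : ℝ) + 1)⁻¹) = 0)).resolve_left h0.ne'
  linarith

theorem ne_centre_of_mem_boundary {u : Simplex l} (hu : u ∈ simplexBoundary l) :
    u ≠ simplexCentre l := by
  rintro rfl
  exact not_mem_simplexInterior_iff.2 hu (simplexCentre_mem_interior l)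

/-- Polar coordinates of the punctured simplex. -/
theorem exists_polar : ∃ (dir : {y : Simplex l // y ≠ simplexCentre l} → Simplex l)
    (rad : {y : Simplex l // y ≠ simplexCentre l} → I), Continuous dir ∧ Continuous rad ∧
    ∀ y, dir y ∈ simplexBoundary l ∧ 0 < rad y ∧ radialPoint (dir y) (rad y) = y := by
  choose dir hb hd hrad using fun y : {y : Simplex l // y ≠ simplexCentre l} =>
    exists_radialPoint_eq y.1 y.2
  refine ⟨dir, fun y => ⟨simplexRadius y.1, (simplexRadius_pos y.2).le, simplexRadius_le_one _⟩,
    ?_, ?_, fun y => ⟨hb y, simplexRadius_pos y.2, hrad y _ rfl⟩⟩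
  · refine Continuous.subtype_mk (f := fun y => (dir y).1) ?_ _
    refine continuous_pi fun j => ?_
    have : (fun y => (dir y).1 j) = fun y : {y : Simplex l // y ≠ simplexCentre l} =>
        ((l : ℝ) + 1)⁻¹ + (y.1 j - ((l : ℝ) + 1)⁻¹) / simplexRadius y.1 := funext fun y => hd y j
    rw [this]
    refine continuous_const.add (Continuous.div ?_ ?_ fun y => (simplexRadius_pos y.2).ne')
    · exact ((continuous_simplex_apply j).comp continuous_subtype_val).sub continuous_const
    · exact continuous_simplexRadius.comp continuous_subtype_val
  · exact (continuous_simplexRadius.comp continuous_subtype_val).subtype_mk _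

end Polar

/-! ### Motion along the rays with prescribed length -/

/-- Let `L x` be decreasing functions on `[0, 1]` with `L x 1 = 0` that depend continuously on `x`.
Then the parameter at which `L x` is the fraction `1 - t` of its value at `r` is unique and depends
continuously on `x`, `r` and `t`, since its graph is closed and `[0, 1]` is compact. -/
theorem exists_continuous_reparam {X : Type*} [TopologicalSpace X] {L : X × I → ℝ}
    (hL : Continuous L) (h1 : ∀ x, L (x, 1) = 0) (hanti : ∀ x, StrictAnti fun r => L (x, r)) :
    ∃ ρ : X × I × I → I, Continuous ρ ∧
      ∀ x r t, L (x, ρ (x, r, t)) = (1 - (t : ℝ)) * L (x, r) ∧ r ≤ ρ (x, r, t) := by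
  have ex : ∀ q : X × I × I, ∃ s : I, L (q.1, s) = (1 - (q.2.2 : ℝ)) * L (q.1, q.2.1) := by
    rintro ⟨x, r, t⟩
    have hpos : 0 ≤ L (x, r) := (h1 x) ▸ (hanti x).antitone (le_top (a := r) : r ≤ 1)
    have ht0 := t.2.1
    have ht1 := t.2.2
    have hc : Continuous fun s : I => L (x, s) := hL.comp (by fun_prop)
    obtain ⟨s, -, hs⟩ := intermediate_value_Icc' (le_top (a := r) : r ≤ 1)
      (f := fun s : I => L (x, s)) hc.continuousOn
      (show (1 - (t : ℝ)) * L (x, r) ∈ Icc (L (x, 1)) (L (x, r)) from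
        ⟨by rw [h1]; exact mul_nonneg (by linarith) hpos, by nlinarith⟩)
    exact ⟨s, hs⟩
  choose ρ hρ using ex
  refine ⟨ρ, ?_, fun x r t => ⟨hρ (x, r, t), ?_⟩⟩
  · rw [continuous_iff_isClosed]
    intro F hF
    have e : ρ ⁻¹' F = Prod.fst '' ({p : (X × I × I) × I |
        L (p.1.1, p.2) = (1 - (p.1.2.2 : ℝ)) * L (p.1.1, p.1.2.1)} ∩ Prod.snd ⁻¹' F) := by
      ext q
      constructor
      · intro hq
        exact ⟨(q, ρ q), ⟨hρ q, hq⟩, rfl⟩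
      · rintro ⟨⟨q, s⟩, ⟨hs, hsF⟩, rfl⟩
        have : ρ q = s := (hanti q.1).injective ((hρ q).trans hs.symm)
        exact (this ▸ hsF : ρ q ∈ F)
    rw [e]
    refine isClosedMap_fst_of_compactSpace _ (IsClosed.inter ?_ (hF.preimage continuous_snd))
    exact isClosed_eq (hL.comp (by fun_prop))
      ((continuous_const.sub (by fun_prop)).mul (hL.comp (by fun_prop)))
  · have hpos : 0 ≤ L (x, r) := (h1 x) ▸ (hanti x).antitone (le_top (a := r) : r ≤ 1)
    refine (hanti x).le_iff_ge.1 ?_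
    have := hρ (x, r, t)
    simp only at this ⊢
    rw [this]
    nlinarith [t.2.1]

/-! ### The deformation retraction -/

/-- A homotopy upstairs that is compatible with the fibres of a continuous surjection `g` of a
compact space onto a Hausdorff space descends to every subspace of the image: `g` is proper, so its
restriction times the interval is still a quotient map. -/
theorem exists_descended_homotopy {Y X : Type*} [TopologicalSpace Y] [TopologicalSpace X]
    [CompactSpace Y] [T2Space X] {g : Y → X} (hg : Continuous g) (hs : Function.Surjective g)
    {p : X → Prop} {R : {y : Y // p (g y)} × I → {y : Y // p (g y)}} (hR : Continuous R)
    (hfib : ∀ (y y' : {y : Y // p (g y)}) (t : I), g y = g y' → g (R (y, t)) = g (R (y', t))) :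
    ∃ F : C({x : X // p x} × I, {x : X // p x}),
      ∀ (y : {y : Y // p (g y)}) (t : I), (F (⟨g y, y.2⟩, t) : X) = g (R (y, t)) := by
  let q : {y : Y // p (g y)} → {x : X // p x} := fun y => ⟨g y, y.2⟩
  have hqc : Continuous q := (hg.comp continuous_subtype_val).subtype_mk _
  have hqs : Function.Surjective q := by
    rintro ⟨x, hx⟩
    obtain ⟨y, rfl⟩ := hs x
    exact ⟨⟨y, hx⟩, rfl⟩
  have hqp : IsProperMap q := hg.isProperMap.restrictPreimage {x | p x}
  have hQ : IsQuotientMap (Prod.map q (id : I → I)) :=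
    (hqp.prodMap isProperMap_id).isClosedMap.isQuotientMap (hqc.prodMap continuous_id)
      (hqs.prodMap Function.surjective_id)
  obtain ⟨sec, hsec⟩ := hqs.hasRightInverse
  have key : ∀ y t, q (R (sec (q y), t)) = q (R (y, t)) := fun y t =>
    Subtype.ext (hfib _ _ t (congrArg Subtype.val (hsec (q y))))
  refine ⟨⟨fun z => q (R (sec z.1, z.2)), hQ.continuous_iff.2 ?_⟩, fun y t =>
    congrArg Subtype.val (key y t)⟩
  have : (fun z : {x : X // p x} × I => q (R (sec z.1, z.2))) ∘ Prod.map q (id : I → I) =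
      q ∘ R := funext fun z => key z.1 z.2
  rw [this]
  exact hqc.comp hR

section Retraction

variable {d : ℕ} {M : Type u} {φ₀ : Simplex (d + 1) → M} {P : Set (Simplex (d + 1) → M)}
  {W : Set M} {f : M → M} {g : Simplex (d + 1) → M}

theorem tendsto_radialPoint {l : ℕ} (u : Simplex l) :
    Tendsto (fun t : ℝ => radialPoint u (projIcc 0 1 zero_le_one t)) (𝓝[<] 1) (𝓝 u) := by
  have hc : Continuous fun t : ℝ => radialPoint u (projIcc 0 1 zero_le_one t) :=
    continuous_radialPoint.comp (continuous_const.prodMk (continuous_projIcc (h := zero_le_one)))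
  have h := hc.tendsto 1
  rw [projIcc_right, show (⟨1, right_mem_Icc.2 zero_le_one⟩ : I) = 1 from rfl,
    radialPoint_one] at h
  exact h.mono_left nhdsWithin_le_nhds

theorem radialPoint_projIcc_mem_interior {l : ℕ} (u : Simplex l) {t : ℝ} (ht : t < 1) :
    radialPoint u (projIcc 0 1 zero_le_one t) ∈ simplexInterior l :=
  radialPoint_mem_interior u (Subtype.coe_lt_coe.1 (by
    rw [coe_projIcc]; exact max_lt one_pos (min_lt_of_right_lt ht)))

theorem IsCharacteristicMap.eq_centre_iff (hg : IsCharacteristicMap φ₀ P W f g)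
    {y : Simplex (d + 1)} :
    g y = φ₀ (simplexCentre (d + 1)) ↔ y = simplexCentre (d + 1) := by
  have hc := simplexCentre_mem_interior (d + 1)
  refine ⟨fun h => ?_, fun h => h ▸ hg.centre⟩
  by_cases hy : y ∈ simplexInterior (d + 1)
  · exact hg.bijOn.injOn hy hc (h.trans hg.centre.symm)
  · refine absurd ?_ (hg.boundary y (not_mem_simplexInterior_iff.1 hy))
    rw [h, ← hg.centre]
    exact hg.bijOn.mapsTo hc

theorem IsCharacteristicMap.mem_iff (hg : IsCharacteristicMap φ₀ P W f g)
    {y : Simplex (d + 1)} : g y ∈ W ↔ y ∈ simplexInterior (d + 1) :=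
  ⟨fun h => by_contra fun hy => hg.boundary y (not_mem_simplexInterior_iff.1 hy) h,
    fun h => hg.bijOn.mapsTo h⟩

theorem IsCharacteristicMap.brokenLine_eq (hg : IsCharacteristicMap φ₀ P W f g)
    (u : Simplex (d + 1)) {t : ℝ} (ht : t < 1) : brokenLine φ₀ f u t = radialCurve g u t :=
  hg.eq _ (radialPoint_projIcc_mem_interior u ht)

variable [TopologicalSpace M] [ChartedSpace (EuclideanSpace ℝ (Fin (d + 1))) M]
  {T : SmoothTriangulation (d + 1) M}

/-- The characteristic map is onto: the white points are dense, since they contain the inner parts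
of all simplexes of maximal dimension. -/
theorem IsCharacteristicMap.surjective [IsManifold (𝓡 (d + 1)) ∞ M] [T2Space M] [CompactSpace M]
    [ConnectedSpace M]
    (hg : IsCharacteristicMap φ₀ P W f g) (hW : IsWhiteSet T P W) (hfin : IsFinished T P W)
    (hgc : Continuous g) : Function.Surjective g := by
  intro x
  have hx : x ∈ ⋃ ρ ∈ T.simplexes (d + 1), range ρ := by
    rw [T.iUnion_range_eq_univ d.succ_pos]; trivial
  simp only [mem_iUnion] at hx
  obtain ⟨ρ, hρ, y, rfl⟩ := hx
  have hcl : IsClosed (range g) := (isCompact_range hgc).isClosed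
  have hlim : Tendsto (fun t : ℝ => ρ (radialPoint y (projIcc 0 1 zero_le_one t))) (𝓝[<] 1)
      (𝓝 (ρ y)) := ((T.continuous hρ).tendsto y).comp (tendsto_radialPoint y)
  refine hcl.mem_of_tendsto hlim ?_
  filter_upwards [self_mem_nhdsWithin] with t ht
  rw [← hW.eq_simplexes hfin] at hρ
  have hw := hW.inner_subset ρ hρ ⟨_, radialPoint_projIcc_mem_interior y ht, rfl⟩
  exact (hg.bijOn.image_eq ▸ image_subset_range g _ : W ⊆ range g) hw

/-- The deformation along the broken lines: on the ray through a point `y` of the closed simplex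
the point with the fraction `1 - t` of the remaining length is well defined and continuous, and the
motion descends along the characteristic map, which identifies boundary points only. -/
theorem IsCharacteristicMap.exists_deformation [IsManifold (𝓡 (d + 1)) ∞ M]
    [Bundle.RiemannianBundle (fun x : M => TangentSpace (𝓡 (d + 1)) x)]
    [IsContMDiffRiemannianBundle (𝓡 (d + 1)) ∞ (EuclideanSpace ℝ (Fin (d + 1)))
      (fun x : M => TangentSpace (𝓡 (d + 1)) x)] [T2Space M]
    (hg : IsCharacteristicMap φ₀ P W f g) (hP : ∀ φ ∈ P, IsSmoothSimplex (n := d + 1) φ)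
    (hgc : Continuous g) (hs : Function.Surjective g) :
    ∃ F : C({x : M // x ≠ φ₀ (simplexCentre (d + 1))} × I,
        {x : M // x ≠ φ₀ (simplexCentre (d + 1))}),
      (∀ x, F (x, 0) = x) ∧
      (∀ x, (F (x, 1) : M) ∉ W) ∧
      (∀ (x : {x : M // x ≠ φ₀ (simplexCentre (d + 1))}) (t : I), (x : M) ∉ W → F (x, t) = x) ∧
      ∀ x : {x : M // x ≠ φ₀ (simplexCentre (d + 1))}, (x : M) ∈ W →
        ∃ u ∈ simplexBoundary (d + 1), ∃ r ∈ Ioo (0 : ℝ) 1,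
          brokenLine φ₀ f u r = x ∧
          Tendsto (brokenLine φ₀ f u) (𝓝[<] 1) (𝓝 (F (x, 1) : M)) ∧
          Manifold.pathELength (𝓡 (d + 1)) (brokenLine φ₀ f u) r 1 ≠ 0 ∧
          Manifold.pathELength (𝓡 (d + 1)) (brokenLine φ₀ f u) r 1 ≠ ⊤ ∧
          ∀ t : I, t < 1 → ∃ r' ∈ Ico r 1,
            (F (x, t) : M) = brokenLine φ₀ f u r' ∧
            Manifold.pathELength (𝓡 (d + 1)) (brokenLine φ₀ f u) r' 1 =
              ENNReal.ofReal (1 - t) *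
                Manifold.pathELength (𝓡 (d + 1)) (brokenLine φ₀ f u) r 1 := by
  obtain ⟨L, hLc, hL1, hanti, hlen⟩ := hg.pieces.exists_length hP
  obtain ⟨dir, rad, hdc, hrc, hpol⟩ := exists_polar (l := d + 1)
  obtain ⟨ρ, hρc, hρ⟩ := exists_continuous_reparam
    (X := {u : Simplex (d + 1) // u ≠ simplexCentre (d + 1)})
    (L := fun p => L (p.1.1, p.2)) (hLc.comp (by fun_prop)) (fun x => hL1 x)
    (fun x => hanti x x.2)
  -- the direction and the radius of a point whose image is not the centre
  have hne : ∀ y : {y : Simplex (d + 1) // g y ≠ φ₀ (simplexCentre (d + 1))},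
      y.1 ≠ simplexCentre (d + 1) := fun y h => y.2 (hg.eq_centre_iff.2 h)
  let e : {y : Simplex (d + 1) // g y ≠ φ₀ (simplexCentre (d + 1))} →
      {y : Simplex (d + 1) // y ≠ simplexCentre (d + 1)} := fun y => ⟨y.1, hne y⟩
  have hec : Continuous e := continuous_subtype_val.subtype_mk _
  let D : {y : Simplex (d + 1) // y ≠ simplexCentre (d + 1)} →
      {u : Simplex (d + 1) // u ≠ simplexCentre (d + 1)} :=
    fun y => ⟨dir y, ne_centre_of_mem_boundary (hpol y).1⟩
  have hDc : Continuous D := hdc.subtype_mk _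
  let S : {y : Simplex (d + 1) // y ≠ simplexCentre (d + 1)} → I → I :=
    fun y t => ρ (D y, rad y, t)
  have hSL : ∀ y t, L (dir y, S y t) = (1 - (t : ℝ)) * L (dir y, rad y) :=
    fun y t => (hρ (D y) (rad y) t).1
  have hSle : ∀ y t, rad y ≤ S y t := fun y t => (hρ (D y) (rad y) t).2
  have hinj : ∀ y, Function.Injective fun r => L (dir y, r) := fun y => (hanti _ (D y).2).injective
  have hS0 : ∀ y, S y 0 = rad y := fun y => hinj y (by simp [hSL])
  have hS1 : ∀ y, S y 1 = 1 := fun y => hinj y (by simp [hSL, hL1])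
  let R : {y : Simplex (d + 1) // g y ≠ φ₀ (simplexCentre (d + 1))} × I →
      {y : Simplex (d + 1) // g y ≠ φ₀ (simplexCentre (d + 1))} := fun z =>
    ⟨radialPoint (dir (e z.1)) (S (e z.1) z.2), fun h =>
      radialPoint_ne_centre (D (e z.1)).2 ((hpol (e z.1)).2.1.trans_le (hSle _ _))
        (hg.eq_centre_iff.1 h)⟩
  have hRc : Continuous R := by
    refine Continuous.subtype_mk (continuous_radialPoint.comp
      ((hdc.comp (hec.comp continuous_fst)).prodMk (hρc.comp ?_))) _
    exact (hDc.comp (hec.comp continuous_fst)).prodMk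
      ((hrc.comp (hec.comp continuous_fst)).prodMk continuous_snd)
  -- points of the boundary do not move, so that the motion is compatible with the fibres of `g`
  have hRb : ∀ y t, y.1 ∈ simplexBoundary (d + 1) → R (y, t) = y := by
    intro y t hy
    have hr : rad (e y) = 1 := by
      by_contra h
      have := radialPoint_mem_interior (dir (e y)) (lt_top_iff_ne_top.2 h)
      rw [(hpol (e y)).2.2] at this
      exact not_mem_simplexInterior_iff.2 hy this
    have hS : S (e y) t = rad (e y) := le_antisymm (hr ▸ le_top (a := S (e y) t)) (hSle _ _)
    refine Subtype.ext ?_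
    change radialPoint (dir (e y)) (S (e y) t) = y.1
    rw [hS, (hpol (e y)).2.2]
  obtain ⟨F, hF⟩ := exists_descended_homotopy hgc hs (p := fun x => x ≠ φ₀ (simplexCentre (d + 1)))
    hRc (fun y y' t h => by
      by_cases hy : y.1 ∈ simplexInterior (d + 1)
      · have hy' : y'.1 ∈ simplexInterior (d + 1) := hg.mem_iff.1 (h ▸ hg.mem_iff.2 hy)
        rw [Subtype.ext (hg.bijOn.injOn hy hy' h)]
      · have hy' : y'.1 ∉ simplexInterior (d + 1) := fun h' =>
          hy (hg.mem_iff.1 (h ▸ hg.mem_iff.2 h'))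
        rw [hRb y t (not_mem_simplexInterior_iff.1 hy),
          hRb y' t (not_mem_simplexInterior_iff.1 hy'), h])
  have hF1 : ∀ y : {y : Simplex (d + 1) // g y ≠ φ₀ (simplexCentre (d + 1))},
      (F (⟨g y, y.2⟩, 1) : M) = g (dir (e y)) := fun y => by
    rw [hF y 1]
    change g (radialPoint (dir (e y)) (S (e y) 1)) = _
    rw [hS1, radialPoint_one]
  refine ⟨F, ?_, ?_, ?_, ?_⟩
  · rintro ⟨x, hx⟩
    obtain ⟨y, rfl⟩ := hs x
    refine Subtype.ext ((hF ⟨y, hx⟩ 0).trans ?_)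
    change g (radialPoint (dir (e ⟨y, hx⟩)) (S (e ⟨y, hx⟩) 0)) = g y
    rw [hS0, (hpol _).2.2]
  · rintro ⟨x, hx⟩
    obtain ⟨y, rfl⟩ := hs x
    rw [hF1 ⟨y, hx⟩]
    exact hg.boundary _ (hpol _).1
  · rintro ⟨x, hx⟩ t hxW
    obtain ⟨y, rfl⟩ := hs x
    refine Subtype.ext ((hF ⟨y, hx⟩ t).trans ?_)
    rw [hRb _ t (not_mem_simplexInterior_iff.1 fun h => hxW (hg.mem_iff.2 h))]
  · rintro ⟨x, hx⟩ hxW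
    obtain ⟨y, rfl⟩ := hs x
    have hy : y ∈ simplexInterior (d + 1) := hg.mem_iff.1 hxW
    set z := e ⟨y, hx⟩ with hz
    have hr1 : rad z < 1 := by
      refine lt_top_iff_ne_top.2 fun h => ?_
      have h2 := (hpol z).2.2
      rw [h, show (⊤ : I) = 1 from rfl, radialPoint_one] at h2
      refine not_mem_simplexInterior_iff.2 (hpol z).1 ?_
      rw [h2]
      exact hy
    have hlen' : ∀ r : I, Manifold.pathELength (𝓡 (d + 1)) (brokenLine φ₀ f (dir z)) r 1 =
        ENNReal.ofReal (L (dir z, r)) := fun r => by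
      rw [← hlen _ (D z).2 r]
      exact Manifold.pathELength_congr_Ioo fun t ht => hg.brokenLine_eq _ ht.2
    have hbl : ∀ r : I, r < 1 → brokenLine φ₀ f (dir z) r = g (radialPoint (dir z) r) :=
      fun r hr => by
        rw [hg.brokenLine_eq _ (show (r : ℝ) < 1 from hr), radialCurve, projIcc_val]
    have hpos : 0 < L (dir z, rad z) := hL1 (dir z) ▸ hanti _ (D z).2 hr1
    refine ⟨dir z, (hpol z).1, rad z, ⟨(hpol z).2.1, hr1⟩, ?_, ?_, ?_, ?_, fun t ht => ?_⟩
    · rw [hbl _ hr1, (hpol z).2.2]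
    · rw [hF1 ⟨y, hx⟩]
      refine ((hgc.tendsto _).comp (tendsto_radialPoint (dir z))).congr' ?_
      filter_upwards [self_mem_nhdsWithin] with t ht
      exact (hg.brokenLine_eq _ ht).symm
    · rw [hlen']
      exact (ENNReal.ofReal_pos.2 hpos).ne'
    · rw [hlen']
      exact ENNReal.ofReal_ne_top
    · have ht1 : (0 : ℝ) < 1 - t := sub_pos.2 ht
      have hS : S z t < 1 := by
        refine lt_top_iff_ne_top.2 fun h => ?_
        have := hSL z t
        rw [h, show (⊤ : I) = 1 from rfl, hL1] at this
        exact (mul_pos ht1 hpos).ne this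
      refine ⟨S z t, ⟨hSle z t, hS⟩, ?_, ?_⟩
      · rw [hbl _ hS]
        exact hF ⟨y, hx⟩ t
      · rw [hlen', hlen', hSL, ENNReal.ofReal_mul ht1.le]

end Retraction

/-! ### Homotopy equivalence and singular homology -/

section Homology

open CategoryTheory AlgebraicTopology

/-- Homotopy equivalent spaces have isomorphic singular homology groups. -/
theorem ContinuousMap.HomotopyEquiv.nonempty_singularHomology_iso {X Y : Type u}
    [TopologicalSpace X] [TopologicalSpace Y] (h : X ≃ₕ Y) (A : AddCommGrpCat.{u}) (k : ℕ) :
    Nonempty (((singularHomologyFunctor AddCommGrpCat.{u} k).obj A).obj (TopCat.of X) ≅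
      ((singularHomologyFunctor AddCommGrpCat.{u} k).obj A).obj (TopCat.of Y)) := by
  obtain ⟨H₁⟩ := h.left_inv
  obtain ⟨H₂⟩ := h.right_inv
  let p : TopCat.of X ⟶ TopCat.of Y := TopCat.ofHom h.toFun
  let q : TopCat.of Y ⟶ TopCat.of X := TopCat.ofHom h.invFun
  have h₁ : TopCat.Homotopy (p ≫ q) (𝟙 _) := H₁
  have h₂ : TopCat.Homotopy (q ≫ p) (𝟙 _) := H₂
  let G := (singularHomologyFunctor AddCommGrpCat.{u} k).obj A
  have e₁ : G.map (p ≫ q) = G.map (𝟙 _) :=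
    h₁.congr_homologyMap_singularChainComplexFunctor A k
  have e₂ : G.map (q ≫ p) = G.map (𝟙 _) :=
    h₂.congr_homologyMap_singularChainComplexFunctor A k
  exact ⟨⟨G.map p, G.map q, by rw [← G.map_comp, e₁, G.map_id],
    by rw [← G.map_comp, e₂, G.map_id]⟩⟩

/-- A strong deformation retraction of a subspace `{x // p x}` to `K` is a homotopy equivalence. -/
theorem nonempty_homotopyEquiv_of_retraction {X : Type u} [TopologicalSpace X] {p : X → Prop}
    {K : Set X} (hK : ∀ x ∈ K, p x) (F : C({x : X // p x} × I, {x : X // p x}))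
    (h0 : ∀ x, F (x, 0) = x) (h1 : ∀ x, (F (x, 1) : X) ∈ K)
    (hfix : ∀ (x : {x : X // p x}) (t : I), (x : X) ∈ K → F (x, t) = x) :
    Nonempty ({x : X // p x} ≃ₕ K) := by
  let r : C({x : X // p x}, K) :=
    ⟨fun x => ⟨F (x, 1), h1 x⟩, Continuous.subtype_mk (by fun_prop) _⟩
  let i : C(K, {x : X // p x}) :=
    ⟨fun x => ⟨x, hK x x.2⟩, continuous_subtype_val.subtype_mk _⟩
  have hri : r.comp i = ContinuousMap.id K :=
    ContinuousMap.ext fun x => Subtype.ext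
      (congrArg (Subtype.val : {x : X // p x} → X) (hfix (i x) 1 x.2))
  have H : ContinuousMap.Homotopy (ContinuousMap.id {x : X // p x}) (i.comp r) :=
    { toFun := fun z => F (z.2, z.1)
      continuous_toFun := by fun_prop
      map_zero_left := fun x => h0 x
      map_one_left := fun x => rfl }
  exact ⟨⟨r, i, ⟨H.symm⟩, hri ▸ ContinuousMap.Homotopic.refl _⟩⟩

end Homology

theorem theorem2 {d : ℕ} {M : Type u} [TopologicalSpace M] [T2Space M] [CompactSpace M]
    [ConnectedSpace M] [ChartedSpace (EuclideanSpace ℝ (Fin (d + 1))) M]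
    [IsManifold (𝓡 (d + 1)) ∞ M]
    [Bundle.RiemannianBundle (fun x : M => TangentSpace (𝓡 (d + 1)) x)]
    [IsContMDiffRiemannianBundle (𝓡 (d + 1)) ∞ (EuclideanSpace ℝ (Fin (d + 1)))
      (fun x : M => TangentSpace (𝓡 (d + 1)) x)]
    (T : SmoothTriangulation (d + 1) M)
    (φ₀ : Simplex (d + 1) → M) (hφ₀ : φ₀ ∈ T.simplexes (d + 1))
    (P : Set (Simplex (d + 1) → M)) (C : Set M) (f : M → M)
    (hrun : CellExtension T φ₀ P C f) (hfin : IsFinished T P C)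
    (c₀ : M) (hc₀ : c₀ = φ₀ (simplexCentre (d + 1)))
    (K : Set M) (hK : K = blackComplex T C) :
    -- the decomposition of `M` into the cell and the complex
    C ∪ K = univ ∧ Disjoint C K ∧
    BijOn (f ∘ φ₀) (simplexInterior (d + 1)) C ∧
    -- the deformation retraction along the broken lines
    (∃ F : C({x : M // x ≠ c₀} × I, {x : M // x ≠ c₀}),
      (∀ x, F (x, 0) = x) ∧
      (∀ x, (F (x, 1) : M) ∈ K) ∧
      (∀ (x : {x : M // x ≠ c₀}) (t : I), (x : M) ∈ K → F (x, t) = x) ∧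
      ∀ x : {x : M // x ≠ c₀}, (x : M) ∈ C →
        ∃ u ∈ simplexBoundary (d + 1), ∃ r ∈ Ioo (0 : ℝ) 1,
          brokenLine φ₀ f u r = x ∧
          Tendsto (brokenLine φ₀ f u) (𝓝[<] 1) (𝓝 (F (x, 1) : M)) ∧
          Manifold.pathELength (𝓡 (d + 1)) (brokenLine φ₀ f u) r 1 ≠ 0 ∧
          Manifold.pathELength (𝓡 (d + 1)) (brokenLine φ₀ f u) r 1 ≠ ⊤ ∧
          ∀ t : I, t < 1 → ∃ r' ∈ Ico r 1,
            (F (x, t) : M) = brokenLine φ₀ f u r' ∧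
            Manifold.pathELength (𝓡 (d + 1)) (brokenLine φ₀ f u) r' 1 =
              ENNReal.ofReal (1 - t) *
                Manifold.pathELength (𝓡 (d + 1)) (brokenLine φ₀ f u) r 1) ∧
    -- homotopy equivalence and isomorphism of singular homology
    Nonempty ({x : M // x ≠ c₀} ≃ₕ K) ∧
    ∀ (A : AddCommGrpCat.{u}) (k : ℕ),
      Nonempty
        (((AlgebraicTopology.singularHomologyFunctor AddCommGrpCat.{u} k).obj A).obj
            (TopCat.of {x : M // x ≠ c₀}) ≅
          ((AlgebraicTopology.singularHomologyFunctor AddCommGrpCat.{u} k).obj A).obj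
            (TopCat.of K)) := by
  subst hc₀ hK
  obtain ⟨hW, g, hg⟩ := hrun.invariants hφ₀
  have hP : ∀ φ ∈ P, IsSmoothSimplex (n := d + 1) φ := fun φ hφ =>
    T.smooth _ φ (hW.subset hφ)
  have hgc : Continuous g := hg.pieces.continuous fun φ hφ => T.continuous (hW.subset hφ)
  have hcover := hW.union_blackComplex hfin
  have hdisj : Disjoint C (blackComplex T C) := hW.disjoint_blackComplex
  have hmem : ∀ x, x ∈ blackComplex T C ↔ x ∉ C := fun x =>
    ⟨fun hx hC => disjoint_left.1 hdisj hC hx, fun hx =>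
      (hcover.symm ▸ mem_univ x : x ∈ C ∪ blackComplex T C).resolve_left hx⟩
  obtain ⟨F, hF0, hF1, hFK, hFC⟩ :=
    hg.exists_deformation hP hgc (hg.surjective hW hfin hgc)
  obtain ⟨h⟩ := nonempty_homotopyEquiv_of_retraction
    (p := fun x => x ≠ φ₀ (simplexCentre (d + 1))) (K := blackComplex T C)
    (fun x hx hxc => (hmem x).1 hx (hxc ▸
      hW.inner_subset φ₀ hg.mem ⟨_, simplexCentre_mem_interior _, rfl⟩))
    F hF0 (fun x => (hmem _).2 (hF1 x)) (fun x t hx => hFK x t ((hmem _).1 hx))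
  exact ⟨hcover, hdisj, hg.bijOn.congr fun y hy => (hg.eq y hy).symm,
    ⟨F, hF0, fun x => (hmem _).2 (hF1 x), fun x t hx => hFK x t ((hmem _).1 hx), hFC⟩,
    ⟨h⟩, fun A k => h.nonempty_singularHomology_iso A k⟩
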